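/- **Wavelet trees.** Let $s$ be a string of length $n$ over the alphabet $\{0,\dots,\sigma-1\}$, where $2\le\sigma\le n$, and let $k=\lceil\log_2\sigma\rceil$, so that characters are $k$-bit numbers. The (binary) wavelet tree of $s$ is the perfect binary tree of height $k$ defined recursively as follows. The bitmask $B_r$ of the root $r$ is the sequence of the most significant bits of the characters of $s$. The left (right) subtree of $r$ is the wavelet tree, over $(k-1)$-bit characters, of the subsequence of $s$ consisting of the characters whose most significant bit is $0$ (respectively $1$), with this bit removed. A tree of height $0$ is a leaf and has no bitmask. Nodes are numbered like in a heap: the root has number $1$, and the left and right children of node $h$ have numbers $2h$ and $2h+1$. **Model.** A word RAM with word length $w$ has a fixed finite program, registers holding $w$-bit words, and a memory of $2^w$ cells of $w$ bits each. It executes at unit cost: loading a constant, loading from and storing to memory, jumps, comparisons, and on words addition, subtraction and multiplication modulo $2^w$, integer division and remainder, bitwise and, or, xor, and shifts. A list of bits is packed by storing bit $i$ (counted from $0$) as bit $i \bmod w$ of the $\lfloor i/w\rfloor$-th word, with unused bits equal to $0$. Initially, three registers hold $n$, $\sigma$ and $w$, the others are $0$; the memory holds, starting at address $0$, the string $s$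 as a packed list of $k$-bit blocks, one per character (each with its least significant bit first), and zeros elsewhere. **Theorem.** There are a single (deterministic) word RAM program and constants $c_0$ and $C$ such that, for all integers $2\le\sigma\le n$, every string $s$ of length $n$ over $\{0,\dots,\sigma-1\}$ and every word length $w\ge\lceil\log_2 n\rceil+c_0$, the program halts on $s$ after at most $$C\cdot\frac{n\log_2\sigma}{\sqrt{\log_2 n}}$$ steps, and then all bitmasks $B_u$ of the wavelet tree of $s$ are stored in memory: each $B_u$ is packed into $\lceil |B_u|/w\rceil$ consecutive cells, starting at a new word, the sets of cells occupied by different bitmasks being disjoint; and for some address $d$, given in a register, the cells $d+2h$ and $d+2h+1$ contain the starting address and the length of the bitmask of the internal node with number $h$. -/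

import Mathlib

/-! ### Wavelet trees -/

/-- The shape of a binary wavelet tree: every internal node `u` carries its bitmask `B_u`. -/
inductive WaveletTree : Type
  | leaf : WaveletTree
  | node (bitmask : List Bool) (left right : WaveletTree) : WaveletTree

/-- The wavelet tree of a string over the alphabet `[0, 2 ^ k - 1]`, its characters being read as
`k`-bit numbers.  The root stores the most significant bits of the characters; the string is then
split (stably) according to that bit, the bit is removed, and the construction recurses.  It stops
when the alphabet is unary. -/
def waveletTree : ℕ → List ℕ → WaveletTree
  | 0, _ => WaveletTree.leaf
  | k + 1, s =>
      WaveletTree.node (s.map fun c => c.testBit k)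
        (waveletTree k ((s.filter fun c => !c.testBit k).map fun c => c % 2 ^ k))
        (waveletTree k ((s.filter fun c => c.testBit k).map fun c => c % 2 ^ k))

/-- The bitmask of the internal node with label `l`, the label being the sequence of edge labels
on the path from the root (`false` = left, `true` = right); `none` if there is no such internal
node. -/
def WaveletTree.bitmaskAt : WaveletTree → List Bool → Option (List Bool)
  | WaveletTree.leaf, _ => none
  | WaveletTree.node B _ _, [] => some B
  | WaveletTree.node _ left _, false :: l => left.bitmaskAt l
  | WaveletTree.node _ _ right, true :: l => right.bitmaskAt l

/-- Heap-like numbering of the nodes: the root is `1`, the children of `h` are `2 h`, `2 h + 1`. -/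
def heapIndex (l : List Bool) : ℕ :=
  l.foldl (fun h b => 2 * h + b.toNat) 1

/-! ### The word RAM with `w`-bit words -/

namespace WordRAM

/-- The binary word operations, all of unit cost. -/
inductive BinOp : Type
  | add | sub | mul | div | mod | and | or | xor | shl | shr

/-- Arithmetic is modulo `2 ^ w`, division and remainder are unsigned, shifts are logical. -/
def BinOp.eval {w : ℕ} : BinOp → BitVec w → BitVec w → BitVec w
  | BinOp.add, x, y => x + y
  | BinOp.sub, x, y => x - y
  | BinOp.mul, x, y => x * y
  | BinOp.div, x, y => x.udiv y
  | BinOp.mod, x, y => x.umod y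
  | BinOp.and, x, y => x &&& y
  | BinOp.or, x, y => x ||| y
  | BinOp.xor, x, y => x ^^^ y
  | BinOp.shl, x, y => x <<< y.toNat
  | BinOp.shr, x, y => x >>> y.toNat

/-- Instructions.  Registers are numbered; a program mentions only finitely many of them. -/
inductive Instr : Type
  /-- `R[dst] := c mod 2 ^ w` -/
  | const (dst c : ℕ)
  /-- `R[dst] := R[a] op R[b]` -/
  | op (o : BinOp) (dst a b : ℕ)
  /-- `R[dst] := M[R[addr]]` -/
  | load (dst addr : ℕ)
  /-- `M[R[addr]] := R[src]` -/
  | store (addr src : ℕ)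
  /-- `goto target` -/
  | jump (target : ℕ)
  /-- `if R[a] = R[b] then goto target` -/
  | jumpEq (a b target : ℕ)
  /-- `if R[a] < R[b] then goto target` (unsigned comparison) -/
  | jumpLt (a b target : ℕ)
  /-- stop -/
  | halt

/-- A program is a finite list of instructions; it does not depend on the word length `w`. -/
abbrev Program : Type := List Instr

/-- A configuration: program counter, registers, and a memory of `2 ^ w` cells of `w` bits. -/
structure Config (w : ℕ) : Type where
  pc : ℕ
  reg : ℕ → BitVec w
  mem : BitVec w → BitVec w

/-- Execution of one instruction (for `halt`, the configuration does not change). -/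
def Instr.exec {w : ℕ} (c : Config w) : Instr → Config w
  | Instr.const dst k =>
      { c with pc := c.pc + 1, reg := Function.update c.reg dst (BitVec.ofNat w k) }
  | Instr.op o dst a b =>
      { c with pc := c.pc + 1, reg := Function.update c.reg dst (o.eval (c.reg a) (c.reg b)) }
  | Instr.load dst addr =>
      { c with pc := c.pc + 1, reg := Function.update c.reg dst (c.mem (c.reg addr)) }
  | Instr.store addr src =>
      { c with pc := c.pc + 1, mem := Function.update c.mem (c.reg addr) (c.reg src) }
  | Instr.jump target => { c with pc := target }
  | Instr.jumpEq a b target =>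
      { c with pc := if c.reg a = c.reg b then target else c.pc + 1 }
  | Instr.jumpLt a b target =>
      { c with pc := if (c.reg a).toNat < (c.reg b).toNat then target else c.pc + 1 }
  | Instr.halt => c

/-- The instruction about to be executed; outside the program text it is `halt`. -/
def Program.current (P : Program) {w : ℕ} (c : Config w) : Instr :=
  (P[c.pc]?).getD Instr.halt

/-- One step of the program. -/
def Program.step (P : Program) {w : ℕ} (c : Config w) : Config w :=
  (P.current c).exec c

/-- The configuration reached after `t` steps. -/
def Program.run (P : Program) {w : ℕ} (t : ℕ) (c : Config w) : Config w :=
  (P.step)^[t] c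

/-- The program has stopped. -/
def Program.Halted (P : Program) {w : ℕ} (c : Config w) : Prop :=
  P.current c = Instr.halt

/-! ### Packed representation -/

/-- The `j`-th word of a bit list packed into `w`-bit words: bit `i` of the list is bit `i % w`
(counted from the least significant one) of word `i / w`; unused bits are `0`. -/
def packedWord (w : ℕ) (bits : List Bool) (j : ℕ) : BitVec w :=
  BitVec.ofFnLE fun i : Fin w => bits.getD (j * w + i) false

/-- A list of `b`-bit integers as a list of bits, one block of `b` bits (least significant bit
first) for each entry. -/
def entryBits (b : ℕ) (s : List ℕ) : List Bool :=
  s.flatMap fun c => (List.range b).map fun i => c.testBit i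

/-- The initial configuration for a string `s` over `[0, σ - 1]`: the memory holds, from address
`0` on, `s` as a packed list of `⌈log₂ σ⌉`-bit integers, and zeros after it; registers
`0, 1, 2` hold the length of `s`, the alphabet size `σ` and the word length `w`, and all other
registers are `0`. -/
def initial (w σ : ℕ) (s : List ℕ) : Config w where
  pc := 0
  reg := fun r =>
    if r = 0 then BitVec.ofNat w s.length
    else if r = 1 then BitVec.ofNat w σ
    else if r = 2 then BitVec.ofNat w w
    else 0
  mem := fun a => packedWord w (entryBits (Nat.clog 2 σ) s) a.toNat

/-- The content, as a natural number, of the memory cell with address `a`. -/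
def Config.cell {w : ℕ} (c : Config w) (a : ℕ) : ℕ :=
  (c.mem (BitVec.ofNat w a)).toNat

/-- The bit list `B` is stored in packed form in the `⌈|B| / w⌉` consecutive cells starting with
cell `a`. -/
def Config.StoresBits {w : ℕ} (c : Config w) (a : ℕ) (B : List Bool) : Prop :=
  a + B.length ⌈/⌉ w ≤ 2 ^ w ∧
    ∀ j < B.length ⌈/⌉ w, c.mem (BitVec.ofNat w (a + j)) = packedWord w B j

/-- All bitmasks of the tree `T` are stored in memory, each starting at a new word.  The node with
heap number `h` is described by the cells `d + 2 h` and `d + 2 h + 1` of a directory, where `d` is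
the content of register `0`: the first one holds the address at which its bitmask begins, the
second one the length of the bitmask.  Different bitmasks occupy disjoint sets of cells. -/
def Config.StoresBitmasks {w : ℕ} (c : Config w) (T : WaveletTree) : Prop :=
  let entry : List Bool → ℕ := fun l => (c.reg 0).toNat + 2 * heapIndex l
  (∀ l B, T.bitmaskAt l = some B →
    entry l + 1 < 2 ^ w ∧
    c.cell (entry l + 1) = B.length ∧
    c.StoresBits (c.cell (entry l)) B) ∧
  ∀ l l' B B', T.bitmaskAt l = some B → T.bitmaskAt l' = some B' → l ≠ l' →
    Disjoint
      (Set.Ico (c.cell (entry l)) (c.cell (entry l) + B.length ⌈/⌉ w))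
      (Set.Ico (c.cell (entry l')) (c.cell (entry l') + B'.length ⌈/⌉ w))

end WordRAM

/-!
# Construction of wavelet trees in `O(n log σ / √(log n))` steps

Let `k = ⌈log₂ σ⌉`, let `q = ⌊√⌊log₂ n⌋⌋` and `τ = min k q`.  The levels of the tree are grouped
into blocks of `τ` levels.  Inside a block, a node is represented by the list of its *short
characters*: of a character, only the at most `τ` bits that the block is about are kept
(`shortChar`), the bit of the current level being the leading one.  As `q * τ ≤ log₂ n`, a memory
cell has room for `q` short characters, and it has at most `n` different contents.

*Splitting the list of a node.*  A table, computed in advance (`tableLoop_within`), contains for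
every content of a cell the leading bits of its short characters, the two packed lists of those
with leading bit `0` and `1` from which this bit is removed, and the length of the latter.  With
it, a list is processed cell by cell (`splitBody_within`): the leading bits are appended to the
bitmask of the node and the two lists to the lists of its children.  This takes constant time per
cell, so that a level with `2 ^ d` nodes takes `O(n / q + 2 ^ d)` steps (`levelLoop_within`).

*Filling the lists.*  At the first level of a block, the lists contain no useful bits any more,
but their sizes are known.  They are filled in one pass over the input, which appends to the list
of each node the next short character of every character that belongs to it
(`fillLong_within`); this takes `O(n)` steps for each of the `⌈k / q⌉` blocks.  If `k ≤ q`, there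
is only one block and the short characters are the characters themselves, so that the input is
copied to the list of the root, `q` characters at a time (`fillShort_within`).

All in all, the time is `O(n * ⌈k / q⌉)` or `O(n / q)` for filling, `O(k * n / q + 2 ^ k)` for
splitting and `O(2 ^ (q * τ) + k + log n)` for the initialization, each of which is
`O(n * k / q)` (`perCell_mul_time_le`); and `k / q` is of the order of `log σ / √(log n)`
(`time_le`).

The program is written in a small structured language over natural numbers, which is compiled to
the machine (`Run.code`, `Run.program`); correctness and running time are shown together, by rules
for `Cmd.Within` and by symbolic execution of the commands without loops (`Cmd.within_of_pre`).  A
packed list is treated as a number whose digits are the contents of the cells (`Stores`), so that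
appending is an addition and reading is a division with remainder.

The memory is divided into regions that start at the following addresses: the input at `0`, the
directory at `16 * n`, for each node the number of characters in its list during a pass over the
input at `32 * n`, the table at `48 * n`, two buffers for the lists of the even and of the odd
levels at `64 * n` and `80 * n`, and the bitmasks from `96 * n` on.
-/

/-! ### A structured language that compiles to the word RAM -/

namespace WaveletRAM

open WordRAM

/-- The variables of the structured program.  Variable number `i`, in the order listed, lives in
register `i`; thus `vn`, `vsig` and `vw` are the three input registers. -/
inductive Var : Type
  | vn | vsig | vw | vk | vpk | vl | vq | vtau | vL | vpL | vpT | vdir | vptr | vtab | vnb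
    | vob | vout | vbp | vd | ve | vh | vlo | vhi | vp | vm | vrb | vi | vu | vent | vx | va
    | vs | vkd | vsa | vsb | vpw | vpb | vc | vg | vr | vy
  deriving DecidableEq

/-- The register that holds a variable. -/
def Var.idx (v : Var) : ℕ := v.ctorIdx

/-- The first of the registers used for intermediate results; it exceeds all variables. -/
abbrev scratch : ℕ := 64

theorem Var.idx_lt (v : Var) : v.idx < scratch := by
  cases v <;> simp [Var.idx, scratch, Var.ctorIdx]

theorem Var.idx_injective : Function.Injective Var.idx := by
  intro a b h
  have ha := Var.ofNat_ctorIdx a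
  have hb := Var.ofNat_ctorIdx b
  unfold Var.idx at h
  rw [← ha, ← hb, h]

/-- A state of the structured program: variables and memory with natural numbers as contents. -/
structure State : Type where
  v : Var → ℕ
  mem : ℕ → ℕ

/-- Assignment to a variable. -/
def State.set (S : State) (x : Var) (a : ℕ) : State := { S with v := Function.update S.v x a }

/-- Assignment to a memory cell. -/
def State.put (S : State) (p a : ℕ) : State := { S with mem := Function.update S.mem p a }

/-- The value of a word operation on natural numbers, under the side condition `BinOp.Ok`.
Only the left shift is truncated. -/
def opVal (w : ℕ) : BinOp → ℕ → ℕ → ℕ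
  | .add, x, y => x + y
  | .sub, x, y => x - y
  | .mul, x, y => x * y
  | .div, x, y => x / y
  | .mod, x, y => x % y
  | .and, x, y => x &&& y
  | .or, x, y => x ||| y
  | .xor, x, y => x ^^^ y
  | .shl, x, y => x * 2 ^ y % 2 ^ w
  | .shr, x, y => x / 2 ^ y

/-- The side condition under which a word operation agrees with `opVal`: no overflow in sums and
products, no negative differences. -/
def opOk (w : ℕ) : BinOp → ℕ → ℕ → Prop
  | .add, x, y => x + y < 2 ^ w
  | .sub, x, y => y ≤ x
  | .mul, x, y => x * y < 2 ^ w
  | _, _, _ => True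

theorem toNat_eval {w : ℕ} (o : BinOp) (x y : BitVec w) (h : opOk w o x.toNat y.toNat) :
    (o.eval x y).toNat = opVal w o x.toNat y.toNat := by
  cases o <;> simp only [BinOp.eval, opVal, opOk] at *
  · rw [BitVec.toNat_add, Nat.mod_eq_of_lt h]
  · rw [BitVec.toNat_sub_of_le (by simpa [BitVec.le_def] using h)]
  · rw [BitVec.toNat_mul, Nat.mod_eq_of_lt h]
  · simp
  · simp
  · simp
  · simp
  · simp
  · simp [Nat.shiftLeft_eq]
  · simp [Nat.shiftRight_eq_div_pow]

/-- Expressions over variables and memory. -/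
inductive Expr : Type
  | var (x : Var)
  | lit (c : ℕ)
  | bin (o : BinOp) (a b : Expr)
  | ld (a : Expr)

/-- The value of an expression. -/
def Expr.val (w : ℕ) (S : State) : Expr → ℕ
  | .var x => S.v x
  | .lit c => c
  | .bin o a b => opVal w o (a.val w S) (b.val w S)
  | .ld a => S.mem (a.val w S)

/-- No operation of the expression overflows. -/
def Expr.Ok (w : ℕ) (S : State) : Expr → Prop
  | .var _ => True
  | .lit c => c < 2 ^ w
  | .bin o a b => a.Ok w S ∧ b.Ok w S ∧ opOk w o (a.val w S) (b.val w S)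
  | .ld a => a.Ok w S

/-- Code that computes an expression into register `t`, using only registers from `t` on. -/
def Expr.code : Expr → ℕ → List Instr
  | .var x, t => [Instr.op BinOp.and t x.idx x.idx]
  | .lit c, t => [Instr.const t c]
  | .bin o a b, t => a.code t ++ (b.code (t + 1) ++ [Instr.op o t t (t + 1)])
  | .ld a, t => a.code t ++ [Instr.load t t]

/-- The running time of an expression. -/
def Expr.cost : Expr → ℕ
  | .var _ => 1
  | .lit _ => 1
  | .bin _ a b => a.cost + (b.cost + 1)
  | .ld a => a.cost + 1

theorem Expr.length_code (e : Expr) (t : ℕ) : (e.code t).length = e.cost := by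
  induction e generalizing t <;> simp_all [Expr.code, Expr.cost]

/-- Commands; the conditions of branches and loops are strict inequalities `a < b`. -/
inductive Cmd : Type
  | skip
  | set (x : Var) (e : Expr)
  | store (a e : Expr)
  | seq (c₁ c₂ : Cmd)
  | ite (a b : Expr) (c₁ c₂ : Cmd)
  | loop (a b : Expr) (c : Cmd)

/-- `Run w c S S' t`: with word length `w`, the command `c` leads from state `S` to state `S'` in
`t` machine steps, without overflow. -/
inductive Run (w : ℕ) : Cmd → State → State → ℕ → Prop
  | skip (S) : Run w .skip S S 0
  | set (x e S) (h : e.Ok w S) : Run w (.set x e) S (S.set x (e.val w S)) (e.cost + 1)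
  | store (a e S) (ha : a.Ok w S) (he : e.Ok w S) :
      Run w (.store a e) S (S.put (a.val w S) (e.val w S)) (a.cost + (e.cost + 1))
  | seq {c₁ c₂ S S₁ S₂ t₁ t₂} (h₁ : Run w c₁ S S₁ t₁) (h₂ : Run w c₂ S₁ S₂ t₂) :
      Run w (.seq c₁ c₂) S S₂ (t₁ + t₂)
  | ite_true {a b c₁ c₂ S S₁ t} (ha : a.Ok w S) (hb : b.Ok w S)
      (h : a.val w S < b.val w S) (h₁ : Run w c₁ S S₁ t) :
      Run w (.ite a b c₁ c₂) S S₁ (a.cost + (b.cost + 1) + t)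
  | ite_false {a b c₁ c₂ S S₁ t} (ha : a.Ok w S) (hb : b.Ok w S)
      (h : ¬ a.val w S < b.val w S) (h₂ : Run w c₂ S S₁ t) :
      Run w (.ite a b c₁ c₂) S S₁ (a.cost + (b.cost + 1) + (t + 1))
  | loop_true {a b c S S₁ S₂ t₁ t₂} (ha : a.Ok w S) (hb : b.Ok w S)
      (h : a.val w S < b.val w S) (h₁ : Run w c S S₁ t₁)
      (h₂ : Run w (.loop a b c) S₁ S₂ t₂) :
      Run w (.loop a b c) S S₂ (a.cost + (b.cost + 1) + (t₁ + 1) + t₂)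
  | loop_false {a b c S} (ha : a.Ok w S) (hb : b.Ok w S)
      (h : ¬ a.val w S < b.val w S) :
      Run w (.loop a b c) S S (a.cost + (b.cost + 1) + 1)

/-- The length of the code of a command. -/
def Cmd.size : Cmd → ℕ
  | .skip => 0
  | .set _ e => e.cost + 1
  | .store a e => a.cost + (e.cost + 1)
  | .seq c₁ c₂ => c₁.size + c₂.size
  | .ite a b c₁ c₂ => a.cost + (b.cost + 1) + (c₂.size + 1) + c₁.size
  | .loop a b c => a.cost + (b.cost + 1) + 1 + (c.size + 1)

/-- The code that evaluates `a` and `b` and jumps to `target` if `a < b`. -/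
def branchCode (a b : Expr) (target : ℕ) : List Instr :=
  a.code scratch ++ (b.code (scratch + 1) ++ [Instr.jumpLt scratch (scratch + 1) target])

/-- The code of a command that is placed at address `pos`. -/
def Cmd.code : Cmd → ℕ → List Instr
  | .skip, _ => []
  | .set x e, _ => e.code scratch ++ [Instr.op BinOp.and x.idx scratch scratch]
  | .store a e, _ =>
      a.code scratch ++ (e.code (scratch + 1) ++ [Instr.store scratch (scratch + 1)])
  | .seq c₁ c₂, pos => c₁.code pos ++ c₂.code (pos + c₁.size)
  | .ite a b c₁ c₂, pos =>
      let p₂ := pos + (a.cost + (b.cost + 1))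
      let p₁ := p₂ + (c₂.size + 1)
      branchCode a b p₁ ++ (c₂.code p₂ ++ ([Instr.jump (p₁ + c₁.size)] ++ c₁.code p₁))
  | .loop a b c, pos =>
      let p := pos + (a.cost + (b.cost + 1)) + 1
      branchCode a b p ++ ([Instr.jump (p + (c.size + 1))] ++ (c.code p ++ [Instr.jump pos]))

theorem length_branchCode (a b : Expr) (t : ℕ) :
    (branchCode a b t).length = a.cost + (b.cost + 1) := by
  simp [branchCode, Expr.length_code]

theorem Cmd.length_code (c : Cmd) (pos : ℕ) : (c.code pos).length = c.size := by
  induction c generalizing pos <;>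
    simp_all [Cmd.code, Cmd.size, Expr.length_code, length_branchCode] <;> omega

/-- A machine configuration represents a state of the structured program. -/
structure Represents {w : ℕ} (γ : Config w) (S : State) : Prop where
  reg : ∀ x : Var, (γ.reg x.idx).toNat = S.v x
  mem : ∀ a : BitVec w, (γ.mem a).toNat = S.mem a.toNat

/-- The code `code` stands in `P` at address `pos`. -/
def CodeAt (P : Program) (pos : ℕ) (code : List Instr) : Prop :=
  ∀ j < code.length, P[pos + j]? = code[j]?

theorem CodeAt.left {P : Program} {pos : ℕ} {l₁ l₂ : List Instr} (h : CodeAt P pos (l₁ ++ l₂)) :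
    CodeAt P pos l₁ := by
  intro j hj
  rw [h j (by simp; omega), List.getElem?_append_left hj]

theorem CodeAt.right {P : Program} {pos : ℕ} {l₁ l₂ : List Instr}
    (h : CodeAt P pos (l₁ ++ l₂)) : CodeAt P (pos + l₁.length) l₂ := by
  intro j hj
  have := h (l₁.length + j) (by simp; omega)
  rw [← Nat.add_assoc] at this
  rw [this, List.getElem?_append_right (by omega)]
  simp

theorem CodeAt.current {P : Program} {pos : ℕ} {i : Instr} (h : CodeAt P pos [i]) {w : ℕ}
    (γ : Config w) (hγ : γ.pc = pos) : P.step γ = i.exec γ := by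
  have := h 0 (by simp)
  simp at this
  simp [Program.step, Program.current, hγ, this]

theorem Program.run_add (P : Program) {w : ℕ} (s t : ℕ) (γ : Config w) :
    P.run (s + t) γ = P.run t (P.run s γ) := by
  simp [WordRAM.Program.run, Nat.add_comm s t, Function.iterate_add_apply]

theorem Program.run_succ (P : Program) {w : ℕ} (t : ℕ) (γ : Config w) :
    P.run (t + 1) γ = P.step (P.run t γ) := by
  simp [WordRAM.Program.run, Function.iterate_succ_apply']

/-- The code of an expression computes its value. -/
theorem Expr.run_code {w : ℕ} {P : Program} (e : Expr) {S : State} (hok : e.Ok w S) (t : ℕ)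
    (ht : scratch ≤ t) {γ : Config w} (hγ : Represents γ S) (hP : CodeAt P γ.pc (e.code t)) :
    (P.run e.cost γ).pc = γ.pc + e.cost ∧ (P.run e.cost γ).mem = γ.mem ∧
      (∀ r < t, (P.run e.cost γ).reg r = γ.reg r) ∧
      ((P.run e.cost γ).reg t).toNat = e.val w S := by
  induction e generalizing t γ with
  | var x =>
    have h := hP.current γ rfl
    have : P.run 1 γ = P.step γ := rfl
    simp only [Expr.cost, this, h, Instr.exec, BinOp.eval, Expr.val]
    refine ⟨trivial, trivial, fun r hr => ?_, ?_⟩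
    · rw [Function.update_of_ne (by omega)]
    · simp [hγ.reg]
  | lit c =>
    have h := hP.current γ rfl
    have : P.run 1 γ = P.step γ := rfl
    simp only [Expr.cost, this, h, Instr.exec, Expr.val]
    refine ⟨trivial, trivial, fun r hr => ?_, ?_⟩
    · rw [Function.update_of_ne (by omega)]
    · simpa using Nat.mod_eq_of_lt hok
  | ld a ih =>
    obtain ⟨h1, h2, h3, h4⟩ := ih hok t ht hγ hP.left
    have hP' := hP.right
    rw [Expr.length_code, ← h1] at hP'
    have h := hP'.current _ rfl
    simp only [Expr.cost, Program.run_succ, h, Instr.exec, Expr.val]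
    refine ⟨by omega, h2, fun r hr => ?_, ?_⟩
    · rw [Function.update_of_ne (by omega), h3 r hr]
    · simp [h2, hγ.mem, h4]
  | bin o a b iha ihb =>
    obtain ⟨hoa, hob, hoo⟩ := hok
    obtain ⟨h1, h2, h3, h4⟩ := iha hoa t ht hγ hP.left
    have hP' := hP.right
    rw [Expr.length_code, ← h1] at hP'
    set γ₁ := P.run a.cost γ with hγ₁
    have hr₁ : Represents γ₁ S :=
      ⟨fun x => by rw [h3 _ (x.idx_lt.trans_le ht), hγ.reg], fun y => by rw [h2, hγ.mem]⟩
    obtain ⟨g1, g2, g3, g4⟩ := ihb hob (t + 1) (by omega) hr₁ hP'.left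
    have hP'' := hP'.right
    rw [Expr.length_code, ← g1] at hP''
    have h := hP''.current _ rfl
    simp only [Expr.cost, Program.run_add, ← hγ₁, Program.run_succ P b.cost, h, Instr.exec,
      Expr.val]
    refine ⟨?_, ?_, fun r hr => ?_, ?_⟩
    · omega
    · rw [g2, h2]
    · rw [Function.update_of_ne (by omega), g3 r (by omega), h3 r hr]
    · rw [Function.update_self]
      have e1 : ((P.run b.cost γ₁).reg t).toNat = a.val w S := by rw [g3 t (by omega), h4]
      rw [toNat_eval, e1, g4]
      rwa [e1, g4]

/-- A branch evaluates its two sides and jumps accordingly. -/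
theorem run_branchCode {w : ℕ} {P : Program} (a b : Expr) {S : State} (ha : a.Ok w S)
    (hb : b.Ok w S) (target : ℕ) {γ : Config w} (hγ : Represents γ S)
    (hP : CodeAt P γ.pc (branchCode a b target)) :
    Represents (P.run (a.cost + (b.cost + 1)) γ) S ∧
      (P.run (a.cost + (b.cost + 1)) γ).pc =
        if a.val w S < b.val w S then target else γ.pc + (a.cost + (b.cost + 1)) := by
  obtain ⟨h1, h2, h3, h4⟩ := a.run_code ha scratch le_rfl hγ hP.left
  have hP' := hP.right
  rw [Expr.length_code, ← h1] at hP'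
  rw [Program.run_add]
  set γ₁ := P.run a.cost γ with hγ₁
  have hr₁ : Represents γ₁ S :=
    ⟨fun x => by rw [h3 _ x.idx_lt, hγ.reg], fun y => by rw [h2, hγ.mem]⟩
  obtain ⟨g1, g2, g3, g4⟩ := b.run_code hb (scratch + 1) (by omega) hr₁ hP'.left
  have hP'' := hP'.right
  rw [Expr.length_code, ← g1] at hP''
  have h := hP''.current _ rfl
  rw [Program.run_succ, h]
  simp only [Instr.exec]
  refine ⟨⟨fun x => ?_, fun y => ?_⟩, ?_⟩
  · rw [g3 _ (x.idx_lt.trans (by omega)), hr₁.reg]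
  · rw [g2, hr₁.mem]
  · rw [g4, g3 _ (by omega), h4, g1, h1]
    split_ifs <;> omega

theorem run_jump {w : ℕ} {P : Program} {target : ℕ} {γ : Config w}
    (hP : CodeAt P γ.pc [Instr.jump target]) {S : State} (hγ : Represents γ S) :
    Represents (P.run 1 γ) S ∧ (P.run 1 γ).pc = target := by
  have h := hP.current γ rfl
  have : P.run 1 γ = P.step γ := rfl
  rw [this, h]
  exact ⟨⟨hγ.reg, hγ.mem⟩, rfl⟩

/-- Correctness of the compiler: the code of a command does what the command does, in the same
number of steps. -/
theorem Run.code {w : ℕ} {P : Program} {c : Cmd} {S S' : State} {t : ℕ} (h : Run w c S S' t)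
    {γ : Config w} (hγ : Represents γ S) (hP : CodeAt P γ.pc (c.code γ.pc)) :
    Represents (P.run t γ) S' ∧ (P.run t γ).pc = γ.pc + c.size := by
  induction h generalizing γ with
  | skip S => exact ⟨hγ, rfl⟩
  | set x e S hok =>
    obtain ⟨h1, h2, h3, h4⟩ := e.run_code hok scratch le_rfl hγ hP.left
    have hP' := hP.right
    rw [Expr.length_code, ← h1] at hP'
    rw [Program.run_succ, hP'.current _ rfl]
    simp only [Instr.exec, BinOp.eval, Cmd.size]
    refine ⟨⟨fun y => ?_, fun y => ?_⟩, by omega⟩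
    · by_cases hxy : y = x
      · subst hxy; simp [State.set, h4]
      · have : y.idx ≠ x.idx := fun h => hxy (Var.idx_injective h)
        simp only [State.set]
        rw [Function.update_of_ne this, Function.update_of_ne hxy, h3 _ y.idx_lt, hγ.reg]
    · simp only [State.set]
      rw [h2, hγ.mem]
  | store a e S hoa hoe =>
    obtain ⟨h1, h2, h3, h4⟩ := a.run_code hoa scratch le_rfl hγ hP.left
    have hP' := hP.right
    rw [Expr.length_code, ← h1] at hP'
    rw [Program.run_add]
    set γ₁ := P.run a.cost γ with hγ₁
    have hr₁ : Represents γ₁ S :=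
      ⟨fun x => by rw [h3 _ x.idx_lt, hγ.reg], fun y => by rw [h2, hγ.mem]⟩
    obtain ⟨g1, g2, g3, g4⟩ := e.run_code hoe (scratch + 1) (by omega) hr₁ hP'.left
    have hP'' := hP'.right
    rw [Expr.length_code, ← g1] at hP''
    rw [Program.run_succ, hP''.current _ rfl]
    simp only [Instr.exec, Cmd.size]
    refine ⟨⟨fun x => ?_, fun y => ?_⟩, by omega⟩
    · simp only [State.put]
      rw [g3 _ (x.idx_lt.trans (by omega)), hr₁.reg]
    · have e1 : ((P.run e.cost γ₁).reg scratch).toNat = a.val w S := by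
        rw [g3 _ (by omega), h4]
      simp only [State.put]
      by_cases hy : y = (P.run e.cost γ₁).reg scratch
      · subst hy; rw [e1]; simp [g4]
      · have : y.toNat ≠ a.val w S := by
          rw [← e1]; exact fun h => hy (BitVec.eq_of_toNat_eq h)
        rw [Function.update_of_ne hy, Function.update_of_ne this, g2, hr₁.mem]
  | @seq c₁ c₂ S S₁ S₂ t₁ t₂ _ _ ih₁ ih₂ =>
    obtain ⟨h1, h2⟩ := ih₁ hγ hP.left
    have hP' := hP.right
    rw [Cmd.length_code, ← h2] at hP'
    obtain ⟨g1, g2⟩ := ih₂ h1 hP'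
    rw [Program.run_add]
    exact ⟨g1, by rw [g2, h2]; simp only [Cmd.size]; omega⟩
  | @ite_true a b c₁ c₂ S S₁ t hoa hob hlt _ ih =>
    obtain ⟨h1, h2⟩ := run_branchCode a b hoa hob _ hγ hP.left
    have hP' := hP.right.right.right
    rw [length_branchCode, Cmd.length_code] at hP'
    rw [if_pos hlt] at h2
    rw [Program.run_add]
    simp only [List.length_singleton] at hP'
    have e : γ.pc + (a.cost + (b.cost + 1)) + c₂.size + 1 =
      γ.pc + (a.cost + (b.cost + 1)) + (c₂.size + 1) := by omega
    rw [e, ← h2] at hP'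
    obtain ⟨g1, g2⟩ := ih h1 hP'
    exact ⟨g1, by rw [g2, h2]; simp only [Cmd.size]; omega⟩
  | @ite_false a b c₁ c₂ S S₁ t hoa hob hlt _ ih =>
    obtain ⟨h1, h2⟩ := run_branchCode a b hoa hob _ hγ hP.left
    have hP' := hP.right
    rw [length_branchCode] at hP'
    rw [if_neg hlt] at h2
    rw [← h2] at hP'
    obtain ⟨g1, g2⟩ := ih h1 hP'.left
    have hP'' := hP'.right.left
    rw [Cmd.length_code, ← g2] at hP''
    obtain ⟨f1, f2⟩ := run_jump hP'' g1
    rw [Program.run_add, Program.run_add]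
    exact ⟨f1, by rw [f2, h2]; simp only [Cmd.size]; omega⟩
  | @loop_true a b c S S₁ S₂ t₁ t₂ hoa hob hlt _ _ ih₁ ih₂ =>
    obtain ⟨h1, h2⟩ := run_branchCode a b hoa hob _ hγ hP.left
    have hP' := hP.right.right
    rw [length_branchCode, List.length_singleton] at hP'
    rw [if_pos hlt] at h2
    rw [← h2] at hP'
    obtain ⟨g1, g2⟩ := ih₁ h1 hP'.left
    have hP'' := hP'.right
    rw [Cmd.length_code, ← g2] at hP''
    obtain ⟨f1, f2⟩ := run_jump hP'' g1
    rw [Program.run_add, Program.run_add, Program.run_add]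
    obtain ⟨e1, e2⟩ := ih₂ f1 (by rw [f2]; exact hP)
    exact ⟨e1, by rw [e2, f2]⟩
  | @loop_false a b c S hoa hob hlt =>
    obtain ⟨h1, h2⟩ := run_branchCode a b hoa hob _ hγ hP.left
    have hP' := hP.right.left
    rw [length_branchCode] at hP'
    rw [if_neg hlt] at h2
    rw [← h2] at hP'
    obtain ⟨f1, f2⟩ := run_jump hP' h1
    rw [Program.run_add]
    exact ⟨f1, by rw [f2]; simp only [Cmd.size]; omega⟩

/-- A complete program: the code of a command, then `halt`. -/
def Cmd.program (c : Cmd) : Program := c.code 0 ++ [Instr.halt]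

theorem Run.program {w : ℕ} {c : Cmd} {S S' : State} {t : ℕ} (h : Run w c S S' t)
    {γ : Config w} (hγ : Represents γ S) (h0 : γ.pc = 0) :
    Represents (c.program.run t γ) S' ∧ c.program.Halted (c.program.run t γ) := by
  have hP : CodeAt c.program 0 (c.code 0 ++ [Instr.halt]) := fun j _ => by simp [Cmd.program]
  obtain ⟨h1, h2⟩ := h.code (P := c.program) hγ (by rw [h0]; exact hP.left)
  refine ⟨h1, ?_⟩
  have := hP.right 0 (by simp)
  simp only [Cmd.length_code, Nat.zero_add, Nat.add_zero] at this
  simp only [WordRAM.Program.Halted, Program.current, h2, h0, Nat.zero_add, this]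
  rfl

/-! ### Total correctness with time bounds -/

/-- From the state `S`, the command terminates within `t` steps in a state that satisfies `Q`. -/
def Cmd.Within (w : ℕ) (c : Cmd) (S : State) (t : ℕ) (Q : State → Prop) : Prop :=
  ∃ S' t', t' ≤ t ∧ Run w c S S' t' ∧ Q S'

/-- The variables a command assigns to. -/
def Cmd.writes : Cmd → List Var
  | .skip => []
  | .set x _ => [x]
  | .store _ _ => []
  | .seq c₁ c₂ => c₁.writes ++ c₂.writes
  | .ite _ _ c₁ c₂ => c₁.writes ++ c₂.writes
  | .loop _ _ c => c.writes

theorem Run.frame {w : ℕ} {c : Cmd} {S S' : State} {t : ℕ} (h : Run w c S S' t) {x : Var}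
    (hx : x ∉ c.writes) : S'.v x = S.v x := by
  induction h <;> simp_all [Cmd.writes, State.set, State.put]

variable {w : ℕ} {S : State} {Q : State → Prop} {t : ℕ}

theorem Cmd.Within.frame {c : Cmd} (h : c.Within w S t Q) :
    c.Within w S t fun S' => Q S' ∧ ∀ x ∉ c.writes, S'.v x = S.v x := by
  obtain ⟨S', t', h1, h2, h3⟩ := h
  exact ⟨S', t', h1, h2, h3, fun x hx => h2.frame hx⟩

theorem Cmd.Within.mono {c : Cmd} {t' : ℕ} {Q' : State → Prop} (h : c.Within w S t Q)
    (ht : t ≤ t') (hQ : ∀ S, Q S → Q' S) : c.Within w S t' Q' := by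
  obtain ⟨S', t₁, h1, h2, h3⟩ := h
  exact ⟨S', t₁, h1.trans ht, h2, hQ _ h3⟩

theorem within_skip (h : Q S) : Cmd.skip.Within w S t Q := ⟨S, 0, Nat.zero_le _, .skip S, h⟩

theorem within_set {x : Var} {e : Expr} (hok : e.Ok w S) (ht : e.cost + 1 ≤ t)
    (h : Q (S.set x (e.val w S))) : (Cmd.set x e).Within w S t Q :=
  ⟨_, _, ht, .set x e S hok, h⟩

theorem within_store {a e : Expr} (ha : a.Ok w S) (he : e.Ok w S) (ht : a.cost + (e.cost + 1) ≤ t)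
    (h : Q (S.put (a.val w S) (e.val w S))) : (Cmd.store a e).Within w S t Q :=
  ⟨_, _, ht, .store a e S ha he, h⟩

theorem within_seq {c₁ c₂ : Cmd} (t₁ t₂ : ℕ)
    (h : c₁.Within w S t₁ fun S' => c₂.Within w S' t₂ Q) (ht : t₁ + t₂ ≤ t) :
    (Cmd.seq c₁ c₂).Within w S t Q := by
  obtain ⟨S₁, t₁', h1, h2, S₂, t₂', h3, h4, h5⟩ := h
  exact ⟨S₂, _, by omega, .seq h2 h4, h5⟩

theorem within_ite {a b : Expr} {c₁ c₂ : Cmd} (t' : ℕ) (ha : a.Ok w S) (hb : b.Ok w S)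
    (h₁ : a.val w S < b.val w S → c₁.Within w S t' Q)
    (h₂ : ¬ a.val w S < b.val w S → c₂.Within w S t' Q)
    (ht : a.cost + b.cost + 2 + t' ≤ t) : (Cmd.ite a b c₁ c₂).Within w S t Q := by
  by_cases h : a.val w S < b.val w S
  · obtain ⟨S', t₁, g1, g2, g3⟩ := h₁ h
    exact ⟨S', _, by omega, .ite_true ha hb h g2, g3⟩
  · obtain ⟨S', t₁, g1, g2, g3⟩ := h₂ h
    exact ⟨S', _, by omega, .ite_false ha hb h g2, g3⟩

/-- The rule for a loop with `N` iterations and invariant `I`: `F j` bounds the time spent in the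
first `j` iterations. -/
theorem within_loop {a b : Expr} {c : Cmd} (N : ℕ) (I : ℕ → State → Prop) (f F : ℕ → ℕ)
    (h0 : I 0 S) (hab : ∀ j S, I j S → a.Ok w S ∧ b.Ok w S)
    (hstep : ∀ j < N, ∀ S, I j S → a.val w S < b.val w S ∧ c.Within w S (f j) (I (j + 1)))
    (hend : ∀ S, I N S → ¬ a.val w S < b.val w S)
    (hF : ∀ j < N, F j + (f j + a.cost + b.cost + 2) ≤ F (j + 1))
    (ht : F N + a.cost + b.cost + 2 ≤ t + F 0) : (Cmd.loop a b c).Within w S t (I N) := by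
  have hmono : ∀ r j, j + r = N → F j ≤ F N := by
    intro r
    induction r with
    | zero => intro j hj; rw [← hj]; simp
    | succ r ih => intro j hj; have := ih (j + 1) (by omega); have := hF j (by omega); omega
  have key : ∀ r j S, j + r = N → I j S → ∀ t, F N + a.cost + b.cost + 2 ≤ t + F j →
      (Cmd.loop a b c).Within w S t (I N) := by
    intro r
    induction r with
    | zero =>
      intro j S hj hI t ht
      obtain rfl : j = N := by omega
      have := hab _ _ hI
      exact ⟨S, _, by omega, .loop_false this.1 this.2 (hend S hI), hI⟩
    | succ r ih =>
      intro j S hj hI t ht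
      have hok := hab _ _ hI
      obtain ⟨hlt, S₁, t₁, h1, h2, h3⟩ := hstep j (by omega) S hI
      have hFj := hF j (by omega)
      have := hmono r (j + 1) (by omega)
      obtain ⟨S₂, t₂, g1, g2, g3⟩ := ih (j + 1) S₁ (by omega) h3
        (t - (t₁ + a.cost + b.cost + 2)) (by omega)
      exact ⟨S₂, _, by omega, .loop_true hok.1 hok.2 hlt h2 g2, g3⟩
  exact key N 0 S (by omega) h0 t ht

end WaveletRAM

/-! ### Packed lists as numbers -/

namespace WaveletRAM

/-- Cells `a`, `a + 1`, …, `a + N` of the memory `m` hold the first `N + 1` digits of the number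
`X` in base `2 ^ W`. -/
def Stores (m : ℕ → ℕ) (a W X N : ℕ) : Prop :=
  ∀ j ≤ N, m (a + j) = X / 2 ^ (W * j) % 2 ^ W

theorem Stores.mono {m a W X N N'} (h : Stores m a W X N) (hN : N' ≤ N) : Stores m a W X N' :=
  fun j hj => h j (hj.trans hN)

theorem Stores.congr {m m' a W X N} (h : Stores m a W X N)
    (hm : ∀ j ≤ N, m' (a + j) = m (a + j)) : Stores m' a W X N :=
  fun j hj => by rw [hm j hj, h j hj]

/-- Adding a multiple of `2 ^ (W * i + s)` does not change the digits below the `i`-th one. -/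
theorem digit_add_of_lt {W X i s x j : ℕ} (hj : j < i) :
    (X + 2 ^ (W * i + s) * x) / 2 ^ (W * j) % 2 ^ W = X / 2 ^ (W * j) % 2 ^ W := by
  obtain ⟨r, rfl⟩ : ∃ r, i = j + 1 + r := ⟨i - (j + 1), by omega⟩
  have : 2 ^ (W * (j + 1 + r) + s) * x = 2 ^ (W * j) * (2 ^ W * (2 ^ (W * r + s) * x)) := by
    rw [← mul_assoc, ← mul_assoc, ← pow_add, ← pow_add]; congr 2; ring
  rw [this, Nat.add_mul_div_left _ _ (by positivity), Nat.add_mul_mod_self_left]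

theorem div_add_eq {W X i s x : ℕ} :
    (X + 2 ^ (W * i + s) * x) / 2 ^ (W * i) = X / 2 ^ (W * i) + x * 2 ^ s := by
  have : 2 ^ (W * i + s) * x = 2 ^ (W * i) * (x * 2 ^ s) := by rw [pow_add]; ring
  rw [this, Nat.add_mul_div_left _ _ (by positivity)]

theorem div_lt_of_lt {W X i s : ℕ} (hX : X < 2 ^ (W * i + s)) : X / 2 ^ (W * i) < 2 ^ s := by
  rw [Nat.div_lt_iff_lt_mul (by positivity), ← pow_add, add_comm]; exact hX

theorem add_mul_mod_lt {A x s W : ℕ} (hA : A < 2 ^ s) (hs : s ≤ W) :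
    A + x * 2 ^ s % 2 ^ W < 2 ^ W := by
  obtain ⟨r, rfl⟩ := Nat.exists_eq_add_of_le hs
  have h1 : x * 2 ^ s % 2 ^ (s + r) = x % 2 ^ r * 2 ^ s := by
    rw [pow_add, mul_comm x, Nat.mul_mod_mul_left, mul_comm]
  have h2 : x % 2 ^ r + 1 ≤ 2 ^ r := Nat.mod_lt _ (by positivity)
  have := Nat.mul_le_mul_right (2 ^ s) h2
  rw [h1, pow_add, mul_comm (2 ^ s)]
  linarith

theorem add_mul_mod {A x s W : ℕ} (hA : A < 2 ^ s) (hs : s ≤ W) :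
    (A + x * 2 ^ s) % 2 ^ W = A + x * 2 ^ s % 2 ^ W := by
  rw [Nat.add_mod, Nat.mod_eq_of_lt (hA.trans_le (Nat.pow_le_pow_right (by norm_num) hs)),
    Nat.mod_eq_of_lt (add_mul_mod_lt hA hs)]

/-- Appending `x` at bit position `W * i + s` changes the cells `i` and `i + 1` only. -/
theorem Stores.append {m m' : ℕ → ℕ} {a W X i s x : ℕ} (h : Stores m a W X i)
    (hX : X < 2 ^ (W * i + s)) (hs : s < W) (hx : x < 2 ^ W)
    (h₁ : m' (a + i) = m (a + i) + x * 2 ^ s % 2 ^ W) (h₂ : m' (a + i + 1) = x / 2 ^ (W - s))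
    (h₃ : ∀ j < i, m' (a + j) = m (a + j)) :
    Stores m' a W (X + 2 ^ (W * i + s) * x) (i + 1) := by
  have hA := div_lt_of_lt hX
  intro j hj
  rcases Nat.lt_trichotomy j i with hlt | rfl | hgt
  · rw [h₃ j hlt, h j hlt.le, digit_add_of_lt hlt]
  · rw [h₁, h j le_rfl, div_add_eq, add_mul_mod hA hs.le,
      Nat.mod_eq_of_lt (hA.trans_le (Nat.pow_le_pow_right (by norm_num) hs.le))]
  · obtain rfl : j = i + 1 := by omega
    rw [← add_assoc, h₂, mul_add, mul_one, pow_add 2 (W * i) W, ← Nat.div_div_eq_div_mul,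
      div_add_eq]
    have : 2 ^ W = 2 ^ s * 2 ^ (W - s) := by rw [← pow_add]; congr 1; omega
    have e : (X / 2 ^ (W * i) + x * 2 ^ s) / 2 ^ W = x / 2 ^ (W - s) := by
      rw [this, ← Nat.div_div_eq_div_mul, Nat.add_mul_div_right _ _ (by positivity),
        Nat.div_eq_of_lt hA, zero_add]
    rw [e, Nat.mod_eq_of_lt ((Nat.div_le_self _ _).trans_lt hx)]

/-- Appending a number `x` of `nb` items of `U` bits to a list of `cnt` items that is packed with
`Q` items per cell. -/
theorem Stores.append_items {m m' : ℕ → ℕ} {a Q U X x cnt nb : ℕ} (hQ : 0 < Q) (hU : 0 < U)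
    (h : Stores m a (Q * U) X (cnt / Q)) (hX : X < 2 ^ (U * cnt)) (hx : x < 2 ^ (U * nb))
    (hnb : nb ≤ Q)
    (h₁ : m' (a + cnt / Q) = m (a + cnt / Q) + x * 2 ^ (cnt % Q * U) % 2 ^ (Q * U))
    (h₂ : m' (a + cnt / Q + 1) = x / 2 ^ (Q * U - cnt % Q * U))
    (h₃ : ∀ j < cnt / Q, m' (a + j) = m (a + j)) :
    Stores m' a (Q * U) (X + 2 ^ (U * cnt) * x) ((cnt + nb) / Q) := by
  have e : U * cnt = Q * U * (cnt / Q) + cnt % Q * U := by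
    conv_lhs => rw [← Nat.div_add_mod cnt Q]
    ring
  rw [e] at hX ⊢
  refine (h.append hX ?_ ?_ h₁ h₂ h₃).mono ?_
  · exact Nat.mul_lt_mul_of_pos_right (Nat.mod_lt _ hQ) hU
  · refine hx.trans_le (Nat.pow_le_pow_right (by norm_num) ?_)
    rw [mul_comm]; exact Nat.mul_le_mul_right _ hnb
  · rw [← Nat.add_div_right _ hQ]
    exact Nat.div_le_div_right (by omega)

/-- The cell in which an append starts has room for the lower part. -/
theorem Stores.add_lt {m : ℕ → ℕ} {a Q U X cnt : ℕ} (hQ : 0 < Q)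
    (h : Stores m a (Q * U) X (cnt / Q)) (hX : X < 2 ^ (U * cnt)) (x : ℕ) :
    m (a + cnt / Q) + x * 2 ^ (cnt % Q * U) % 2 ^ (Q * U) < 2 ^ (Q * U) := by
  have e : U * cnt = Q * U * (cnt / Q) + cnt % Q * U := by
    conv_lhs => rw [← Nat.div_add_mod cnt Q]
    ring
  rw [e] at hX
  have hs : cnt % Q * U ≤ Q * U := Nat.mul_le_mul_right _ (Nat.mod_lt _ hQ).le
  rw [h _ le_rfl]
  exact add_mul_mod_lt ((Nat.mod_le _ _).trans_lt (div_lt_of_lt hX)) hs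

/-- Adding one item to a packed list all of whose cells are initialized. -/
theorem Stores.add_item {m m' : ℕ → ℕ} {a Q U X x cnt N : ℕ} (hQ : 0 < Q)
    (h : Stores m a (Q * U) X N) (hX : X < 2 ^ (U * cnt)) (hx : x < 2 ^ U)
    (h₁ : m' (a + cnt / Q) = m (a + cnt / Q) + x * 2 ^ (cnt % Q * U))
    (h₂ : ∀ j, j ≠ cnt / Q → m' (a + j) = m (a + j)) :
    Stores m' a (Q * U) (X + 2 ^ (U * cnt) * x) N := by
  have e : U * cnt = Q * U * (cnt / Q) + cnt % Q * U := by
    conv_lhs => rw [← Nat.div_add_mod cnt Q]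
    ring
  have hs1 : cnt % Q * U + U ≤ Q * U := by
    rw [← Nat.succ_mul]; exact Nat.mul_le_mul_right _ (Nat.mod_lt _ hQ)
  have hlt : x * 2 ^ (cnt % Q * U) < 2 ^ (Q * U) := by
    calc x * 2 ^ (cnt % Q * U) < 2 ^ U * 2 ^ (cnt % Q * U) :=
          Nat.mul_lt_mul_of_pos_right hx (by positivity)
      _ ≤ _ := by rw [← pow_add]; exact Nat.pow_le_pow_right (by norm_num) (by omega)
  have hX0 := hX
  rw [e] at hX ⊢
  have hs : cnt % Q * U ≤ Q * U := by omega
  have hA := div_lt_of_lt hX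
  intro j hj
  rcases Nat.lt_trichotomy j (cnt / Q) with hj' | rfl | hj'
  · rw [h₂ j hj'.ne, h j hj, digit_add_of_lt hj']
  · rw [h₁, h _ hj, div_add_eq, add_mul_mod hA hs, Nat.mod_eq_of_lt hlt,
      Nat.mod_eq_of_lt (hA.trans_le (Nat.pow_le_pow_right (by norm_num) hs))]
  · have hle : U * cnt + U ≤ Q * U * j := by
      have : Q * U * (cnt / Q + 1) ≤ Q * U * j := Nat.mul_le_mul_left _ hj'
      rw [e]; rw [mul_add, mul_one] at this; omega
    have hX' : X + 2 ^ (Q * U * (cnt / Q) + cnt % Q * U) * x < 2 ^ (Q * U * j) := by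
      rw [← e]
      calc X + 2 ^ (U * cnt) * x < 2 ^ (U * cnt) + 2 ^ (U * cnt) * x := by omega
        _ = 2 ^ (U * cnt) * (x + 1) := by ring
        _ ≤ 2 ^ (U * cnt) * 2 ^ U := Nat.mul_le_mul_left _ hx
        _ ≤ _ := by rw [← pow_add]; exact Nat.pow_le_pow_right (by norm_num) hle
    rw [h₂ j hj'.ne', h j hj, Nat.div_eq_of_lt hX', Nat.div_eq_of_lt]
    exact hX0.trans_le (Nat.pow_le_pow_right (by norm_num) (by omega))

/-- The cell that receives a new item has room for it. -/
theorem Stores.add_item_lt {m : ℕ → ℕ} {a Q U X x cnt N : ℕ} (hQ : 0 < Q)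
    (h : Stores m a (Q * U) X N) (hX : X < 2 ^ (U * cnt)) (hx : x < 2 ^ U) (hN : cnt / Q ≤ N) :
    x * 2 ^ (cnt % Q * U) < 2 ^ (Q * U) ∧
      m (a + cnt / Q) + x * 2 ^ (cnt % Q * U) < 2 ^ (Q * U) := by
  have hs1 : cnt % Q * U + U ≤ Q * U := by
    rw [← Nat.succ_mul]; exact Nat.mul_le_mul_right _ (Nat.mod_lt _ hQ)
  have hlt : x * 2 ^ (cnt % Q * U) < 2 ^ (Q * U) := by
    calc x * 2 ^ (cnt % Q * U) < 2 ^ U * 2 ^ (cnt % Q * U) :=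
          Nat.mul_lt_mul_of_pos_right hx (by positivity)
      _ ≤ _ := by rw [← pow_add]; exact Nat.pow_le_pow_right (by norm_num) (by omega)
  have := (h.mono hN).add_lt hQ hX x
  rw [Nat.mod_eq_of_lt hlt] at this
  exact ⟨hlt, this⟩

/-- Reading `b ≤ W` bits at bit position `W * i + s` from the cells `i` and `i + 1`. -/
theorem read_bits {W X i s b : ℕ} (hs : s < W) (hb : b ≤ W) :
    (X / 2 ^ (W * i) % 2 ^ W / 2 ^ s + X / 2 ^ (W * (i + 1)) % 2 ^ W * 2 ^ (W - s) % 2 ^ W) % 2 ^ b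
      = X / 2 ^ (W * i + s) % 2 ^ b := by
  set Y := X / 2 ^ (W * i) with hY
  have e1 : X / 2 ^ (W * (i + 1)) = Y / 2 ^ W := by
    rw [hY, Nat.div_div_eq_div_mul, ← pow_add, mul_add, mul_one]
  have e2 : X / 2 ^ (W * i + s) = Y / 2 ^ s := by
    rw [hY, Nat.div_div_eq_div_mul, ← pow_add]
  rw [e1, e2]
  obtain ⟨r, rfl⟩ := Nat.exists_eq_add_of_le hs.le
  have hr : s + r - s = r := by omega
  rw [hr]
  have h1 : Y % 2 ^ (s + r) / 2 ^ s = Y / 2 ^ s % 2 ^ r := by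
    rw [pow_add, Nat.mod_mul_right_div_self]
  have h2 : Y / 2 ^ (s + r) % 2 ^ (s + r) * 2 ^ r % 2 ^ (s + r) =
      Y / 2 ^ s / 2 ^ r % 2 ^ s * 2 ^ r := by
    rw [pow_add, ← Nat.div_div_eq_div_mul, Nat.mul_mod_mul_right, mul_comm (2 ^ s),
      Nat.mod_mul_left_mod]
  rw [h1, h2]
  set Z := Y / 2 ^ s
  have h3 : Z % 2 ^ r + Z / 2 ^ r % 2 ^ s * 2 ^ r = Z % 2 ^ (s + r) := by
    rw [add_comm s r, pow_add, Nat.mod_mul, mul_comm (2 ^ r)]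
  rw [h3, Nat.mod_mod_of_dvd _ (pow_dvd_pow _ hb)]

/-- The sum computed when reading bits does not overflow. -/
theorem read_bits_lt {W Y Z s : ℕ} (hs : s < W) (hY : Y < 2 ^ W) :
    Y / 2 ^ s + Z * 2 ^ (W - s) % 2 ^ W < 2 ^ W := by
  refine add_mul_mod_lt ?_ (by omega)
  rw [Nat.div_lt_iff_lt_mul (by positivity), ← pow_add]
  rwa [Nat.sub_add_cancel hs.le]

theorem ofDigits_lt_pow {b : ℕ} {l : List ℕ} (hl : ∀ c ∈ l, c < b) :
    Nat.ofDigits b l < b ^ l.length := by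
  induction l with
  | nil => simp
  | cons c l ih =>
    have h1 := ih fun c hc => hl c (by simp [hc])
    have h2 := hl c (by simp)
    have h3 : Nat.ofDigits b l + 1 ≤ b ^ l.length := h1
    have := Nat.mul_le_mul_left b h3
    rw [Nat.ofDigits_cons, List.length_cons, pow_succ']
    linarith

theorem ofDigits_lt_two_pow {U : ℕ} {l : List ℕ} (hl : ∀ c ∈ l, c < 2 ^ U) :
    Nat.ofDigits (2 ^ U) l < 2 ^ (U * l.length) := by
  rw [pow_mul]; exact ofDigits_lt_pow hl

/-- A block of `q` digits. -/
theorem ofDigits_div_mod {b : ℕ} {l : List ℕ} (hl : ∀ c ∈ l, c < b) (i q : ℕ) :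
    Nat.ofDigits b l / b ^ i % b ^ q = Nat.ofDigits b ((l.drop i).take q) := by
  rcases Nat.eq_zero_or_pos b with rfl | hb
  · have : l = [] := by
      cases l with
      | nil => rfl
      | cons c l => exact absurd (hl c (by simp)) (by omega)
    subst this; simp
  have key : ∀ (l₁ l₂ : List ℕ), (∀ c ∈ l₁, c < b) →
      Nat.ofDigits b (l₁ ++ l₂) / b ^ l₁.length = Nat.ofDigits b l₂ ∧
      Nat.ofDigits b (l₁ ++ l₂) % b ^ l₁.length = Nat.ofDigits b l₁ := by
    intro l₁ l₂ h
    have := ofDigits_lt_pow h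
    rw [Nat.ofDigits_append, Nat.add_mul_div_left _ _ (by positivity), Nat.div_eq_of_lt this,
      Nat.add_mul_mod_self_left, Nat.mod_eq_of_lt this]
    simp
  have hdiv : Nat.ofDigits b l / b ^ i = Nat.ofDigits b (l.drop i) := by
    rcases Nat.lt_or_ge l.length i with h | h
    · rw [List.drop_eq_nil_of_le h.le, Nat.ofDigits_nil, Nat.div_eq_of_lt]
      exact (ofDigits_lt_pow hl).trans_le (Nat.pow_le_pow_right hb h.le)
    · have := (key (l.take i) (l.drop i) fun c hc => hl c (List.mem_of_mem_take hc)).1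
      rwa [List.take_append_drop, List.length_take, min_eq_left h] at this
  rw [hdiv]
  have hl' : ∀ c ∈ l.drop i, c < b := fun c hc => hl c (List.mem_of_mem_drop hc)
  rcases Nat.lt_or_ge (l.drop i).length q with h | h
  · rw [List.take_of_length_le h.le, Nat.mod_eq_of_lt]
    exact (ofDigits_lt_pow hl').trans_le (Nat.pow_le_pow_right hb h.le)
  · have := (key ((l.drop i).take q) ((l.drop i).drop q)
      fun c hc => hl' c (List.mem_of_mem_take hc)).2
    rwa [List.take_append_drop, List.length_take, min_eq_left h] at this

theorem ofDigits_of_forall_eq_zero {b : ℕ} {l : List ℕ} (h : ∀ c ∈ l, c = 0) :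
    Nat.ofDigits b l = 0 := by
  induction l with
  | nil => rfl
  | cons c l ih =>
    rw [Nat.ofDigits_cons, ih fun c hc => h c (by simp [hc]), h c (by simp)]; simp

/-! ### Bit lists -/

/-- A bit list as a number, the first bit being the least significant one. -/
def bitsVal (B : List Bool) : ℕ := Nat.ofDigits 2 (B.map Bool.toNat)

theorem bitsVal_testBit (B : List Bool) (i : ℕ) : (bitsVal B).testBit i = B.getD i false := by
  induction B generalizing i with
  | nil => simp [bitsVal]
  | cons b B ih =>
    have : bitsVal (b :: B) = 2 * bitsVal B + b.toNat := by
      simp [bitsVal, Nat.ofDigits_cons, add_comm]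
    rw [this]
    cases i with
    | zero => cases b <;> simp [Nat.testBit_zero]
    | succ i =>
      rw [Nat.testBit_succ]
      have : (2 * bitsVal B + b.toNat) / 2 = bitsVal B := by cases b <;> simp; omega
      rw [this, ih]; simp

theorem toNat_packedWord (w : ℕ) (B : List Bool) (j : ℕ) :
    (WordRAM.packedWord w B j).toNat = bitsVal B / 2 ^ (w * j) % 2 ^ w := by
  apply Nat.eq_of_testBit_eq
  intro i
  rw [Nat.testBit_mod_two_pow, ← Nat.shiftRight_eq_div_pow, Nat.testBit_shiftRight,
    bitsVal_testBit, BitVec.testBit_toNat, WordRAM.packedWord]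
  by_cases hi : i < w
  · simp [hi, mul_comm]
  · rw [BitVec.getLsbD_of_ge _ _ (not_lt.mp hi)]; simp [hi]

theorem bitsVal_append (B B' : List Bool) :
    bitsVal (B ++ B') = bitsVal B + 2 ^ B.length * bitsVal B' := by
  simp [bitsVal, Nat.ofDigits_append]

theorem bitsVal_lt (B : List Bool) : bitsVal B < 2 ^ B.length := by
  have := ofDigits_lt_pow (b := 2) (l := B.map Bool.toNat) (by
    intro c hc
    simp only [List.mem_map] at hc
    obtain ⟨b, _, rfl⟩ := hc
    cases b <;> simp)
  simpa [bitsVal] using this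

theorem bitsVal_range_testBit (k c : ℕ) (hc : c < 2 ^ k) :
    bitsVal ((List.range k).map fun i => c.testBit i) = c := by
  apply Nat.eq_of_testBit_eq
  intro i
  rw [bitsVal_testBit]
  by_cases hi : i < k
  · simp [List.getD, hi]
  · have : c.testBit i = false :=
      Nat.testBit_lt_two_pow (hc.trans_le (Nat.pow_le_pow_right (by norm_num) (by omega)))
    simp [List.getD, hi, this]

/-- The input, read as one number, has the characters as its digits in base `2 ^ k`. -/
theorem bitsVal_entryBits {k : ℕ} {s : List ℕ} (hs : ∀ c ∈ s, c < 2 ^ k) :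
    bitsVal (WordRAM.entryBits k s) = Nat.ofDigits (2 ^ k) s := by
  induction s with
  | nil => rfl
  | cons c s ih =>
    have := ih fun c hc => hs c (by simp [hc])
    rw [WordRAM.entryBits] at this
    rw [WordRAM.entryBits, List.flatMap_cons, bitsVal_append, this,
      bitsVal_range_testBit _ _ (hs c (by simp)), Nat.ofDigits_cons]
    simp

end WaveletRAM

/-! ### Splitting a list of characters by their leading bit -/

namespace WaveletRAM

/-- The leading bit of a `τ`-bit character. -/
def topBit (τ c : ℕ) : Bool := decide (2 ^ (τ - 1) ≤ c)

/-- A `τ`-bit character without its leading bit, shifted to the left by one position. -/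
def dropTop (τ c : ℕ) : ℕ := 2 * c % 2 ^ τ

/-- The characters with leading bit `b`, in order, each without this bit. -/
def split (τ : ℕ) (b : Bool) (l : List ℕ) : List ℕ :=
  (l.filter fun c => topBit τ c == b).map (dropTop τ)

/-- The characters with leading bit `b`, packed. -/
def splitVal (τ : ℕ) (b : Bool) (l : List ℕ) : ℕ := Nat.ofDigits (2 ^ τ) (split τ b l)

/-- The number of characters whose leading bit is `1`. -/
def onesCount (τ : ℕ) (l : List ℕ) : ℕ := (split τ true l).length

/-- The packed sequence of the leading bits. -/
def topBits (τ : ℕ) (l : List ℕ) : ℕ := bitsVal (l.map (topBit τ))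

/-- The four table entries for an argument `x` describe the list of the digits of `x`. -/
def TableEntry (m : ℕ → ℕ) (tab τ x : ℕ) : Prop :=
  m (tab + 4 * x) = onesCount τ (Nat.digits (2 ^ τ) x) ∧
  m (tab + 4 * x + 1) = topBits τ (Nat.digits (2 ^ τ) x) ∧
  m (tab + 4 * x + 2) = splitVal τ false (Nat.digits (2 ^ τ) x) ∧
  m (tab + 4 * x + 3) = splitVal τ true (Nat.digits (2 ^ τ) x)

theorem dropTop_lt (τ c : ℕ) : dropTop τ c < 2 ^ τ := Nat.mod_lt _ (by positivity)

theorem split_lt {τ : ℕ} {b : Bool} {l : List ℕ} : ∀ c ∈ split τ b l, c < 2 ^ τ := by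
  intro c hc
  simp only [split, List.mem_map] at hc
  obtain ⟨c', _, rfl⟩ := hc
  exact dropTop_lt _ _

theorem split_append (τ : ℕ) (b : Bool) (l l' : List ℕ) :
    split τ b (l ++ l') = split τ b l ++ split τ b l' := by simp [split]

theorem split_length_add (τ : ℕ) (l : List ℕ) :
    (split τ false l).length + (split τ true l).length = l.length := by
  induction l with
  | nil => rfl
  | cons c l ih =>
    cases ht : topBit τ c <;> simp [split, ht] at ih ⊢ <;> omega

theorem splitVal_lt {τ : ℕ} {b : Bool} {l : List ℕ} :
    splitVal τ b l < 2 ^ (τ * (split τ b l).length) := ofDigits_lt_two_pow split_lt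

theorem splitVal_append (τ : ℕ) (b : Bool) (l l' : List ℕ) :
    splitVal τ b (l ++ l') =
      splitVal τ b l + 2 ^ (τ * (split τ b l).length) * splitVal τ b l' := by
  rw [splitVal, split_append, Nat.ofDigits_append, ← pow_mul]; rfl

theorem topBits_append (τ : ℕ) (l l' : List ℕ) :
    topBits τ (l ++ l') = topBits τ l + 2 ^ l.length * topBits τ l' := by
  simp [topBits, bitsVal_append]

theorem topBits_lt (τ : ℕ) (l : List ℕ) : topBits τ l < 2 ^ l.length := by
  simpa [topBits] using bitsVal_lt (l.map (topBit τ))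

theorem onesCount_le (τ : ℕ) (l : List ℕ) : onesCount τ l ≤ l.length := by
  have := split_length_add τ l; simp only [onesCount]; omega

theorem topBit_zero (τ : ℕ) : topBit τ 0 = false := by simp [topBit]

theorem exists_digits_append {b : ℕ} (hb : 1 < b) {l : List ℕ} (hl : ∀ c ∈ l, c < b) :
    ∃ j, l = Nat.digits b (Nat.ofDigits b l) ++ List.replicate j 0 := by
  induction l with
  | nil => exact ⟨0, by simp⟩
  | cons c l ih =>
    obtain ⟨j, hj⟩ := ih fun c hc => hl c (by simp [hc])
    have hc := hl c (by simp)
    rw [Nat.ofDigits_cons]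
    rcases Nat.eq_zero_or_pos (c + b * Nat.ofDigits b l) with h | h
    · have h1 : c = 0 := by omega
      have h2 : Nat.ofDigits b l = 0 := by
        rcases Nat.eq_zero_or_pos (Nat.ofDigits b l) with h2 | h2
        · exact h2
        · have := Nat.mul_pos (show 0 < b by omega) h2; omega
      rw [h2] at hj
      refine ⟨j + 1, ?_⟩
      rw [h, h1, List.replicate_succ]
      simpa using hj
    · refine ⟨j, ?_⟩
      rw [Nat.digits_def' hb h, Nat.add_mul_mod_self_left, Nat.mod_eq_of_lt hc,
        Nat.add_mul_div_left _ _ (by omega), Nat.div_eq_of_lt hc, zero_add, List.cons_append, ← hj]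

/-- Zeros at the end of a list do not change the packed results, so that the table is right for
lists with any number of them. -/
theorem TableEntry.list {m : ℕ → ℕ} {tab τ : ℕ} (hτ : 0 < τ) {l : List ℕ}
    (hl : ∀ c ∈ l, c < 2 ^ τ) (h : TableEntry m tab τ (Nat.ofDigits (2 ^ τ) l)) :
    m (tab + 4 * Nat.ofDigits (2 ^ τ) l) = onesCount τ l ∧
    m (tab + 4 * Nat.ofDigits (2 ^ τ) l + 1) = topBits τ l ∧
    m (tab + 4 * Nat.ofDigits (2 ^ τ) l + 2) = splitVal τ false l ∧
    m (tab + 4 * Nat.ofDigits (2 ^ τ) l + 3) = splitVal τ true l := by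
  obtain ⟨j, hj⟩ := exists_digits_append (Nat.one_lt_two_pow hτ.ne') hl
  set l' := Nat.digits (2 ^ τ) (Nat.ofDigits (2 ^ τ) l) with hl'
  have z1 : split τ true (List.replicate j 0) = [] := by simp [split, topBit_zero]
  have z0 : splitVal τ false (List.replicate j 0) = 0 := by
    apply ofDigits_of_forall_eq_zero
    intro c hc
    simp only [split, List.mem_map, List.mem_filter, List.mem_replicate] at hc
    obtain ⟨c', ⟨⟨_, rfl⟩, _⟩, rfl⟩ := hc
    simp [dropTop]
  have z2 : topBits τ (List.replicate j 0) = 0 := by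
    apply ofDigits_of_forall_eq_zero
    intro c hc
    simp only [List.mem_map, List.mem_replicate] at hc
    obtain ⟨_, ⟨_, ⟨_, rfl⟩, rfl⟩, rfl⟩ := hc
    simp [topBit_zero]
  obtain ⟨h1, h2, h3, h4⟩ := h
  rw [← hl'] at h1 h2 h3 h4
  refine ⟨?_, ?_, ?_, ?_⟩
  · rw [h1]; conv_rhs => rw [hj]
    rw [onesCount, onesCount, split_append, z1, List.append_nil]
  · rw [h2]; conv_rhs => rw [hj]
    rw [topBits_append, z2]; simp
  · rw [h3]; conv_rhs => rw [hj]
    rw [splitVal_append, z0]; simp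
  · rw [h4]; conv_rhs => rw [hj]
    rw [splitVal, splitVal, split_append, z1, List.append_nil]

theorem tableEntry_zero {m : ℕ → ℕ} {tab τ : ℕ} (h : ∀ j < 4, m (tab + j) = 0) :
    TableEntry m tab τ 0 := by
  have h0 := h 0 (by omega)
  have h1 := h 1 (by omega)
  have h2 := h 2 (by omega)
  have h3 := h 3 (by omega)
  simp [TableEntry, onesCount, split, splitVal, topBits, bitsVal] at *
  exact ⟨h0, h1, h2, h3⟩

/-- The entries for `x` follow from those for `x` without its first character. -/
theorem tableEntry_of_div {m : ℕ → ℕ} {tab τ x : ℕ} (hτ : 0 < τ) (hx : 0 < x)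
    (h : TableEntry m tab τ (x / 2 ^ τ)) {m' : ℕ → ℕ}
    (h0 : x % 2 ^ τ < 2 ^ (τ - 1) →
      m' (tab + 4 * x) = m (tab + 4 * (x / 2 ^ τ)) ∧
      m' (tab + 4 * x + 1) = 2 * m (tab + 4 * (x / 2 ^ τ) + 1) ∧
      m' (tab + 4 * x + 2) =
        2 * (x % 2 ^ τ) % 2 ^ τ + m (tab + 4 * (x / 2 ^ τ) + 2) * 2 ^ τ ∧
      m' (tab + 4 * x + 3) = m (tab + 4 * (x / 2 ^ τ) + 3))
    (h1 : ¬ x % 2 ^ τ < 2 ^ (τ - 1) →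
      m' (tab + 4 * x) = m (tab + 4 * (x / 2 ^ τ)) + 1 ∧
      m' (tab + 4 * x + 1) = 2 * m (tab + 4 * (x / 2 ^ τ) + 1) + 1 ∧
      m' (tab + 4 * x + 2) = m (tab + 4 * (x / 2 ^ τ) + 2) ∧
      m' (tab + 4 * x + 3) =
        2 * (x % 2 ^ τ) % 2 ^ τ + m (tab + 4 * (x / 2 ^ τ) + 3) * 2 ^ τ) :
    TableEntry m' tab τ x := by
  obtain ⟨e1, e2, e3, e4⟩ := h
  unfold TableEntry
  rw [Nat.digits_def' (Nat.one_lt_two_pow hτ.ne') hx]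
  set l := Nat.digits (2 ^ τ) (x / 2 ^ τ)
  set c := x % 2 ^ τ
  by_cases hc : c < 2 ^ (τ - 1)
  · obtain ⟨f1, f2, f3, f4⟩ := h0 hc
    have ht : topBit τ c = false := by simp [topBit, hc]
    rw [f1, f2, f3, f4, e1, e2, e3, e4]
    simp [onesCount, split, splitVal, topBits, bitsVal, ht, Nat.ofDigits_cons, dropTop, mul_comm]
  · obtain ⟨f1, f2, f3, f4⟩ := h1 hc
    have ht : topBit τ c = true := by simpa [topBit] using hc
    rw [f1, f2, f3, f4, e1, e2, e3, e4]
    simp [onesCount, split, splitVal, topBits, bitsVal, ht, Nat.ofDigits_cons, dropTop, mul_comm,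
      add_comm]

/-! ### The nodes of the wavelet tree -/

theorem heapIndex_foldl (l : List Bool) (a : ℕ) :
    l.foldl (fun h b => 2 * h + b.toNat) (a + 1) = heapIndex l + a * 2 ^ l.length := by
  unfold heapIndex
  induction l generalizing a with
  | nil => simp [add_comm]
  | cons b l ih =>
    simp only [List.foldl_cons, List.length_cons]
    rw [show 2 * (a + 1) + b.toNat = (2 * a + b.toNat + 1) + 1 by ring,
      ih (2 * a + b.toNat + 1), show 2 * 1 + b.toNat = (b.toNat + 1) + 1 by ring,
      ih (b.toNat + 1), pow_succ]
    ring

theorem heapIndex_cons (b : Bool) (l : List Bool) :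
    heapIndex (b :: l) = heapIndex l + (b.toNat + 1) * 2 ^ l.length := by
  rw [← heapIndex_foldl]
  simp only [heapIndex, List.foldl_cons]
  congr 1; ring

theorem heapIndex_mem (l : List Bool) :
    2 ^ l.length ≤ heapIndex l ∧ heapIndex l < 2 ^ (l.length + 1) := by
  induction l with
  | nil => simp [heapIndex]
  | cons b l ih =>
    rw [heapIndex_cons, List.length_cons, pow_succ 2 (l.length + 1), pow_succ] at *
    cases b <;> simp <;> omega

theorem heapIndex_injective : Function.Injective heapIndex := by
  have key : ∀ l l' : List Bool, l.length = l'.length → heapIndex l = heapIndex l' → l = l' := by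
    intro l
    induction l with
    | nil => intro l' h _; exact (List.length_eq_zero_iff.mp h.symm).symm
    | cons b l ih =>
      intro l' hl h
      cases l' with
      | nil => simp at hl
      | cons b' l' =>
        have hl' : l.length = l'.length := by simpa using hl
        rw [heapIndex_cons, heapIndex_cons, ← hl'] at h
        have h1 := heapIndex_mem l
        have h2 := heapIndex_mem l'
        rw [pow_succ] at h1 h2
        rw [← hl'] at h2
        have : b = b' := by
          cases b <;> cases b' <;> simp at h ⊢ <;> omega
        subst this
        rw [ih l' hl' (by omega)]
  intro l l' h
  refine key l l' ?_ h
  have h1 := heapIndex_mem l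
  have h2 := heapIndex_mem l'
  rw [← h] at h2
  have a := (Nat.pow_lt_pow_iff_right (a := 2) (by norm_num)).mp (h1.1.trans_lt h2.2)
  have b := (Nat.pow_lt_pow_iff_right (a := 2) (by norm_num)).mp (h2.1.trans_lt h1.2)
  omega

/-- The characters of `s`, in their original form, that belong to the node of depth `d` with heap
number `h`. -/
def nodeList (k : ℕ) (s : List ℕ) (d h : ℕ) : List ℕ :=
  s.filter fun c => decide (c / 2 ^ (k - d) + 2 ^ d = h)

theorem bitmaskAt_eq_some {k : ℕ} {s : List ℕ} {l : List Bool} {B : List Bool}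
    (hs : ∀ c ∈ s, c < 2 ^ k) (h : (waveletTree k s).bitmaskAt l = some B) :
    l.length < k ∧
      B = (nodeList k s l.length (heapIndex l)).map fun c => c.testBit (k - 1 - l.length) := by
  induction k generalizing s l with
  | zero => simp [waveletTree, WaveletTree.bitmaskAt] at h
  | succ k ih =>
    have hsub : ∀ (b : Bool) (l : List Bool), (waveletTree k ((s.filter fun c =>
        c.testBit k == b).map fun c => c % 2 ^ k)).bitmaskAt l = some B →
        (b :: l).length < k + 1 ∧ B = (nodeList (k + 1) s (b :: l).length
          (heapIndex (b :: l))).map fun c => c.testBit (k + 1 - 1 - (b :: l).length) := by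
      intro b l h
      obtain ⟨h1, h2⟩ := ih (by
        intro c hc
        simp only [List.mem_map] at hc
        obtain ⟨c', _, rfl⟩ := hc
        exact Nat.mod_lt _ (by positivity)) h
      refine ⟨by simpa using h1, ?_⟩
      rw [h2, nodeList, nodeList, List.filter_map, List.map_map, List.filter_filter]
      have hf : ∀ c ∈ s, ((decide (c % 2 ^ k / 2 ^ (k - l.length) + 2 ^ l.length = heapIndex l)) &&
          (c.testBit k == b)) = decide (c / 2 ^ (k + 1 - (b :: l).length) + 2 ^ (b :: l).length =
            heapIndex (b :: l)) := by
        intro c hc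
        have hc' := hs c hc
        rw [heapIndex_cons, List.length_cons, Nat.add_sub_add_right]
        have hl := heapIndex_mem l
        set L := l.length
        set y := c % 2 ^ k / 2 ^ (k - L) with hy
        have hkL : 2 ^ k = 2 ^ (k - L) * 2 ^ L := by rw [← pow_add]; congr 1; omega
        have hylt : y < 2 ^ L := by
          rw [hy, Nat.div_lt_iff_lt_mul (by positivity), mul_comm, ← hkL]
          exact Nat.mod_lt _ (by positivity)
        have hdiv : c / 2 ^ (k - L) = y + 2 ^ L * (c / 2 ^ k) := by
          conv_lhs => rw [← Nat.mod_add_div c (2 ^ k)]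
          conv_lhs => rw [hkL, mul_assoc]
          rw [Nat.add_mul_div_left _ _ (by positivity), ← hkL]
        have ht : c / 2 ^ k < 2 := by
          rw [Nat.div_lt_iff_lt_mul (by positivity)]; rw [pow_succ] at hc'; omega
        have hb : c.testBit k = decide (c / 2 ^ k = 1) := by
          rw [Nat.testBit_eq_decide_div_mod_eq, Nat.mod_eq_of_lt ht]
        rw [hdiv, hb, pow_succ]
        rw [pow_succ] at hl
        clear_value y
        generalize c / 2 ^ k = t at *
        have : t = 0 ∨ t = 1 := by omega
        rw [Bool.eq_iff_iff]
        rcases this with rfl | rfl <;> cases b <;> simp <;> omega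
      rw [List.filter_congr (q := fun c => decide (c / 2 ^ (k + 1 - (b :: l).length) +
        2 ^ (b :: l).length = heapIndex (b :: l)))]
      · apply List.map_congr_left
        intro c _
        simp only [Function.comp, List.length_cons, Nat.testBit_mod_two_pow]
        rw [decide_eq_true (by omega), Bool.true_and]
        congr 1; omega
      · intro c hc
        exact hf c hc
    cases l with
    | nil =>
      simp only [waveletTree, WaveletTree.bitmaskAt, Option.some.injEq] at h
      refine ⟨by simp, ?_⟩
      have : nodeList (k + 1) s 0 (heapIndex []) = s := by
        apply List.filter_eq_self.mpr
        intro c hc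
        simp [heapIndex, Nat.div_eq_of_lt (hs c hc)]
      simp only [List.length_nil, this, ← h]
      simp
    | cons b l =>
      cases b with
      | false =>
        simp only [waveletTree, WaveletTree.bitmaskAt] at h
        refine hsub false l ?_
        simpa using h
      | true =>
        simp only [waveletTree, WaveletTree.bitmaskAt] at h
        refine hsub true l ?_
        simpa using h

theorem testBit_eq_mod {c i : ℕ} : c.testBit i = decide (c / 2 ^ i % 2 = 1) :=
  Nat.testBit_eq_decide_div_mod_eq ..

theorem nodeList_child {k d h : ℕ} (hd : d < k) (s : List ℕ) (b : Bool) :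
    nodeList k s (d + 1) (2 * h + b.toNat) =
      (nodeList k s d h).filter fun c => c.testBit (k - 1 - d) == b := by
  rw [nodeList, nodeList, List.filter_filter]
  apply List.filter_congr
  intro c _
  have e1 : k - (d + 1) = k - 1 - d := by omega
  have e2 : 2 ^ (k - d) = 2 ^ (k - 1 - d) * 2 := by rw [← pow_succ]; congr 1; omega
  rw [testBit_eq_mod, e1, e2, ← Nat.div_div_eq_div_mul, pow_succ]
  generalize c / 2 ^ (k - 1 - d) = y
  rw [Bool.eq_iff_iff]
  cases b <;> simp <;> omega

/-- The number of characters that belong to the nodes of depth `d` before the node `h`. -/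
def before (k : ℕ) (s : List ℕ) (d h : ℕ) : ℕ :=
  (s.filter fun c => decide (c / 2 ^ (k - d) + 2 ^ d < h)).length

theorem before_succ (k : ℕ) (s : List ℕ) (d h : ℕ) :
    before k s d (h + 1) = before k s d h + (nodeList k s d h).length := by
  simp only [before, nodeList, Nat.lt_succ_iff]
  induction s with
  | nil => rfl
  | cons c s ih =>
    simp only [List.filter_cons]
    generalize c / 2 ^ (k - d) + 2 ^ d = x
    rcases Nat.lt_trichotomy x h with h1 | rfl | h1
    · simp [h1, h1.ne, h1.le, ih]; omega
    · simp [ih]; omega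
    · simp [h1.ne', h1.not_gt, h1.not_ge, ih]

theorem before_le (k : ℕ) (s : List ℕ) (d h : ℕ) : before k s d h ≤ s.length :=
  List.length_filter_le ..

theorem before_two_pow (k : ℕ) (s : List ℕ) (d : ℕ) : before k s d (2 ^ d) = 0 := by
  simp [before]

/-! ### Short characters -/

/-- The part of the character `c` that the lists of depth `d` hold.  Depths are grouped into
blocks of `τ`; a list holds the bits of `c` from depth `d` to the end of the block (or to the end
of `c`), the bit of depth `d` being bit `τ - 1`. -/
def shortChar (k τ d c : ℕ) : ℕ := c * 2 ^ τ / 2 ^ (k - τ * (d / τ)) * 2 ^ (d % τ) % 2 ^ τ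

theorem shortChar_lt (k τ d c : ℕ) : shortChar k τ d c < 2 ^ τ := Nat.mod_lt _ (by positivity)

theorem topBit_eq_testBit {τ c : ℕ} (hτ : 0 < τ) (hc : c < 2 ^ τ) :
    topBit τ c = c.testBit (τ - 1) := by
  have e : 2 ^ τ = 2 ^ (τ - 1) * 2 := by rw [← pow_succ]; congr 1; omega
  have : c / 2 ^ (τ - 1) < 2 := by
    rw [Nat.div_lt_iff_lt_mul (by positivity), mul_comm, ← e]; exact hc
  rw [testBit_eq_mod, Nat.mod_eq_of_lt this, topBit]
  congr 1
  rw [← Nat.one_le_div_iff (by positivity)]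
  apply propext; omega

theorem topBit_shortChar {k τ d : ℕ} (hτ : 0 < τ) (hd : d < k) (c : ℕ) :
    topBit τ (shortChar k τ d c) = c.testBit (k - 1 - d) := by
  rw [topBit_eq_testBit hτ (shortChar_lt _ _ _ _), shortChar]
  have he := Nat.mod_lt d hτ
  have hD := Nat.div_add_mod d τ
  rw [Nat.testBit_mod_two_pow, Nat.testBit_mul_two_pow, ← Nat.shiftRight_eq_div_pow,
    Nat.testBit_shiftRight, Nat.testBit_mul_two_pow]
  generalize τ * (d / τ) = D at *
  generalize d % τ = e at *
  have h1 : decide (τ - 1 < τ) = true := decide_eq_true (by omega)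
  have h2 : decide (e ≤ τ - 1) = true := decide_eq_true (by omega)
  have h3 : decide (τ ≤ k - D + (τ - 1 - e)) = true := decide_eq_true (by omega)
  rw [h1, h2, h3, Bool.true_and, Bool.true_and, Bool.true_and]
  congr 1; omega

theorem dropTop_shortChar {k τ d : ℕ} (hτ : 0 < τ) (c : ℕ) :
    dropTop τ (shortChar k τ d c) =
      if (d + 1) % τ = 0 then 0 else shortChar k τ (d + 1) c := by
  have he := Nat.mod_lt d hτ
  have hD := Nat.div_add_mod d τ
  have h1 : dropTop τ (shortChar k τ d c) =
      c * 2 ^ τ / 2 ^ (k - τ * (d / τ)) * 2 ^ (d % τ + 1) % 2 ^ τ := by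
    rw [dropTop, shortChar, Nat.mul_mod_mod, pow_succ]; congr 1; ring
  rw [h1]
  rcases Nat.lt_or_ge (d % τ + 1) τ with h | h
  · have h2 : (d + 1) % τ = d % τ + 1 := by
      conv_lhs => rw [← hD]
      rw [add_assoc, Nat.mul_add_mod, Nat.mod_eq_of_lt h]
    have h3 : (d + 1) / τ = d / τ := by
      conv_lhs => rw [← hD]
      rw [add_assoc, Nat.mul_add_div hτ, Nat.div_eq_of_lt h, add_zero]
    rw [if_neg (by omega), shortChar, h2, h3]
  · have h2 : d % τ + 1 = τ := by omega
    have h3 : (d + 1) % τ = 0 := by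
      conv_lhs => rw [← hD]
      rw [add_assoc, h2, Nat.mul_add_mod, Nat.mod_self]
    rw [if_pos h3, h2, Nat.mul_mod_left]

end WaveletRAM

/-! ### Symbolic execution -/

namespace WaveletRAM

open WordRAM

instance : Coe Var Expr := ⟨Expr.var⟩
instance (c : ℕ) : OfNat Expr c := ⟨Expr.lit c⟩
instance : Add Expr := ⟨Expr.bin .add⟩
instance : Sub Expr := ⟨Expr.bin .sub⟩
instance : Mul Expr := ⟨Expr.bin .mul⟩
instance : Div Expr := ⟨Expr.bin .div⟩
instance : Mod Expr := ⟨Expr.bin .mod⟩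
instance : ShiftLeft Expr := ⟨Expr.bin .shl⟩
instance : ShiftRight Expr := ⟨Expr.bin .shr⟩

infixr:50 " ;; " => Cmd.seq

section
variable (w : ℕ) (S : State) (a b : Expr) (c : ℕ) (x : Var)

@[simp] theorem Expr.val_var : (Expr.var x).val w S = S.v x := rfl
@[simp] theorem Expr.val_lit : (no_index (OfNat.ofNat c) : Expr).val w S = c := rfl
@[simp] theorem Expr.val_ld : (Expr.ld a).val w S = S.mem (a.val w S) := rfl
@[simp] theorem Expr.val_add : (a + b).val w S = a.val w S + b.val w S := rfl
@[simp] theorem Expr.val_sub : (a - b).val w S = a.val w S - b.val w S := rfl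
@[simp] theorem Expr.val_mul : (a * b).val w S = a.val w S * b.val w S := rfl
@[simp] theorem Expr.val_div : (a / b).val w S = a.val w S / b.val w S := rfl
@[simp] theorem Expr.val_mod : (a % b).val w S = a.val w S % b.val w S := rfl
@[simp] theorem Expr.val_shl : (a <<< b).val w S = a.val w S * 2 ^ b.val w S % 2 ^ w := rfl
@[simp] theorem Expr.val_shr : (a >>> b).val w S = a.val w S / 2 ^ b.val w S := rfl
@[simp] theorem Expr.ok_var : (Expr.var x).Ok w S ↔ True := Iff.rfl
@[simp] theorem Expr.ok_lit : (no_index (OfNat.ofNat c) : Expr).Ok w S ↔ c < 2 ^ w := Iff.rfl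
@[simp] theorem Expr.ok_ld : (Expr.ld a).Ok w S ↔ a.Ok w S := Iff.rfl
@[simp] theorem Expr.ok_add : (a + b).Ok w S ↔
    a.Ok w S ∧ b.Ok w S ∧ a.val w S + b.val w S < 2 ^ w := Iff.rfl
@[simp] theorem Expr.ok_sub : (a - b).Ok w S ↔
    a.Ok w S ∧ b.Ok w S ∧ b.val w S ≤ a.val w S := Iff.rfl
@[simp] theorem Expr.ok_mul : (a * b).Ok w S ↔
    a.Ok w S ∧ b.Ok w S ∧ a.val w S * b.val w S < 2 ^ w := Iff.rfl
@[simp] theorem Expr.ok_div : (a / b).Ok w S ↔ a.Ok w S ∧ b.Ok w S :=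
  ⟨fun h => ⟨h.1, h.2.1⟩, fun h => ⟨h.1, h.2, trivial⟩⟩
@[simp] theorem Expr.ok_mod : (a % b).Ok w S ↔ a.Ok w S ∧ b.Ok w S :=
  ⟨fun h => ⟨h.1, h.2.1⟩, fun h => ⟨h.1, h.2, trivial⟩⟩
@[simp] theorem Expr.ok_shl : (a <<< b).Ok w S ↔ a.Ok w S ∧ b.Ok w S :=
  ⟨fun h => ⟨h.1, h.2.1⟩, fun h => ⟨h.1, h.2, trivial⟩⟩
@[simp] theorem Expr.ok_shr : (a >>> b).Ok w S ↔ a.Ok w S ∧ b.Ok w S :=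
  ⟨fun h => ⟨h.1, h.2.1⟩, fun h => ⟨h.1, h.2, trivial⟩⟩

@[simp] theorem State.v_set (y : Var) : (S.set x c).v y = if y = x then c else S.v y := by
  simp [State.set, Function.update_apply]
@[simp] theorem State.mem_set : (S.set x c).mem = S.mem := rfl
@[simp] theorem State.v_put (p : ℕ) : (S.put p c).v = S.v := rfl
@[simp] theorem State.mem_put (p : ℕ) : (S.put p c).mem = Function.update S.mem p c := rfl
end

/-- The weakest precondition of a command without loops. -/
def Cmd.pre (w : ℕ) : Cmd → (State → Prop) → State → Prop
  | .skip, Q, S => Q S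
  | .set x e, Q, S => e.Ok w S ∧ Q (S.set x (e.val w S))
  | .store a e, Q, S => a.Ok w S ∧ e.Ok w S ∧ Q (S.put (a.val w S) (e.val w S))
  | .seq c₁ c₂, Q, S => c₁.pre w (c₂.pre w Q) S
  | .ite a b c₁ c₂, Q, S => a.Ok w S ∧ b.Ok w S ∧
      (a.val w S < b.val w S → c₁.pre w Q S) ∧ (b.val w S ≤ a.val w S → c₂.pre w Q S)
  | .loop _ _ _, _, _ => False

/-- A bound for the running time of a command without loops. -/
def Cmd.time : Cmd → ℕ
  | .skip => 0
  | .set _ e => e.cost + 1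
  | .store a e => a.cost + (e.cost + 1)
  | .seq c₁ c₂ => c₁.time + c₂.time
  | .ite a b c₁ c₂ => a.cost + b.cost + 2 + (c₁.time + c₂.time)
  | .loop _ _ _ => 0

theorem Cmd.within_of_pre {w : ℕ} {c : Cmd} {S : State} {Q : State → Prop}
    (h : c.pre w Q S) : c.Within w S c.time Q := by
  induction c generalizing S Q with
  | skip => exact within_skip h
  | set x e => exact within_set h.1 le_rfl h.2
  | store a e => exact within_store h.1 h.2.1 le_rfl h.2.2
  | seq c₁ c₂ ih₁ ih₂ =>
    exact within_seq _ _ ((ih₁ h).mono le_rfl fun S hS => ih₂ hS) le_rfl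
  | ite a b c₁ c₂ ih₁ ih₂ =>
    obtain ⟨ha, hb, h1, h2⟩ := h
    exact within_ite (c₁.time + c₂.time) ha hb
      (fun hlt => (ih₁ (h1 hlt)).mono (by omega) fun _ h => h)
      (fun hlt => (ih₂ (h2 (by omega))).mono (by omega) fun _ h => h) le_rfl
  | loop => exact h.elim

theorem within_seq_of {w : ℕ} {c₁ c₂ : Cmd} {S : State} {t₁ t₂ t : ℕ} {P Q : State → Prop}
    (h₁ : c₁.Within w S t₁ P)
    (h₂ : ∀ S', P S' → (∀ x ∉ c₁.writes, S'.v x = S.v x) → c₂.Within w S' t₂ Q)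
    (ht : t₁ + t₂ ≤ t) : (c₁ ;; c₂).Within w S t Q :=
  within_seq t₁ t₂ (h₁.frame.mono le_rfl fun S' h => h₂ S' h.1 h.2) ht

/-! ### Parameters -/

/-- What the correctness proof uses about the numerical parameters: `n` is the length of the
string, `k` the number of bits of a character, `τ` the number of levels in a block and the number
of bits of a short character, `q` the number of short characters in a cell. -/
structure Params (w n k q τ : ℕ) : Prop where
  two_le : 2 ≤ n
  k_pos : 1 ≤ k
  q_pos : 1 ≤ q
  tau_pos : 1 ≤ τ
  tau_le : τ ≤ k
  k_le : k ≤ w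
  q_le : q ≤ w
  pow_k : 2 ^ k ≤ 2 * n
  pow_L : 2 ^ (q * τ) ≤ n
  room : 256 * n ≤ 2 ^ w
  two_w : w + w < 2 ^ w
  long : k ≤ q → τ = k

theorem Params.L_lt {w n k q τ : ℕ} (h : Params w n k q τ) : q * τ < w := by
  have h1 := h.pow_L
  have h2 := h.room
  have h3 := h.two_le
  exact (Nat.pow_lt_pow_iff_right (a := 2) (by norm_num)).mp (by omega)

theorem Params.tau_lt {w n k q τ : ℕ} (h : Params w n k q τ) : τ < w := by
  have h1 := h.L_lt
  have h2 := Nat.mul_le_mul_right τ h.q_pos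
  omega

/-- The values of the variables that are constant after the initialization. -/
structure Consts (w n k q τ : ℕ) (S : State) : Prop where
  vn : S.v .vn = n
  vw : S.v .vw = w
  vk : S.v .vk = k
  vpk : S.v .vpk = 2 ^ k
  vq : S.v .vq = q
  vtau : S.v .vtau = τ
  vL : S.v .vL = q * τ
  vpL : S.v .vpL = 2 ^ (q * τ)
  vpT : S.v .vpT = 2 ^ τ
  vdir : S.v .vdir = 16 * n
  vptr : S.v .vptr = 32 * n
  vtab : S.v .vtab = 48 * n

/-- The variables with a constant value. -/
def constVars : List Var :=
  [.vn, .vw, .vk, .vpk, .vq, .vtau, .vL, .vpL, .vpT, .vdir, .vptr, .vtab]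

theorem Consts.of_frame {w n k q τ : ℕ} {S S' : State} (h : Consts w n k q τ S) {c : Cmd}
    (hf : ∀ x ∉ c.writes, S'.v x = S.v x) (hc : ∀ x ∈ constVars, x ∉ c.writes) :
    Consts w n k q τ S' := by
  have e : ∀ x ∈ constVars, S'.v x = S.v x := fun x hx => hf x (hc x hx)
  constructor <;> rw [e _ (by decide)]
  exacts [h.vn, h.vw, h.vk, h.vpk, h.vq, h.vtau, h.vL, h.vpL, h.vpT, h.vdir, h.vptr, h.vtab]

/-! ### Appending to packed lists -/

open Var in
/-- Append the bits of the number in `vx` to the bit list that starts at `vout` and has `vi` bits.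
The cell after the one that receives the first bit is overwritten, even if nothing is carried over
to it.  Hence the memory behind the list need not be cleared, but one spare cell is necessary. -/
def appendBits : Cmd :=
  .set va (vout + vi / vw) ;;
  .set vs (vi % vw) ;;
  .store va (.ld va + (vx : Expr) <<< (vs : Expr)) ;;
  .store (va + 1) ((vx : Expr) >>> (vw - vs : Expr))

open Var in
/-- Append the packed short characters in `vx` to the list that starts at the address in `base`
and has `vy` elements, in the same way as in `appendBits`. -/
def appendItems (base : Var) : Cmd :=
  .set va (base + vy / vq) ;;
  .set vs (vy % vq * vtau) ;;
  .store va (.ld va + (vx : Expr) <<< (vs : Expr) % vpL) ;;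
  .store (va + 1) ((vx : Expr) >>> (vL - vs : Expr))

/-- The memory `m` after writing `x` to the address `a` and `y` to the address `a + 1`. -/
def write₂ (m : ℕ → ℕ) (a x y : ℕ) : ℕ → ℕ := Function.update (Function.update m a x) (a + 1) y

theorem write₂_self (m : ℕ → ℕ) (a x y : ℕ) : write₂ m a x y a = x := by
  simp [write₂]

theorem write₂_succ (m : ℕ → ℕ) (a x y : ℕ) : write₂ m a x y (a + 1) = y := by
  simp [write₂]

theorem write₂_of_ne {m : ℕ → ℕ} {a x y b : ℕ} (h : b < a ∨ a + 1 < b) :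
    write₂ m a x y b = m b := by
  rw [write₂, Function.update_of_ne (by omega), Function.update_of_ne (by omega)]

theorem Stores.write_items {m : ℕ → ℕ} {a Q U X x cnt nb : ℕ} (hQ : 0 < Q) (hU : 0 < U)
    (h : Stores m a (Q * U) X (cnt / Q)) (hX : X < 2 ^ (U * cnt)) (hx : x < 2 ^ (U * nb))
    (hnb : nb ≤ Q) :
    Stores (write₂ m (a + cnt / Q) (m (a + cnt / Q) + x * 2 ^ (cnt % Q * U) % 2 ^ (Q * U))
      (x / 2 ^ (Q * U - cnt % Q * U))) a (Q * U) (X + 2 ^ (U * cnt) * x) ((cnt + nb) / Q) :=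
  h.append_items hQ hU hX hx hnb (write₂_self ..) (write₂_succ ..)
    fun j hj => write₂_of_ne (by omega)

variable {w n k q τ : ℕ} {S : State}

theorem appendBits_within (hp : Params w n k q τ) (hc : Consts w n k q τ S)
    (ha : S.v .vout + S.v .vi / w + 1 < 2 ^ w)
    (hlt : S.mem (S.v .vout + S.v .vi / w) + S.v .vx * 2 ^ (S.v .vi % w) % 2 ^ w < 2 ^ w) :
    appendBits.Within w S appendBits.time fun S' => S'.mem =
      write₂ S.mem (S.v .vout + S.v .vi / w)
        (S.mem (S.v .vout + S.v .vi / w) + S.v .vx * 2 ^ (S.v .vi % w) % 2 ^ w)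
        (S.v .vx / 2 ^ (w - S.v .vi % w)) := by
  apply Cmd.within_of_pre
  have hw : 0 < w := by have := hp.k_le; have := hp.k_pos; omega
  have := (Nat.mod_lt (S.v .vi) hw).le
  simp [appendBits, write₂, Cmd.pre, hc.vw, hlt]
  and_intros <;> omega

theorem appendItems_within (hp : Params w n k q τ) (hc : Consts w n k q τ S) (base : Var)
    (ha : S.v base + S.v .vy / q + 1 < 2 ^ w)
    (hlt : S.mem (S.v base + S.v .vy / q) + S.v .vx * 2 ^ (S.v .vy % q * τ) % 2 ^ (q * τ)
      < 2 ^ (q * τ)) :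
    (appendItems base).Within w S (appendItems base).time fun S' => S'.mem =
      write₂ S.mem (S.v base + S.v .vy / q)
        (S.mem (S.v base + S.v .vy / q) + S.v .vx * 2 ^ (S.v .vy % q * τ) % 2 ^ (q * τ))
        (S.v .vx / 2 ^ (q * τ - S.v .vy % q * τ)) := by
  apply Cmd.within_of_pre
  have h3 := Nat.mul_le_mul_right τ (Nat.mod_lt (S.v .vy) hp.q_pos).le
  have h4 := hp.L_lt
  have h5 := hp.two_w
  have h6 := Nat.pow_lt_pow_right (a := 2) (by norm_num) h4
  have h7 : ∀ x, x % 2 ^ w % 2 ^ (q * τ) = x % 2 ^ (q * τ) := fun x =>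
    Nat.mod_mod_of_dvd _ (pow_dvd_pow _ h4.le)
  simp [appendItems, write₂, Cmd.pre, hc.vq, hc.vL, hc.vpL, hc.vtau, h7]
  and_intros <;> omega

end WaveletRAM

/-! ### Splitting the list of a node -/

namespace WaveletRAM

open WordRAM

open Var in
/-- Process one cell, at address `vp`, of the list of a node.  The four table entries for the
cell are looked up, and the leading bits and the two packed sublists are appended to the bitmask
and to the lists of the children; `vu` is the number of leading bits `1` found so far. -/
def splitBody : Cmd :=
  (.set vent (vtab + 4 * .ld vp) ;; .set vx (.ld (vent + 1))) ;;
  appendBits ;;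
  (.set vx (.ld (vent + 2)) ;; .set vy (vi - vu)) ;;
  appendItems vbp ;;
  (.set vx (.ld (vent + 3)) ;; .set vy vu) ;;
  appendItems vrb ;;
  (.set vu (vu + .ld vent) ;; .set vi (vi + vq) ;; .set vp (vp + 1))

open Var in
/-- Process all cells of the list of a node. -/
def splitLoop : Cmd := .loop vi vm splitBody

/-- The situation before the list `l`, at address `P`, is split: the bitmask will be stored from
address `o` on, the lists of the children from addresses `bL` and `bR` on. -/
structure SplitPre (w n q τ : ℕ) (l : List ℕ) (o bL bR P : ℕ) (m₀ : ℕ → ℕ) : Prop where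
  lt : ∀ c ∈ l, c < 2 ^ τ
  len : l.length ≤ n
  bL_ge : 64 * n ≤ bL
  bR_eq : bR = bL + (l.length / q + 2)
  bR_le : bR + (l.length / q + 2) ≤ 96 * n
  o_ge : 96 * n ≤ o
  o_le : o + (l.length / w + 2) ≤ 112 * n
  P_ge : 64 * n ≤ P
  P_lt : P + l.length / q < 96 * n
  P_disj : P + l.length / q < bL ∨ bR + (l.length / q + 2) ≤ P
  list : Stores m₀ P (q * τ) (Nat.ofDigits (2 ^ τ) l) (l.length / q)
  table : ∀ x < 2 ^ (q * τ), TableEntry m₀ (48 * n) τ x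

/-- The loop invariant: the first `j` cells of the list have been processed. -/
structure SplitInv (w n k q τ : ℕ) (l : List ℕ) (o bL bR P : ℕ) (m₀ : ℕ → ℕ) (j : ℕ)
    (S : State) : Prop where
  consts : Consts w n k q τ S
  vout : S.v .vout = o
  vbp : S.v .vbp = bL
  vrb : S.v .vrb = bR
  vm : S.v .vm = l.length
  vp : S.v .vp = P + j
  vi : S.v .vi = j * q
  vu : S.v .vu = onesCount τ (l.take (j * q))
  bits : Stores S.mem o w (topBits τ (l.take (j * q))) ((l.take (j * q)).length / w)
  left : Stores S.mem bL (q * τ) (splitVal τ false (l.take (j * q)))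
    ((split τ false (l.take (j * q))).length / q)
  right : Stores S.mem bR (q * τ) (splitVal τ true (l.take (j * q)))
    ((split τ true (l.take (j * q))).length / q)
  frame : ∀ a, (a < o ∨ o + (l.length / w + 2) ≤ a) →
    (a < bL ∨ bR + (l.length / q + 2) ≤ a) → S.mem a = m₀ a

variable {w n k q τ : ℕ} {l : List ℕ} {o bL bR P : ℕ} {m₀ : ℕ → ℕ} {j : ℕ} {S : State}

set_option maxHeartbeats 1000000 in
theorem splitBody_within (hp : Params w n k q τ) (hg : SplitPre w n q τ l o bL bR P m₀)
    (hj : j * q < l.length) (hI : SplitInv w n k q τ l o bL bR P m₀ j S) :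
    splitBody.Within w S splitBody.time (SplitInv w n k q τ l o bL bR P m₀ (j + 1)) := by
  have hroom := hp.room
  have hq := hp.q_pos
  have hτ := hp.tau_pos
  have hw : 0 < w := by have := hp.k_le; have := hp.k_pos; omega
  have hn := hp.two_le
  set T := l.take (j * q) with hT
  set ch := (l.drop (j * q)).take q with hch
  have hTlen : T.length = j * q := by rw [hT, List.length_take]; omega
  have hT' : l.take ((j + 1) * q) = T ++ ch := by
    rw [hT, hch, Nat.succ_mul, List.take_add]
  have hchlt : ∀ c ∈ ch, c < 2 ^ τ := fun c hc =>
    hg.lt c (List.mem_of_mem_drop (List.mem_of_mem_take hc))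
  have hchlen : ch.length ≤ q := by rw [hch, List.length_take]; omega
  have hjq : j ≤ l.length / q := (Nat.le_div_iff_mul_le hq).mpr hj.le
  have hTw : j * q / w ≤ l.length / w := Nat.div_le_div_right hj.le
  have hsplitT := split_length_add τ T
  have hsplitc := split_length_add τ ch
  have hleft : (split τ false T).length / q ≤ l.length / q := Nat.div_le_div_right (by omega)
  have hright : (split τ true T).length / q ≤ l.length / q := Nat.div_le_div_right (by omega)
  have hg1 := hg.bL_ge
  have hg2 := hg.bR_eq
  have hg3 := hg.bR_le
  have hg4 := hg.o_ge
  have hg5 := hg.o_le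
  have hg6 := hg.P_ge
  have hg7 := hg.P_lt
  have hg8 := hg.P_disj
  have hframe := hI.frame
  have z1 := Nat.zero_le (j * q / w)
  have z2 := Nat.zero_le ((split τ false T).length / q)
  have z3 := Nat.zero_le ((split τ true T).length / q)
  -- the cell read is the packed list of the next `q` short characters
  set x := Nat.ofDigits (2 ^ τ) ch with hx
  have hread : S.mem (P + j) = x := by
    rw [hframe _ (by omega) (by omega), hg.list j hjq, hx, hch, ← ofDigits_div_mod hg.lt,
      ← pow_mul, ← pow_mul, show q * τ * j = τ * (j * q) by ring, mul_comm q τ]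
  have hxlt : x < 2 ^ (q * τ) := by
    refine (ofDigits_lt_two_pow hchlt).trans_le (Nat.pow_le_pow_right (by norm_num) ?_)
    rw [mul_comm]; exact Nat.mul_le_mul_right _ hchlen
  have hLn := hp.pow_L
  obtain ⟨t1, t2, t3, t4⟩ := (hg.table x hxlt).list hp.tau_pos hchlt
  have hlenT : (T ++ ch).length = j * q + ch.length := by rw [List.length_append, hTlen]
  have hones : onesCount τ ch ≤ q := (onesCount_le τ ch).trans hchlen
  have honesT : onesCount τ T ≤ j * q := hTlen ▸ onesCount_le τ T
  have hlen := hg.len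
  have hjqn : j * q + q ≤ 2 * n := by
    have h1 := Nat.lt_two_pow_self (n := q * τ)
    have h2 := Nat.le_mul_of_pos_right q hτ
    omega
  have hc := hI.consts
  -- the leading bits go to the bitmask, which is a list with items of one bit
  refine within_seq_of (P := fun S' => S'.mem = S.mem ∧ S'.v .vent = 48 * n + 4 * x ∧
      S'.v .vx = topBits τ ch) (Cmd.within_of_pre ?_) ?_ le_rfl
  · simp [Cmd.pre, hc.vtab, hI.vp, hread]
    refine ⟨by omega, ⟨by omega, by omega⟩, ?_⟩
    rw [hframe _ (by omega) (by omega), t2]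
  rintro S₁ ⟨hm1, hent, hx1⟩ hf1
  have hc1 := hc.of_frame hf1 (by decide)
  have ho1 : S₁.v .vout = o := by rw [hf1 _ (by decide), hI.vout]
  have hi1 : S₁.v .vi = j * q := by rw [hf1 _ (by decide), hI.vi]
  have hbits : Stores S.mem o (w * 1) (topBits τ T) (j * q / w) := by
    rw [mul_one, ← hTlen]; exact hI.bits
  have hbitsX : topBits τ T < 2 ^ (1 * (j * q)) := by
    rw [one_mul, ← hTlen]; exact topBits_lt _ _
  have hb1 := hbits.add_lt hw hbitsX (topBits τ ch)
  rw [mul_one, mul_one] at hb1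
  have hb2 := hbits.write_items hw one_pos hbitsX (x := topBits τ ch) (nb := ch.length)
    (by rw [one_mul]; exact topBits_lt _ _) (hchlen.trans hp.q_le)
  rw [mul_one, mul_one, one_mul] at hb2
  refine within_seq_of (appendBits_within hp hc1 ?_ ?_) ?_ le_rfl
  · rw [ho1, hi1]; omega
  · rw [ho1, hi1, hm1, hx1]; exact hb1
  intro S₂ hm2 hf2
  rw [ho1, hi1, hm1, hx1] at hm2
  rw [← hm2] at hb2
  have hfr2 : ∀ a, (a < o ∨ o + (l.length / w + 2) ≤ a) → S₂.mem a = S.mem a := by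
    intro a ha
    rw [hm2, write₂_of_ne (by omega)]
  have hc2 := hc1.of_frame hf2 (by decide)
  -- the characters with leading bit `0` go to the list of the left child
  refine within_seq_of (P := fun S' => S'.mem = S₂.mem ∧ S'.v .vx = splitVal τ false ch ∧
      S'.v .vy = (split τ false T).length) (Cmd.within_of_pre ?_) ?_ le_rfl
  · have hent2 : S₂.v .vent = 48 * n + 4 * x := by rw [hf2 _ (by decide), hent]
    have hi2 : S₂.v .vi = j * q := by rw [hf2 _ (by decide), hi1]
    have hu2 : S₂.v .vu = onesCount τ T := by
      rw [hf2 _ (by decide), hf1 _ (by decide), hI.vu]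
    simp [Cmd.pre, hent2, hi2, hu2]
    refine ⟨⟨by omega, by omega⟩, honesT, ?_, ?_⟩
    · rw [hfr2 _ (by omega), hframe _ (by omega) (by omega), t3]
    · rw [onesCount]; omega
  rintro S₃ ⟨hm3, hx3, hy3⟩ hf3
  have hc3 := hc2.of_frame hf3 (by decide)
  have hbp3 : S₃.v .vbp = bL := by
    rw [hf3 _ (by decide), hf2 _ (by decide), hf1 _ (by decide), hI.vbp]
  have hL3 : Stores S₃.mem bL (q * τ) (splitVal τ false T) ((split τ false T).length / q) := by
    refine hI.left.congr fun i hi => ?_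
    rw [← hT] at hi
    rw [hm3, hfr2 _ (by omega)]
  have hl1 := hL3.add_lt hq splitVal_lt (splitVal τ false ch)
  have hl2 := hL3.write_items hq hτ splitVal_lt (x := splitVal τ false ch) splitVal_lt (by omega)
  refine within_seq_of (appendItems_within hp hc3 .vbp ?_ ?_) ?_ le_rfl
  · rw [hbp3, hy3]; omega
  · rw [hbp3, hy3, hx3]; exact hl1
  intro S₄ hm4 hf4
  rw [hbp3, hy3, hx3] at hm4
  rw [← hm4] at hl2
  have hfr4 : ∀ a, (a < bL ∨ bL + (l.length / q + 2) ≤ a) → S₄.mem a = S₂.mem a := by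
    intro a ha
    rw [hm4, write₂_of_ne (by omega), hm3]
  have hc4 := hc3.of_frame hf4 (by decide)
  have hent4 : S₄.v .vent = 48 * n + 4 * x := by
    rw [hf4 _ (by decide), hf3 _ (by decide), hf2 _ (by decide), hent]
  have hu4 : S₄.v .vu = onesCount τ T := by
    rw [hf4 _ (by decide), hf3 _ (by decide), hf2 _ (by decide), hf1 _ (by decide), hI.vu]
  -- the characters with leading bit `1` go to the list of the right child
  refine within_seq_of (P := fun S' => S'.mem = S₄.mem ∧ S'.v .vx = splitVal τ true ch ∧
      S'.v .vy = (split τ true T).length) (Cmd.within_of_pre ?_) ?_ le_rfl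
  · simp [Cmd.pre, hent4, hu4]
    refine ⟨⟨by omega, by omega⟩, ?_, rfl⟩
    rw [hfr4 _ (by omega), hfr2 _ (by omega), hframe _ (by omega) (by omega), t4]
  rintro S₅ ⟨hm5, hx5, hy5⟩ hf5
  have hc5 := hc4.of_frame hf5 (by decide)
  have hrb5 : S₅.v .vrb = bR := by
    rw [hf5 _ (by decide), hf4 _ (by decide), hf3 _ (by decide), hf2 _ (by decide),
      hf1 _ (by decide), hI.vrb]
  have hR5 : Stores S₅.mem bR (q * τ) (splitVal τ true T) ((split τ true T).length / q) := by
    refine hI.right.congr fun i hi => ?_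
    rw [← hT] at hi
    rw [hm5, hfr4 _ (by omega), hfr2 _ (by omega)]
  have hr1 := hR5.add_lt hq splitVal_lt (splitVal τ true ch)
  have hr2 := hR5.write_items hq hτ splitVal_lt (x := splitVal τ true ch) splitVal_lt (by omega)
  refine within_seq_of (appendItems_within hp hc5 .vrb ?_ ?_) ?_ le_rfl
  · rw [hrb5, hy5]; omega
  · rw [hrb5, hy5, hx5]; exact hr1
  intro S₆ hm6 hf6
  rw [hrb5, hy5, hx5] at hm6
  rw [← hm6] at hr2
  have hfr6 : ∀ a, (a < bR ∨ bR + (l.length / q + 2) ≤ a) → S₆.mem a = S₄.mem a := by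
    intro a ha
    rw [hm6, write₂_of_ne (by omega), hm5]
  have hc6 := hc5.of_frame hf6 (by decide)
  have hent6 : S₆.v .vent = 48 * n + 4 * x := by
    rw [hf6 _ (by decide), hf5 _ (by decide), hent4]
  have hu6 : S₆.v .vu = onesCount τ T := by
    rw [hf6 _ (by decide), hf5 _ (by decide), hu4]
  have hi6 : S₆.v .vi = j * q := by
    rw [hf6 _ (by decide), hf5 _ (by decide), hf4 _ (by decide), hf3 _ (by decide),
      hf2 _ (by decide), hi1]
  have hp6 : S₆.v .vp = P + j := by
    rw [hf6 _ (by decide), hf5 _ (by decide), hf4 _ (by decide), hf3 _ (by decide),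
      hf2 _ (by decide), hf1 _ (by decide), hI.vp]
  have hones6 : S₆.mem (48 * n + 4 * x) = onesCount τ ch := by
    rw [hfr6 _ (by omega), hfr4 _ (by omega), hfr2 _ (by omega), hframe _ (by omega) (by omega),
      t1]
  have hcnt : onesCount τ (T ++ ch) = onesCount τ T + onesCount τ ch := by
    simp [onesCount, split_append]
  refine ((Cmd.within_of_pre (Q := fun S' => S'.mem = S₆.mem ∧ S'.v .vp = P + (j + 1) ∧
    S'.v .vi = (j + 1) * q ∧ S'.v .vu = onesCount τ (T ++ ch)) ?_).frame).mono le_rfl ?_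
  · have hs : (j + 1) * q = j * q + q := Nat.succ_mul ..
    simp [Cmd.pre, hent6, hu6, hi6, hp6, hones6, hc6.vq, hcnt, hs]
    and_intros <;> omega
  rintro S₇ ⟨⟨hm7, hp7, hi7, hu7⟩, hf7⟩
  have hf : ∀ x ∉ splitBody.writes, S₇.v x = S.v x := by
    intro x hx
    simp only [splitBody, Cmd.writes, List.mem_append, not_or] at hx
    rw [hf7 x (by simpa [Cmd.writes] using hx.2.2.2.2.2.2), hf6 x hx.2.2.2.2.2.1,
      hf5 x (by simpa [Cmd.writes] using hx.2.2.2.2.1), hf4 x hx.2.2.2.1,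
      hf3 x (by simpa [Cmd.writes] using hx.2.2.1), hf2 x hx.2.1,
      hf1 x (by simpa [Cmd.writes] using hx.1)]
  refine ⟨hc.of_frame hf (by decide), ?_, ?_, ?_, ?_, hp7, hi7, ?_, ?_, ?_, ?_, ?_⟩
  · rw [hf _ (by decide), hI.vout]
  · rw [hf _ (by decide), hI.vbp]
  · rw [hf _ (by decide), hI.vrb]
  · rw [hf _ (by decide), hI.vm]
  · rw [hT', hu7]
  · rw [hT', hlenT, topBits_append, hTlen]
    have h5 : (j * q + ch.length) / w ≤ l.length / w := by
      rw [← hlenT, ← hT']; exact Nat.div_le_div_right (List.length_take_le' ..)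
    refine hb2.congr fun i hi => ?_
    rw [hm7, hfr6 _ (by omega), hfr4 _ (by omega)]
  · rw [hT', split_append, splitVal_append, List.length_append]
    have h5 : ((split τ false T).length + (split τ false ch).length) / q ≤ l.length / q := by
      refine Nat.div_le_div_right ?_
      have := List.length_take_le' ((j + 1) * q) l
      rw [hT', List.length_append] at this
      omega
    refine hl2.congr fun i hi => ?_
    rw [hm7, hfr6 _ (by omega)]
  · rw [hT', split_append, splitVal_append, List.length_append]
    refine hr2.congr fun i hi => ?_
    rw [hm7]
  · intro a h1 h2
    rw [hm7, hfr6 _ (by omega), hfr4 _ (by omega), hfr2 _ (by omega), hframe _ h1 h2]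

theorem splitLoop_within (hp : Params w n k q τ) (hg : SplitPre w n q τ l o bL bR P m₀)
    (hI : SplitInv w n k q τ l o bL bR P m₀ 0 S) :
    splitLoop.Within w S ((splitBody.time + 4) * (l.length / q + 2)) fun S' =>
      ∃ j, l.length ≤ j * q ∧ SplitInv w n k q τ l o bL bR P m₀ j S' := by
  set N := (l.length + q - 1) / q with hN
  have hq := hp.q_pos
  have hN1 : l.length ≤ N * q := by
    have h1 := Nat.div_add_mod (l.length + q - 1) q
    have h2 := Nat.mod_lt (l.length + q - 1) hq
    rw [mul_comm, ← hN] at h1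
    omega
  have hN2 : N ≤ l.length / q + 1 := by
    rw [← Nat.add_div_right _ hq]; exact Nat.div_le_div_right (by omega)
  refine (within_loop N (SplitInv w n k q τ l o bL bR P m₀) (fun _ => splitBody.time)
    (fun j => (splitBody.time + 4) * j) hI (fun _ _ _ => by simp) ?_ ?_ ?_ ?_).mono
    le_rfl fun S' h => ⟨N, hN1, h⟩
  · intro j hj S hI
    have : j * q < l.length := by
      have h1 : (j + 1) * q ≤ N * q := Nat.mul_le_mul_right _ hj
      have h2 : N * q ≤ l.length + q - 1 := Nat.div_mul_le_self _ _
      rw [Nat.succ_mul] at h1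
      omega
    refine ⟨?_, splitBody_within hp hg this hI⟩
    simpa [hI.vi, hI.vm] using this
  · intro S hI
    simpa [hI.vi, hI.vm] using hN1
  · intro j _
    exact (Nat.mul_succ ..).ge
  · simp only [Expr.cost]
    have := Nat.mul_le_mul_left (splitBody.time + 4) hN2
    have e := Nat.mul_add (splitBody.time + 4) (l.length / q) 2
    rw [Nat.mul_succ] at this
    omega

end WaveletRAM

/-! ### One level of the tree -/

namespace WaveletRAM

open WordRAM

/-- The characters of `s` that belong to the node with heap number `h`. -/
def nodeChars (k : ℕ) (s : List ℕ) (h : ℕ) : List ℕ := nodeList k s (Nat.log 2 h) h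

/-- The bitmask of the node with heap number `h`. -/
def nodeBits (k : ℕ) (s : List ℕ) (h : ℕ) : List Bool :=
  (nodeChars k s h).map fun c => c.testBit (k - 1 - Nat.log 2 h)

/-- What a list at depth `d` holds of a character when it is created: nothing at the first level
of a block, the short character elsewhere. -/
def initialChar (k τ d c : ℕ) : ℕ := if d % τ = 0 then 0 else shortChar k τ d c

theorem log_eq {d h : ℕ} (h1 : 2 ^ d ≤ h) (h2 : h < 2 ^ (d + 1)) : Nat.log 2 h = d :=
  Nat.log_eq_of_pow_le_of_lt_pow h1 h2

theorem nodeChars_eq {k d h : ℕ} {s : List ℕ} (h1 : 2 ^ d ≤ h) (h2 : h < 2 ^ (d + 1)) :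
    nodeChars k s h = nodeList k s d h := by rw [nodeChars, log_eq h1 h2]

theorem nodeChars_child {k d h : ℕ} {s : List ℕ} (hd : d < k) (h1 : 2 ^ d ≤ h)
    (h2 : h < 2 ^ (d + 1)) (b : Bool) :
    nodeChars k s (2 * h + b.toNat) =
      (nodeChars k s h).filter fun c => c.testBit (k - 1 - d) == b := by
  rw [nodeChars_eq (d := d + 1), nodeChars_eq h1 h2, nodeList_child hd]
  · rw [pow_succ]; omega
  · rw [pow_succ]; cases b <;> simp <;> omega

/-- Splitting the list of a node gives the lists of its children. -/
theorem split_nodeChars {k τ d h : ℕ} {s : List ℕ} (hτ : 0 < τ) (hd : d < k) (h1 : 2 ^ d ≤ h)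
    (h2 : h < 2 ^ (d + 1)) (b : Bool) :
    split τ b ((nodeChars k s h).map (shortChar k τ d)) =
      (nodeChars k s (2 * h + b.toNat)).map (initialChar k τ (d + 1)) := by
  rw [nodeChars_child hd h1 h2, split, List.filter_map, List.map_map]
  have e : ∀ c, topBit τ (shortChar k τ d c) = c.testBit (k - 1 - d) := topBit_shortChar hτ hd
  simp only [Function.comp_def, e, dropTop_shortChar hτ]
  rfl

theorem topBits_nodeChars {k τ d h : ℕ} {s : List ℕ} (hτ : 0 < τ) (hd : d < k) (h1 : 2 ^ d ≤ h)
    (h2 : h < 2 ^ (d + 1)) :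
    topBits τ ((nodeChars k s h).map (shortChar k τ d)) = bitsVal (nodeBits k s h) := by
  rw [topBits, nodeBits, List.map_map, log_eq h1 h2]
  congr 1
  exact List.map_congr_left fun c _ => topBit_shortChar hτ hd c

/-- The lists of the nodes of depth `d` with numbers from `h₁` to `h₂ - 1` are stored between the
addresses `B` and `E`, in order; the characters are represented by means of `f`.  A list of `m`
characters may touch `m / q + 2` cells, including the spare cell of `appendItems`. -/
structure Lists (n k q τ : ℕ) (s : List ℕ) (f : ℕ → ℕ) (m : ℕ → ℕ) (B E h₁ h₂ : ℕ) : Prop where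
  len : ∀ h, h₁ ≤ h → h < h₂ → m (16 * n + 2 * h + 1) = (nodeChars k s h).length
  lo : ∀ h, h₁ ≤ h → h < h₂ → B ≤ m (16 * n + 2 * h)
  hi : ∀ h, h₁ ≤ h → h < h₂ → m (16 * n + 2 * h) + ((nodeChars k s h).length / q + 2) ≤ E
  sep : ∀ h h', h₁ ≤ h → h < h' → h' < h₂ →
    m (16 * n + 2 * h) + ((nodeChars k s h).length / q + 2) ≤ m (16 * n + 2 * h')
  stores : ∀ h, h₁ ≤ h → h < h₂ → Stores m (m (16 * n + 2 * h)) (q * τ)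
    (Nat.ofDigits (2 ^ τ) ((nodeChars k s h).map f)) ((nodeChars k s h).length / q)

/-- The bitmasks of the nodes with numbers below `h₁` are stored, in order, below the address
`E`, and the directory describes them.  The spare cell of `appendBits` is not reserved: it is the
first cell of the next bitmask, which is cleared when that one is begun. -/
structure Done (w n k : ℕ) (s : List ℕ) (m : ℕ → ℕ) (E h₁ : ℕ) : Prop where
  len : ∀ h, 1 ≤ h → h < h₁ → m (16 * n + 2 * h + 1) = (nodeChars k s h).length
  lo : ∀ h, 1 ≤ h → h < h₁ → 96 * n ≤ m (16 * n + 2 * h)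
  hi : ∀ h, 1 ≤ h → h < h₁ → m (16 * n + 2 * h) + ((nodeChars k s h).length / w + 1) ≤ E
  sep : ∀ h h', 1 ≤ h → h < h' → h' < h₁ →
    m (16 * n + 2 * h) + ((nodeChars k s h).length / w + 1) ≤ m (16 * n + 2 * h')
  stores : ∀ h, 1 ≤ h → h < h₁ → Stores m (m (16 * n + 2 * h)) w
    (bitsVal (nodeBits k s h)) ((nodeChars k s h).length / w)

/-- The two list buffers: `OB` holds the lists of the current level, `NB` those of the next. -/
def Buffers (n OB NB : ℕ) : Prop :=
  (OB = 64 * n ∧ NB = 80 * n) ∨ (OB = 80 * n ∧ NB = 64 * n)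

/-- The loop invariant while the nodes of depth `d` are processed, before node `h`. -/
structure LevelInv (w n k q τ : ℕ) (s : List ℕ) (d OB NB : ℕ) (m₀ : ℕ → ℕ) (h : ℕ)
    (S : State) : Prop where
  consts : Consts w n k q τ S
  vh : S.v .vh = h
  vhi : S.v .vhi = 2 ^ (d + 1)
  bp_ge : NB ≤ S.v .vbp
  bp_le : S.v .vbp + 4 * 2 ^ d ≤ NB + 2 * before k s d h + 4 * h
  out_ge : 96 * n ≤ S.v .vout
  out_le : S.v .vout ≤ 96 * n + (n * d + before k s d h) / w + h
  cur : Lists n k q τ s (shortChar k τ d) S.mem OB (OB + 16 * n) h (2 ^ (d + 1))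
  next : Lists n k q τ s (initialChar k τ (d + 1)) S.mem NB (S.v .vbp) (2 ^ (d + 1)) (2 * h)
  done : Done w n k s S.mem (S.v .vout) h
  frame : ∀ a < 64 * n, a < 16 * n ∨ 32 * n ≤ a → S.mem a = m₀ a

open Var in
/-- Prepare the splitting of the list of the node `vh`.  The directory entry of the node, so far
the address of its list, becomes the address of its bitmask.  The sizes of the lists of the
children are not yet known, so that each of them gets room for the whole list. -/
def nodeBegin : Cmd :=
  .set vp (.ld (vdir + 2 * vh)) ;; .set vm (.ld (vdir + 2 * vh + 1)) ;;
  .store (vdir + 2 * vh) vout ;; .set vrb (vbp + (vm / vq + 2)) ;;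
  .store vout 0 ;; .store vbp 0 ;; .store vrb 0 ;; .set vi 0 ;; .set vu 0

open Var in
/-- Enter the children of the node `vh` into the directory. -/
def nodeEnd : Cmd :=
  .store (vdir + 4 * vh) vbp ;; .store (vdir + 4 * vh + 1) (vm - vu) ;;
  .store (vdir + 4 * vh + 2) vrb ;; .store (vdir + 4 * vh + 3) vu ;;
  .set vout (vout + (vm / vw + 1)) ;; .set vbp (vrb + (vm / vq + 2)) ;; .set vh (vh + 1)

/-- Process the node `vh`. -/
def nodeCmd : Cmd := nodeBegin ;; splitLoop ;; nodeEnd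

variable {w n k q τ : ℕ} {s : List ℕ} {d OB NB h : ℕ} {m₀ : ℕ → ℕ} {S : State}

set_option maxHeartbeats 2000000 in
theorem nodeCmd_within (hp : Params w n k q τ) (hs : s.length = n) (hB : Buffers n OB NB)
    (hd : d < k) (h1 : 2 ^ d ≤ h) (h2 : h < 2 ^ (d + 1))
    (hT : ∀ x < 2 ^ (q * τ), TableEntry m₀ (48 * n) τ x)
    (hI : LevelInv w n k q τ s d OB NB m₀ h S) :
    nodeCmd.Within w S ((splitBody.time + 4) * ((nodeChars k s h).length / q + 2) +
        (nodeBegin.time + nodeEnd.time))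
      (LevelInv w n k q τ s d OB NB m₀ (h + 1)) := by
  have hroom := hp.room
  have hn := hp.two_le
  have hq := hp.q_pos
  have hτ := hp.tau_pos
  have hc := hI.consts
  have hw : 0 < w := by have := hp.k_le; have := hp.k_pos; omega
  set l := (nodeChars k s h).map (shortChar k τ d) with hl
  have hllen : l.length = (nodeChars k s h).length := List.length_map ..
  have hcnt : before k s d (h + 1) = before k s d h + l.length := by
    rw [before_succ, hllen, nodeChars_eq h1 h2]
  have hcnt2 := before_le k s d (h + 1)
  rw [hs] at hcnt2
  have hpk : 2 * 2 ^ d ≤ 2 ^ k := by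
    rw [← pow_succ']; exact Nat.pow_le_pow_right (by norm_num) hd
  have hpk2 := hp.pow_k
  have hp2 : 2 ^ (d + 1) = 2 * 2 ^ d := pow_succ' ..
  have h1' : 1 ≤ 2 ^ d := Nat.one_le_two_pow
  have hlq : l.length / q ≤ l.length := Nat.div_le_self _ _
  have z1 := Nat.zero_le (l.length / q)
  have z2 := Nat.zero_le (l.length / w)
  set P := S.mem (16 * n + 2 * h) with hP
  set o := S.v .vout with ho
  set bL := S.v .vbp with hbL
  have hPlo := hI.cur.lo h le_rfl h2
  have hPhi := hI.cur.hi h le_rfl h2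
  have hlen := hI.cur.len h le_rfl h2
  have hsto := hI.cur.stores h le_rfl h2
  rw [← hP, ← hllen] at hPhi
  rw [← hP] at hPlo
  rw [← hllen] at hlen
  rw [← hP, ← hl, ← hllen] at hsto
  have hbp1 := hI.bp_ge
  have hbp2 := hI.bp_le
  have ho1 := hI.out_ge
  have ho2 := hI.out_le
  rw [← hbL] at hbp1 hbp2
  rw [← ho] at ho1 ho2
  have hnd : n * d + n ≤ n * w := by
    have := Nat.mul_le_mul_left n (show d + 1 ≤ w from hd.trans_le hp.k_le)
    rwa [Nat.mul_succ] at this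
  have hdw : (n * d + before k s d h) / w + l.length / w ≤ (n * d + before k s d (h + 1)) / w := by
    rw [hcnt, ← Nat.add_assoc]; exact Nat.div_add_div_le_add_div
  have hdw2 : (n * d + before k s d (h + 1)) / w ≤ n :=
    Nat.div_le_of_le_mul (by rw [mul_comm w n]; omega)
  have z3 := Nat.zero_le ((n * d + before k s d h) / w)
  unfold Buffers at hB
  -- the state before the loop
  have hbegin : nodeBegin.Within w S nodeBegin.time fun S' =>
      S'.mem = Function.update (Function.update (Function.update (Function.update S.mem
        (16 * n + 2 * h) o) o 0) bL 0) (bL + (l.length / q + 2)) 0 ∧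
      S'.v .vp = P ∧ S'.v .vm = l.length ∧ S'.v .vrb = bL + (l.length / q + 2) ∧
      S'.v .vi = 0 ∧ S'.v .vu = 0 := by
    apply Cmd.within_of_pre
    simp [nodeBegin, Cmd.pre, hc.vdir, hc.vq, hI.vh, hlen, ← hP, ← ho, ← hbL]
    and_intros <;> omega
  unfold nodeCmd
  refine within_seq_of (t₂ := (splitBody.time + 4) * ((nodeChars k s h).length / q + 2) +
    nodeEnd.time) hbegin ?_ (by omega)
  clear hbegin
  rintro S₁ ⟨hm1, hp1, hvm1, hrb1, hi1, hu1⟩ hf1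
  have hfr1 : ∀ a, a ≠ 16 * n + 2 * h → a ≠ o → a ≠ bL → a ≠ bL + (l.length / q + 2) →
      S₁.mem a = S.mem a := by
    intro a g1 g2 g3 g4
    rw [hm1, Function.update_of_ne g4, Function.update_of_ne g3, Function.update_of_ne g2,
      Function.update_of_ne g1]
  have hd1 : S₁.mem (16 * n + 2 * h) = o := by
    rw [hm1, Function.update_of_ne (by omega), Function.update_of_ne (by omega),
      Function.update_of_ne (by omega), Function.update_self]
  have ho1' : S₁.mem o = 0 := by
    rw [hm1, Function.update_of_ne (by omega), Function.update_of_ne (by omega),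
      Function.update_self]
  have hb1' : S₁.mem bL = 0 := by
    rw [hm1, Function.update_of_ne (by omega), Function.update_self]
  have hr1' : S₁.mem (bL + (l.length / q + 2)) = 0 := by rw [hm1, Function.update_self]
  have hpre : SplitPre w n q τ l o bL (bL + (l.length / q + 2)) P S₁.mem := by
    refine ⟨?_, by omega, by omega, rfl, by omega, by omega, by omega, by omega, by omega,
      by omega, ?_, ?_⟩
    · intro c hc
      simp only [hl, List.mem_map] at hc
      obtain ⟨c', _, rfl⟩ := hc
      exact shortChar_lt _ _ _ _
    · refine hsto.congr fun i hi => hfr1 _ ?_ ?_ ?_ ?_ <;> omega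
    · intro x hx
      have hLn := hp.pow_L
      obtain ⟨t1, t2, t3, t4⟩ := hT x hx
      refine ⟨?_, ?_, ?_, ?_⟩ <;>
        rw [hfr1 _ (by omega) (by omega) (by omega) (by omega),
          hI.frame _ (by omega) (by omega)] <;> assumption
  have hinv : SplitInv w n k q τ l o bL (bL + (l.length / q + 2)) P S₁.mem 0 S₁ := by
    refine ⟨hc.of_frame hf1 (by decide), ?_, ?_, hrb1, hvm1, by omega, by omega, ?_, ?_, ?_, ?_,
      fun _ _ _ => rfl⟩
    · rw [hf1 _ (by decide)]
    · rw [hf1 _ (by decide)]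
    · simp [hu1, onesCount, split]
    · intro i hi
      obtain rfl : i = 0 := by simpa using hi
      simp [ho1', topBits, bitsVal]
    · intro i hi
      obtain rfl : i = 0 := by simpa [split] using hi
      simp [hb1', splitVal, split]
    · intro i hi
      obtain rfl : i = 0 := by simpa [split] using hi
      simp [hr1', splitVal, split]
  refine within_seq_of (splitLoop_within hp hpre hinv) ?_ (by rw [hllen])
  rintro S₂ ⟨j, hj, hI2⟩ hf2
  have htake : l.take (j * q) = l := List.take_of_length_le hj
  have hfr2 := hI2.frame
  have hbits := hI2.bits
  have hleft := hI2.left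
  have hright := hI2.right
  have hu2 := hI2.vu
  rw [htake] at hbits hleft hright hu2
  have hsl := split_length_add τ l
  have hL0 : split τ false l = (nodeChars k s (2 * h)).map (initialChar k τ (d + 1)) :=
    split_nodeChars hτ hd h1 h2 false
  have hL1 : split τ true l = (nodeChars k s (2 * h + 1)).map (initialChar k τ (d + 1)) :=
    split_nodeChars hτ hd h1 h2 true
  have hlen0 : (split τ false l).length = (nodeChars k s (2 * h)).length := by
    rw [hL0, List.length_map]
  have hlen1 : (split τ true l).length = (nodeChars k s (2 * h + 1)).length := by
    rw [hL1, List.length_map]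
  unfold splitVal at hleft hright
  rw [hlen0] at hleft hsl
  rw [hlen1] at hright hsl
  rw [hL0] at hleft
  rw [hL1] at hright
  rw [topBits_nodeChars hτ hd h1 h2] at hbits
  have hu2' : S₂.v .vu = (nodeChars k s (2 * h + 1)).length := by rw [hu2, onesCount, hlen1]
  set a0 := (nodeChars k s (2 * h)).length
  set a1 := (nodeChars k s (2 * h + 1)).length
  have hq0 : a0 / q ≤ l.length / q := Nat.div_le_div_right (by omega)
  have hq1 : a1 / q ≤ l.length / q := Nat.div_le_div_right (by omega)
  have hh2 : S₂.v .vh = h := by rw [hf2 _ (by decide), hf1 _ (by decide), hI.vh]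
  have hc2 := hI2.consts
  have hend : nodeEnd.Within w S₂ nodeEnd.time fun S' =>
      S'.mem = Function.update (Function.update (Function.update (Function.update S₂.mem
        (16 * n + 4 * h) bL) (16 * n + 4 * h + 1) a0) (16 * n + 4 * h + 2)
        (bL + (l.length / q + 2))) (16 * n + 4 * h + 3) a1 ∧
      S'.v .vout = o + (l.length / w + 1) ∧
      S'.v .vbp = bL + (l.length / q + 2) + (l.length / q + 2) ∧ S'.v .vh = h + 1 := by
    apply Cmd.within_of_pre
    simp [nodeEnd, Cmd.pre, hc2.vdir, hc2.vq, hc2.vw, hh2, hu2', hI2.vbp, hI2.vout, hI2.vrb,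
      hI2.vm]
    refine ⟨by omega, ⟨by omega, by omega⟩, by omega, by omega, by omega, by omega, by omega,
      by omega, ?_⟩
    rw [show l.length - a1 = a0 by omega]
  refine (hend.frame).mono le_rfl ?_
  clear hend
  rintro S₃ ⟨⟨hm3, hout3, hbp3, hh3⟩, hf3⟩
  have hfr3 : ∀ a, (a < 16 * n + 4 * h ∨ 16 * n + 4 * h + 3 < a) → S₃.mem a = S₂.mem a := by
    intro a ha
    rw [hm3, Function.update_of_ne (by omega), Function.update_of_ne (by omega),
      Function.update_of_ne (by omega), Function.update_of_ne (by omega)]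
  have e0 : S₃.mem (16 * n + 2 * (2 * h)) = bL := by
    rw [hm3, Function.update_of_ne (by omega), Function.update_of_ne (by omega),
      Function.update_of_ne (by omega), show 16 * n + 2 * (2 * h) = 16 * n + 4 * h by ring,
      Function.update_self]
  have e1 : S₃.mem (16 * n + 2 * (2 * h) + 1) = a0 := by
    rw [hm3, Function.update_of_ne (by omega), Function.update_of_ne (by omega),
      show 16 * n + 2 * (2 * h) + 1 = 16 * n + 4 * h + 1 by ring, Function.update_self]
  have e2 : S₃.mem (16 * n + 2 * (2 * h + 1)) = bL + (l.length / q + 2) := by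
    rw [hm3, Function.update_of_ne (by omega),
      show 16 * n + 2 * (2 * h + 1) = 16 * n + 4 * h + 2 by ring, Function.update_self]
  have e3 : S₃.mem (16 * n + 2 * (2 * h + 1) + 1) = a1 := by
    rw [hm3, show 16 * n + 2 * (2 * h + 1) + 1 = 16 * n + 4 * h + 3 by ring,
      Function.update_self]
  -- cells that the processing of the node leaves unchanged
  have hkeep : ∀ a, a ≠ 16 * n + 2 * h → (a < o ∨ o + (l.length / w + 2) ≤ a) →
      (a < bL ∨ bL + (l.length / q + 2) + (l.length / q + 2) ≤ a) →
      (a < 16 * n + 4 * h ∨ 16 * n + 4 * h + 3 < a) → S₃.mem a = S.mem a := by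
    intro a g1 g2 g3 g4
    rw [hfr3 a g4, hfr2 a g2 g3, hfr1 a g1 (by omega) (by omega) (by omega)]
  have ed : S₃.mem (16 * n + 2 * h) = o := by
    rw [hfr3 _ (by omega), hfr2 _ (by omega) (by omega), hd1]
  have ed1 : S₃.mem (16 * n + 2 * h + 1) = l.length := by
    rw [hkeep _ (by omega) (by omega) (by omega) (by omega), hlen]
  have hcur : ∀ h', h + 1 ≤ h' → h' < 2 ^ (d + 1) →
      S₃.mem (16 * n + 2 * h') = S.mem (16 * n + 2 * h') ∧
      S₃.mem (16 * n + 2 * h' + 1) = S.mem (16 * n + 2 * h' + 1) := fun h' g1 g2 =>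
    ⟨hkeep _ (by omega) (by omega) (by omega) (by omega),
      hkeep _ (by omega) (by omega) (by omega) (by omega)⟩
  have hnext : ∀ h', 2 ^ (d + 1) ≤ h' → h' < 2 * h →
      S₃.mem (16 * n + 2 * h') = S.mem (16 * n + 2 * h') ∧
      S₃.mem (16 * n + 2 * h' + 1) = S.mem (16 * n + 2 * h' + 1) := fun h' g1 g2 =>
    ⟨hkeep _ (by omega) (by omega) (by omega) (by omega),
      hkeep _ (by omega) (by omega) (by omega) (by omega)⟩
  have hdone : ∀ h', 1 ≤ h' → h' < h →
      S₃.mem (16 * n + 2 * h') = S.mem (16 * n + 2 * h') ∧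
      S₃.mem (16 * n + 2 * h' + 1) = S.mem (16 * n + 2 * h' + 1) := fun h' g1 g2 =>
    ⟨hkeep _ (by omega) (by omega) (by omega) (by omega),
      hkeep _ (by omega) (by omega) (by omega) (by omega)⟩
  refine ⟨hc2.of_frame hf3 (by decide), hh3, ?_, ?_, ?_, ?_, ?_, ?_, ?_, ?_, ?_⟩
  · rw [hf3 _ (by decide), hf2 _ (by decide), hf1 _ (by decide), hI.vhi]
  · rw [hbp3]; omega
  · rw [hbp3]; omega
  · rw [hout3]; omega
  · rw [hout3]; omega
  · refine ⟨fun h' g1 g2 => ?_, fun h' g1 g2 => ?_, fun h' g1 g2 => ?_, fun h' h'' g1 g2 g3 => ?_,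
      fun h' g1 g2 => ?_⟩
    · rw [(hcur h' g1 g2).2, hI.cur.len h' (by omega) g2]
    · rw [(hcur h' g1 g2).1]; exact hI.cur.lo h' (by omega) g2
    · rw [(hcur h' g1 g2).1]; exact hI.cur.hi h' (by omega) g2
    · rw [(hcur h' g1 (by omega)).1, (hcur h'' (by omega) g3).1]
      exact hI.cur.sep h' h'' (by omega) g2 g3
    · rw [(hcur h' g1 g2).1]
      have f1 := hI.cur.lo h' (by omega) g2
      have f2 := hI.cur.hi h' (by omega) g2
      refine (hI.cur.stores h' (by omega) g2).congr fun i hi => hkeep _ ?_ ?_ ?_ ?_ <;> omega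
  · have hcase : ∀ h', 2 ^ (d + 1) ≤ h' → h' < 2 * (h + 1) →
        h' < 2 * h ∨ h' = 2 * h ∨ h' = 2 * h + 1 := fun h' _ _ => by omega
    have hold : ∀ h', 2 ^ (d + 1) ≤ h' → h' < 2 * h →
        NB ≤ S₃.mem (16 * n + 2 * h') ∧
        S₃.mem (16 * n + 2 * h') + ((nodeChars k s h').length / q + 2) ≤ bL := fun h' g1 g2 => by
      rw [(hnext h' g1 g2).1]
      exact ⟨hI.next.lo h' g1 g2, hI.next.hi h' g1 g2⟩
    refine ⟨fun h' g1 g2 => ?_, fun h' g1 g2 => ?_, fun h' g1 g2 => ?_, fun h' h'' g1 g2 g3 => ?_,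
      fun h' g1 g2 => ?_⟩
    · rcases hcase h' g1 g2 with g | rfl | rfl
      · rw [(hnext h' g1 g).2, hI.next.len h' g1 g]
      · rw [e1]
      · rw [e3]
    · rcases hcase h' g1 g2 with g | rfl | rfl
      · exact (hold h' g1 g).1
      · rw [e0]; exact hbp1
      · rw [e2]; omega
    · rw [hbp3]
      rcases hcase h' g1 g2 with g | rfl | rfl
      · have := (hold h' g1 g).2; omega
      · rw [e0]; change bL + (a0 / q + 2) ≤ _; omega
      · rw [e2]; change bL + (l.length / q + 2) + (a1 / q + 2) ≤ _; omega
    · rcases hcase h' g1 (by omega) with g | rfl | rfl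
      · rcases hcase h'' (by omega) g3 with g' | rfl | rfl
        · rw [(hnext h' g1 g).1, (hnext h'' (by omega) g').1]
          exact hI.next.sep h' h'' g1 g2 g'
        · rw [e0]; exact (hold h' g1 g).2
        · rw [e2]; have := (hold h' g1 g).2; omega
      · obtain rfl : h'' = 2 * h + 1 := by omega
        rw [e0, e2]; change bL + (a0 / q + 2) ≤ _; omega
      · omega
    · rcases hcase h' g1 g2 with g | rfl | rfl
      · have f := hold h' g1 g
        rw [(hnext h' g1 g).1] at f ⊢
        have z := Nat.zero_le ((nodeChars k s h').length / q)
        refine (hI.next.stores h' g1 g).congr fun i hi => hkeep _ ?_ ?_ ?_ ?_ <;> omega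
      · rw [e0]
        exact hleft.congr fun i hi => hfr3 _ (by omega)
      · rw [e2]
        exact hright.congr fun i hi => hfr3 _ (by omega)
  · have hold : ∀ h', 1 ≤ h' → h' < h →
        96 * n ≤ S₃.mem (16 * n + 2 * h') ∧
        S₃.mem (16 * n + 2 * h') + ((nodeChars k s h').length / w + 1) ≤ o := fun h' g1 g2 => by
      rw [(hdone h' g1 g2).1]
      exact ⟨hI.done.lo h' g1 g2, hI.done.hi h' g1 g2⟩
    have hcase : ∀ h', h' < h + 1 → h' < h ∨ h' = h := fun h' _ => by omega
    refine ⟨fun h' g1 g2 => ?_, fun h' g1 g2 => ?_, fun h' g1 g2 => ?_, fun h' h'' g1 g2 g3 => ?_,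
      fun h' g1 g2 => ?_⟩
    · rcases hcase h' g2 with g | rfl
      · rw [(hdone h' g1 g).2, hI.done.len h' g1 g]
      · rw [ed1, hllen]
    · rcases hcase h' g2 with g | rfl
      · exact (hold h' g1 g).1
      · rw [ed]; exact ho1
    · rw [hout3]
      rcases hcase h' g2 with g | rfl
      · have := (hold h' g1 g).2; omega
      · rw [ed, hllen]
    · rcases hcase h'' g3 with g | rfl
      · rw [(hdone h' g1 (by omega)).1, (hdone h'' (by omega) g).1]
        exact hI.done.sep h' h'' g1 g2 g
      · rw [ed]; exact (hold h' g1 g2).2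
    · rcases hcase h' g2 with g | rfl
      · have f := hold h' g1 g
        rw [(hdone h' g1 g).1] at f ⊢
        have z := Nat.zero_le ((nodeChars k s h').length / w)
        refine (hI.done.stores h' g1 g).congr fun i hi => hkeep _ ?_ ?_ ?_ ?_ <;> omega
      · rw [ed, ← hllen]
        exact hbits.congr fun i hi => hfr3 _ (by omega)
  · intro a g1 g2
    rw [hkeep a (by omega) (by omega) (by omega) (by omega), hI.frame a g1 g2]

open Var in
/-- Process all nodes of the current level. -/
def levelLoop : Cmd := .loop vh vhi nodeCmd

/-- A bound for the time that a node takes, apart from the cells of its list. -/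
def nodeTime : ℕ := 2 * (splitBody.time + 4) + (nodeBegin.time + nodeEnd.time) + 4

theorem levelLoop_within (hp : Params w n k q τ) (hs : s.length = n) (hB : Buffers n OB NB)
    (hd : d < k) (hT : ∀ x < 2 ^ (q * τ), TableEntry m₀ (48 * n) τ x)
    (hI : LevelInv w n k q τ s d OB NB m₀ (2 ^ d) S) :
    levelLoop.Within w S ((splitBody.time + 4) * (n / q) + nodeTime * (2 ^ d + 1))
      (LevelInv w n k q τ s d OB NB m₀ (2 ^ (d + 1))) := by
  have hp2 : 2 ^ (d + 1) = 2 ^ d + 2 ^ d := by rw [pow_succ]; ring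
  rw [hp2]
  refine within_loop (2 ^ d) (fun j => LevelInv w n k q τ s d OB NB m₀ (2 ^ d + j))
    (fun j => (splitBody.time + 4) * ((nodeChars k s (2 ^ d + j)).length / q + 2) +
        (nodeBegin.time + nodeEnd.time))
    (fun j => (splitBody.time + 4) * (before k s d (2 ^ d + j) / q) + nodeTime * j) hI
    (fun _ _ _ => by simp) ?_ ?_ ?_ ?_
  · intro j hj S hI
    refine ⟨?_, nodeCmd_within hp hs hB hd (by omega) (by omega) hT hI⟩
    simp [hI.vh, hI.vhi]; omega
  · intro S hI
    simp [hI.vh, hI.vhi, hp2]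
  · intro j hj
    have h1 : before k s d (2 ^ d + j) / q + (nodeChars k s (2 ^ d + j)).length / q ≤
        before k s d (2 ^ d + (j + 1)) / q := by
      rw [← Nat.add_assoc, before_succ, nodeChars_eq (d := d) (by omega) (by omega)]
      exact Nat.div_add_div_le_add_div
    have h2 := Nat.mul_le_mul_left (splitBody.time + 4) h1
    simp only [Expr.cost, nodeTime]
    generalize splitBody.time + 4 = A at *
    generalize nodeBegin.time + nodeEnd.time = B at *
    rw [Nat.mul_add] at h2
    linarith
  · have h1 : before k s d (2 ^ d + 2 ^ d) / q ≤ n / q :=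
      Nat.div_le_div_right (hs ▸ before_le _ _ _ _)
    have h2 := Nat.mul_le_mul_left (splitBody.time + 4) h1
    simp only [Expr.cost, nodeTime]
    generalize splitBody.time + 4 = A at *
    generalize nodeBegin.time + nodeEnd.time = B at *
    have h3 : 4 ≤ 2 * A + B + 4 := by omega
    generalize 2 * A + B + 4 = C at *
    rw [Nat.mul_add, mul_one, mul_zero]
    have h4 := Nat.zero_le (A * (before k s d (2 ^ d + 0) / q))
    linarith

end WaveletRAM

/-! ### Filling the lists at the first level of a block -/

namespace WaveletRAM

open WordRAM

open Var in
/-- The word that starts at bit `vpb` of the cell `vpw`. -/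
def readExpr : Expr :=
  Expr.ld vpw >>> (vpb : Expr) + Expr.ld (vpw + 1) <<< (vw - vpb : Expr)

open Var in
/-- Advance the reading position, of which `vpb` is already increased, to a valid one. -/
def normalize : Cmd := .ite vpb vw .skip (.set vpb (vpb - vw) ;; .set vpw (vpw + 1))

open Var in
/-- Add the next character of the input to the list of its node, which has the number `vg`; the
cell `vptr + vg` counts the characters added to it so far. -/
def fillBody : Cmd :=
  (.set vc (readExpr % vpk) ;; .set vpb (vpb + vk) ;; normalize) ;;
  (.set vg ((vc : Expr) >>> (vkd : Expr) + vlo) ;;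
  .set vr (.ld (vptr + vg)) ;; .store (vptr + vg) (vr + 1) ;;
  .set vy (.ld (vdir + 2 * vg) + vr / vq) ;;
  .store vy (.ld vy +
    (((vc : Expr) >>> (vsa : Expr)) <<< (vsb : Expr) % vpT) <<< (vr % vq * vtau : Expr)) ;;
  .set vi (vi + 1))

open Var in
/-- Prepare the distribution: compute the shifts that turn a character into a short character. -/
def fillBegin : Cmd :=
  .set vkd (vk - vd) ;;
  .ite vkd vtau (.set vsa 0 ;; .set vsb (vtau - vkd)) (.set vsa (vkd - vtau) ;; .set vsb 0) ;;
  .set vpw 0 ;; .set vpb 0 ;; .set vi 0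

open Var in
/-- Distribute the characters of the input to the lists of the nodes of depth `vd`. -/
def fillLong : Cmd := fillBegin ;; .loop vi vn fillBody

open Var in
/-- Copy `vq` characters of the input to one cell of the list of the root. -/
def copyBody : Cmd :=
  .store vp (readExpr % vpL) ;; .set vpb (vpb + vL) ;; normalize ;;
  .set vp (vp + 1) ;; .set vi (vi + vq)

open Var in
/-- Copy the input to the list of the root. -/
def fillShort : Cmd :=
  (.set vpw 0 ;; .set vpb 0 ;; .set vi 0 ;; .set vp vob) ;;
  .loop vi (vn + 1) copyBody

open Var in
/-- Fill the lists of the nodes of depth `vd`.  Only if all bits of a character fit into a short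
character, the input is copied several characters at a time. -/
def fillCmd : Cmd := .ite vq vk fillLong fillShort

/-- A bound, up to a constant factor, for the running time of `fillCmd`. -/
def fillCount (n k q : ℕ) : ℕ := if q < k then n else n / q + 1

variable {w n k q τ : ℕ} {s : List ℕ} {d OB NB h : ℕ} {m₀ : ℕ → ℕ} {S : State}

/-- The situation before the lists of depth `d` are filled. -/
structure FillPre (w n k q τ : ℕ) (s : List ℕ) (d OB : ℕ) (m₀ : ℕ → ℕ) : Prop where
  d_lt : d < k
  mod : d % τ = 0
  length : s.length = n
  lt : ∀ c ∈ s, c < 2 ^ k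
  buffer : OB = 64 * n ∨ OB = 80 * n
  input : ∀ a < 16 * n, m₀ a = Nat.ofDigits (2 ^ k) s / 2 ^ (w * a) % 2 ^ w
  ptr : ∀ h, 2 ^ d ≤ h → h < 16 * n → m₀ (32 * n + h) = 0
  lists : Lists n k q τ s (initialChar k τ d) m₀ OB (OB + 16 * n) (2 ^ d) (2 ^ (d + 1))
  root : d = 0 → m₀ (16 * n + 2) = OB

/-- The situation after the lists of depth `d` are filled. -/
structure FillPost (w n k q τ : ℕ) (s : List ℕ) (d OB : ℕ) (m₀ m : ℕ → ℕ) : Prop where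
  ptr : ∀ h, 2 ^ (d + 1) ≤ h → h < 16 * n → m (32 * n + h) = 0
  lists : Lists n k q τ s (shortChar k τ d) m OB (OB + 16 * n) (2 ^ d) (2 ^ (d + 1))
  frame : ∀ a, (a < 32 * n ∨ 48 * n ≤ a) → (a < OB ∨ OB + 16 * n ≤ a) → m a = m₀ a

theorem read_val (hk : ∀ a < 16 * n, S.mem a = Nat.ofDigits (2 ^ k) s / 2 ^ (w * a) % 2 ^ w)
    (hw : S.v .vw = w) {p b pos r : ℕ} (hpw : S.v .vpw = p) (hpb : S.v .vpb = b)
    (hb : b < w) (hpos : p * w + b = pos) (hp : p + 1 < 16 * n) (hr : r ≤ w) :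
    readExpr.val w S % 2 ^ r = Nat.ofDigits (2 ^ k) s / 2 ^ pos % 2 ^ r := by
  simp only [readExpr, Expr.val_add, Expr.val_shr, Expr.val_shl, Expr.val_ld, Expr.val_var,
    Expr.val_sub, Expr.val_lit, hw, hpw, hpb]
  rw [hk p (by omega), hk (p + 1) hp, read_bits hb hr, ← hpos, mul_comm p w]

theorem read_ok (hk : ∀ a < 16 * n, S.mem a = Nat.ofDigits (2 ^ k) s / 2 ^ (w * a) % 2 ^ w)
    (hw : S.v .vw = w) {p b : ℕ} (hpw : S.v .vpw = p) (hpb : S.v .vpb = b)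
    (hb : b < w) (hp : p + 1 < 16 * n) (hn : 16 * n ≤ 2 ^ w) : readExpr.Ok w S := by
  simp only [readExpr, Expr.ok_add, Expr.ok_shr, Expr.ok_shl, Expr.ok_ld, Expr.ok_var,
    Expr.ok_sub, Expr.ok_lit, Expr.val_shr, Expr.val_shl, Expr.val_ld, Expr.val_var,
    Expr.val_add, Expr.val_sub, Expr.val_lit, hw, hpw, hpb, true_and, and_true]
  refine ⟨by and_intros <;> omega, ?_⟩
  apply read_bits_lt hb
  rw [hk p (by omega)]
  exact Nat.mod_lt _ (by positivity)

/-- At the first level of a block, a character becomes short by shifting it right, or left if it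
has less than `τ` bits left. -/
theorem shortChar_eq_shift (hd : d % τ = 0) (c : ℕ) :
    c / 2 ^ (k - d - τ) * 2 ^ (τ - (k - d)) % 2 ^ τ = shortChar k τ d c := by
  have h : τ * (d / τ) = d := by have := Nat.div_add_mod d τ; omega
  rw [shortChar, hd, h, pow_zero, mul_one]
  rcases Nat.le_total τ (k - d) with h' | h'
  · rw [Nat.sub_eq_zero_of_le h', pow_zero, mul_one]
    have : 2 ^ (k - d) = 2 ^ (k - d - τ) * 2 ^ τ := by rw [← pow_add]; congr 1; omega
    rw [this, Nat.mul_div_mul_right _ _ (by positivity)]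
  · rw [Nat.sub_eq_zero_of_le h', pow_zero, Nat.div_one]
    have : 2 ^ τ = 2 ^ (τ - (k - d)) * 2 ^ (k - d) := by rw [← pow_add]; congr 1; omega
    conv_rhs => rw [this, ← mul_assoc, Nat.mul_div_cancel _ (by positivity)]
    rw [this]

/-- The invariant of the loop in `fillLong`: the first `j` characters have been distributed. -/
structure FillInv (w n k q τ : ℕ) (s : List ℕ) (d OB : ℕ) (m₀ : ℕ → ℕ) (j : ℕ)
    (S : State) : Prop where
  consts : Consts w n k q τ S
  vlo : S.v .vlo = 2 ^ d
  vkd : S.v .vkd = k - d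
  vsa : S.v .vsa = k - d - τ
  vsb : S.v .vsb = τ - (k - d)
  vi : S.v .vi = j
  pos : S.v .vpw * w + S.v .vpb = j * k
  vpb : S.v .vpb < w
  ptr : ∀ h, 2 ^ d ≤ h → h < 2 ^ (d + 1) →
    S.mem (32 * n + h) = (nodeChars k (s.take j) h).length
  lists : ∀ h, 2 ^ d ≤ h → h < 2 ^ (d + 1) → Stores S.mem (m₀ (16 * n + 2 * h)) (q * τ)
    (Nat.ofDigits (2 ^ τ) ((nodeChars k (s.take j) h).map (shortChar k τ d)))
    ((nodeChars k s h).length / q)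
  frame : ∀ a, (a < 32 * n + 2 ^ d ∨ 32 * n + 2 ^ (d + 1) ≤ a) →
    (a < OB ∨ OB + 16 * n ≤ a) → S.mem a = m₀ a

theorem normalize_pre {Q : State → Prop} (hw : S.v .vw = w) {b p : ℕ} (hpb : S.v .vpb = b)
    (hpw : S.v .vpw = p) (hp : p + 1 < 2 ^ w)
    (h : ∀ S', S'.mem = S.mem → (∀ x, x ≠ .vpb → x ≠ .vpw → S'.v x = S.v x) →
      S'.v .vpw * w + S'.v .vpb = p * w + b → (b < w + w → S'.v .vpb < w) → Q S') :
    normalize.pre w Q S := by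
  have h0 : w ≠ 0 := by rintro rfl; simp at hp
  simp only [normalize, Cmd.pre, Expr.ok_var, Expr.val_var, hw, hpb, true_and, hpw,
    Expr.ok_sub, Expr.val_sub, Expr.ok_add, Expr.val_add, Expr.ok_lit, Expr.val_lit,
    State.v_set]
  refine ⟨fun hlt => h S rfl (fun _ _ _ => rfl) (by rw [hpb, hpw]) fun _ => by rw [hpb]; exact hlt,
    fun hle => ⟨by simpa using hle, by simp; omega, ?_⟩⟩
  apply h
  · simp
  · intro x h1 h2
    simp [h1, h2]
  · simp only [State.v_set, reduceCtorEq, if_false, if_true, hpb, hpw]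
    rw [Nat.succ_mul]; omega
  · intro hb
    simp only [State.v_set, reduceCtorEq, if_false, if_true, hpb]
    omega

set_option maxHeartbeats 1000000 in
theorem fillBody_within (hp : Params w n k q τ) (hF : FillPre w n k q τ s d OB m₀) {j : ℕ}
    (hj : j < n) (hI : FillInv w n k q τ s d OB m₀ j S) :
    fillBody.Within w S fillBody.time (FillInv w n k q τ s d OB m₀ (j + 1)) := by
  have hroom := hp.room
  have hn := hp.two_le
  have hq := hp.q_pos
  have hkw := hp.k_le
  have hc := hI.consts
  have htw := hp.two_w
  have hd := hF.d_lt
  have hlen := hF.length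
  have hbuf := hF.buffer
  have hw : 0 < w := by have := hp.k_pos; omega
  have hpk : 2 * 2 ^ d ≤ 2 ^ k := by
    rw [← pow_succ']; exact Nat.pow_le_pow_right (by norm_num) hd
  have hpk2 := hp.pow_k
  have hp2 : 2 ^ (d + 1) = 2 * 2 ^ d := pow_succ' ..
  have h1' : 1 ≤ 2 ^ d := Nat.one_le_two_pow
  have hpos := hI.pos
  have hpb := hI.vpb
  set p := S.v .vpw with hpw
  have hpn : p ≤ n := by
    have h1 : j * k ≤ n * w := Nat.mul_le_mul hj.le hkw
    exact Nat.le_of_mul_le_mul_right (by omega) hw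
  have hin : ∀ a < 16 * n, S.mem a = Nat.ofDigits (2 ^ k) s / 2 ^ (w * a) % 2 ^ w := by
    intro a ha
    rw [hI.frame a (by omega) (by omega), hF.input a ha]
  -- the character read
  set c := s[j]'(by omega) with hcdef
  have hclt : c < 2 ^ k := hF.lt c (List.getElem_mem _)
  have hread : readExpr.val w S % 2 ^ k = c := by
    rw [read_val hin hc.vw rfl rfl hpb hpos (by omega) hkw, mul_comm j k, pow_mul]
    have := ofDigits_div_mod hF.lt j 1
    rw [pow_one, List.drop_eq_getElem_cons (by omega), List.take_succ_cons] at this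
    rw [this]; simp [hcdef]
  have hok := read_ok hin hc.vw rfl rfl hpb (by omega : p + 1 < 16 * n) (by omega)
  unfold fillBody
  refine within_seq_of (P := fun S' => S'.mem = S.mem ∧ S'.v .vc = c ∧
    S'.v .vpw * w + S'.v .vpb = (j + 1) * k ∧ S'.v .vpb < w) (Cmd.within_of_pre ?_) ?_ le_rfl
  · simp only [Cmd.pre, Expr.ok_mod, Expr.val_mod, Expr.ok_var, Expr.val_var, hc.vpk, hok, hread,
      Expr.ok_add, Expr.val_add, State.v_set, reduceCtorEq, if_false, hc.vk, true_and]
    refine ⟨by omega, normalize_pre (p := p) (b := S.v .vpb + k) (by simp [hc.vw]) (by simp)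
      (by simp [hpw]) (by omega) ?_⟩
    intro S' g1 g2 g3 g4
    refine ⟨by simpa using g1, ?_, ?_, g4 (by omega)⟩
    · rw [g2 _ (by simp) (by simp)]; simp
    · rw [g3, Nat.succ_mul]; omega
  rintro S₁ ⟨hm1, hc1, hpos1, hpb1⟩ hf1
  -- its node
  set g := c / 2 ^ (k - d) + 2 ^ d with hg
  have hg1 : 2 ^ d ≤ g := Nat.le_add_left _ _
  have hg2 : g < 2 ^ (d + 1) := by
    have : c / 2 ^ (k - d) < 2 ^ d := by
      rw [Nat.div_lt_iff_lt_mul (by positivity), ← pow_add]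
      rwa [show d + (k - d) = k by omega]
    omega
  have htake : s.take (j + 1) = s.take j ++ [c] := by
    rw [hcdef, List.take_succ_eq_append_getElem]
  have hcg : nodeChars k (s.take (j + 1)) g = nodeChars k (s.take j) g ++ [c] := by
    rw [nodeChars_eq hg1 hg2, nodeChars_eq hg1 hg2, htake, nodeList, List.filter_append]
    simp [nodeList, hg]
  have hcne : ∀ h, 2 ^ d ≤ h → h < 2 ^ (d + 1) → h ≠ g →
      nodeChars k (s.take (j + 1)) h = nodeChars k (s.take j) h := by
    intro h e1 e2 e3
    rw [nodeChars_eq e1 e2, nodeChars_eq e1 e2, htake, nodeList, List.filter_append]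
    have : ¬ (c / 2 ^ (k - d) + 2 ^ d = h) := fun h' => e3 (by rw [hg, h'])
    simp [nodeList, this]
  -- its position in the list of the node
  set r := (nodeChars k (s.take j) g).length with hr
  have hrlt : r + 1 ≤ (nodeChars k s g).length := by
    have e1 : (nodeChars k (s.take (j + 1)) g).length = r + 1 := by rw [hcg]; simp [hr]
    rw [← e1, nodeChars_eq hg1 hg2, nodeChars_eq hg1 hg2]
    exact ((List.take_sublist _ _).filter _).length_le
  have hrq : r / q ≤ (nodeChars k s g).length / q := Nat.div_le_div_right (by omega)
  have hrn : r + 1 ≤ n := by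
    refine hrlt.trans ?_
    rw [← hlen, nodeChars_eq hg1 hg2]
    exact List.length_filter_le _ _
  have z := Nat.zero_le (r / q)
  set A := m₀ (16 * n + 2 * g) with hA
  have hAlo := hF.lists.lo g hg1 hg2
  have hAhi := hF.lists.hi g hg1 hg2
  rw [← hA] at hAlo hAhi
  set v := shortChar k τ d c with hv
  have hsg := hI.lists g hg1 hg2
  rw [← hA] at hsg
  have hX : Nat.ofDigits (2 ^ τ) ((nodeChars k (s.take j) g).map (shortChar k τ d)) <
      2 ^ (τ * r) := by
    have := ofDigits_lt_two_pow (U := τ)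
      (l := (nodeChars k (s.take j) g).map (shortChar k τ d)) (by
        intro c hc
        simp only [List.mem_map] at hc
        obtain ⟨c', _, rfl⟩ := hc
        exact shortChar_lt _ _ _ _)
    rwa [List.length_map] at this
  obtain ⟨hl1, hl2⟩ := hsg.add_item_lt hq hX (shortChar_lt k τ d c) hrq
  rw [← hv] at hl1 hl2
  have hLw := Nat.pow_lt_pow_right (a := 2) (by norm_num) hp.L_lt
  have hmodT : ∀ x, x % 2 ^ w % 2 ^ τ = x % 2 ^ τ := fun x =>
    Nat.mod_mod_of_dvd _ (pow_dvd_pow _ hp.tau_lt.le)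
  have hshift : c / 2 ^ (k - d - τ) * 2 ^ (τ - (k - d)) % 2 ^ τ = v := shortChar_eq_shift hF.mod c
  have hptr := hI.ptr g hg1 hg2
  have hdirg : S.mem (16 * n + 2 * g) = A := hI.frame _ (by omega) (by omega)
  have hc1' := hc.of_frame hf1 (by decide)
  have hlo1 : S₁.v .vlo = 2 ^ d := by rw [hf1 _ (by decide), hI.vlo]
  have hkd1 : S₁.v .vkd = k - d := by rw [hf1 _ (by decide), hI.vkd]
  have hsa1 : S₁.v .vsa = k - d - τ := by rw [hf1 _ (by decide), hI.vsa]
  have hsb1 : S₁.v .vsb = τ - (k - d) := by rw [hf1 _ (by decide), hI.vsb]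
  have hi1 : S₁.v .vi = j := by rw [hf1 _ (by decide), hI.vi]
  have hne1 : 16 * n + 2 * g ≠ 32 * n + g := by omega
  have hne2 : A + r / q ≠ 32 * n + g := by omega
  refine ((Cmd.within_of_pre (Q := fun S' => S'.mem = Function.update (Function.update S.mem
    (32 * n + g) (r + 1)) (A + r / q) (S.mem (A + r / q) + v * 2 ^ (r % q * τ)) ∧
    S'.v .vi = j + 1) ?_).frame).mono le_rfl ?_
  · simp [Cmd.pre, hc1, hkd1, hlo1, ← hg, hc1'.vptr, hc1'.vdir, hc1'.vq, hc1'.vpT, hc1'.vtau,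
      hm1, hptr, ← hr, hsa1, hsb1, hi1, hmodT, hshift, Function.update_of_ne hne1, hdirg,
      Function.update_of_ne hne2, Nat.mod_eq_of_lt (hl1.trans hLw)]
    have hrT : r % q * τ < 2 ^ w := by
      have e1 := Nat.mul_le_mul_right τ (Nat.mod_lt r hq).le
      have e2 := hp.L_lt
      omega
    and_intros <;> omega
  · rintro S₂ ⟨⟨hm2, hi2⟩, hf2⟩
    have hf : ∀ x ∉ fillBody.writes, S₂.v x = S.v x := by
      intro x hx
      have hx' := hx
      unfold fillBody at hx'
      rw [Cmd.writes, List.mem_append, not_or] at hx'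
      rw [hf2 x hx'.2, hf1 x hx'.1]
    have hother : ∀ a, a ≠ 32 * n + g → a ≠ A + r / q → S₂.mem a = S.mem a := by
      intro a e1 e2
      rw [hm2, Function.update_of_ne e2, Function.update_of_ne e1]
    have hptr2 : S₂.mem (32 * n + g) = r + 1 := by
      rw [hm2, Function.update_of_ne hne2.symm, Function.update_self]
    refine ⟨hc.of_frame hf (by decide), ?_, ?_, ?_, ?_, hi2, ?_, ?_, ?_, ?_, ?_⟩
    · rw [hf _ (by decide), hI.vlo]
    · rw [hf _ (by decide), hI.vkd]
    · rw [hf _ (by decide), hI.vsa]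
    · rw [hf _ (by decide), hI.vsb]
    · rw [hf2 _ (by decide), hf2 _ (by decide), hpos1]
    · rw [hf2 _ (by decide)]; exact hpb1
    · intro h e1 e2
      by_cases e3 : h = g
      · rw [e3, hptr2, hcg]; simp [hr]
      · rw [hcne h e1 e2 e3, hother _ (by omega) (by omega), hI.ptr h e1 e2]
    · intro h e1 e2
      by_cases e3 : h = g
      · rw [e3, hcg, List.map_append, Nat.ofDigits_append, List.length_map, ← pow_mul, ← hr,
          ← hA, List.map_singleton, Nat.ofDigits_singleton]
        refine hsg.add_item hq hX (shortChar_lt k τ d c) ?_ ?_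
        · rw [hm2, Function.update_self]
        · intro i hi
          have zi := hAlo
          by_cases e : A + i = 32 * n + g
          · omega
          · exact hother _ e (by omega)
      · rw [hcne h e1 e2 e3]
        refine (hI.lists h e1 e2).congr fun i hi => hother _ ?_ ?_
        · have := hF.lists.lo h e1 e2; omega
        · have zh := Nat.zero_le ((nodeChars k s h).length / q)
          rcases Nat.lt_or_gt_of_ne e3 with e4 | e4
          · have := hF.lists.sep h g e1 e4 hg2
            rw [← hA] at this; omega
          · have := hF.lists.sep g h hg1 e4 e2
            rw [← hA] at this; omega
    · intro a e1 e2
      rw [hother a (by omega) (by omega), hI.frame a e1 e2]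

theorem fillLong_within (hp : Params w n k q τ) (hF : FillPre w n k q τ s d OB m₀)
    (hc : Consts w n k q τ S) (hm : S.mem = m₀) (hd : S.v .vd = d) (hlo : S.v .vlo = 2 ^ d) :
    fillLong.Within w S ((fillBody.time + fillBegin.time + 8) * n)
      fun S' => FillPost w n k q τ s d OB m₀ S'.mem := by
  have hn := hp.two_le
  have hdk := hF.d_lt
  have hlen := hF.length
  have hbuf := hF.buffer
  have hw : 0 < w := by have := hp.k_pos; have := hp.k_le; omega
  have hroom := hp.room
  have hpk : 2 * 2 ^ d ≤ 2 ^ k := by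
    rw [← pow_succ']; exact Nat.pow_le_pow_right (by norm_num) hdk
  have hpk2 := hp.pow_k
  have hp2 : 2 ^ (d + 1) = 2 * 2 ^ d := pow_succ' ..
  unfold fillLong
  refine within_seq_of (t₂ := (fillBody.time + 4) * n + 4) (P := fun S' => S'.mem = m₀ ∧
    S'.v .vkd = k - d ∧ S'.v .vsa = k - d - τ ∧ S'.v .vsb = τ - (k - d) ∧
    S'.v .vpw = 0 ∧ S'.v .vpb = 0 ∧ S'.v .vi = 0) (Cmd.within_of_pre ?_) ?_ ?_
  · simp [fillBegin, Cmd.pre, hc.vk, hc.vtau, hd, hm]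
    refine ⟨by omega, fun h => by omega, fun h => by omega⟩
  · rintro S₁ ⟨hm1, hkd1, hsa1, hsb1, hpw1, hpb1, hi1⟩ hf1
    refine (within_loop n (FillInv w n k q τ s d OB m₀) (fun _ => fillBody.time)
      (fun j => (fillBody.time + 4) * j) ?_ (fun _ _ _ => by simp) ?_ ?_ ?_ ?_).mono le_rfl ?_
    · refine ⟨hc.of_frame hf1 (by decide), ?_, hkd1, hsa1, hsb1, hi1, ?_, ?_, ?_, ?_, ?_⟩
      · rw [hf1 _ (by decide), hlo]
      · simp [hpw1, hpb1]
      · rw [hpb1]; exact hw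
      · intro h e1 e2
        rw [hm1, hF.ptr h e1 (by omega)]
        simp [nodeChars, nodeList]
      · intro h e1 e2
        have := hF.lists.stores h e1 e2
        rw [ofDigits_of_forall_eq_zero] at this
        · rw [hm1]
          simpa [nodeChars, nodeList] using this
        · intro c hc
          simp only [List.mem_map, initialChar, hF.mod, if_true] at hc
          obtain ⟨_, _, rfl⟩ := hc
          rfl
      · intro a _ _; rw [hm1]
    · intro j hj S hI
      refine ⟨by simpa [hI.vi, hI.consts.vn] using hj, fillBody_within hp hF hj hI⟩
    · intro S hI
      simp [hI.vi, hI.consts.vn]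
    · intro j _
      exact (Nat.mul_succ ..).ge
    · simp [Expr.cost]
    · intro S₂ hI
      have hdir : ∀ h, 2 ^ d ≤ h → h < 2 ^ (d + 1) →
          S₂.mem (16 * n + 2 * h) = m₀ (16 * n + 2 * h) ∧
          S₂.mem (16 * n + 2 * h + 1) = m₀ (16 * n + 2 * h + 1) := fun h e1 e2 =>
        ⟨hI.frame _ (by omega) (by omega), hI.frame _ (by omega) (by omega)⟩
      have htake : s.take n = s := List.take_of_length_le (by omega)
      refine ⟨?_, ⟨?_, ?_, ?_, ?_, ?_⟩, ?_⟩
      · intro h e1 e2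
        rw [hI.frame _ (by omega) (by omega), hF.ptr h (by omega) e2]
      · intro h e1 e2
        rw [(hdir h e1 e2).2]; exact hF.lists.len h e1 e2
      · intro h e1 e2
        rw [(hdir h e1 e2).1]; exact hF.lists.lo h e1 e2
      · intro h e1 e2
        rw [(hdir h e1 e2).1]; exact hF.lists.hi h e1 e2
      · intro h h' e1 e2 e3
        rw [(hdir h e1 (by omega)).1, (hdir h' (by omega) e3).1]
        exact hF.lists.sep h h' e1 e2 e3
      · intro h e1 e2
        rw [(hdir h e1 e2).1]
        have := hI.lists h e1 e2
        rwa [htake] at this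
      · intro a e1 e2
        exact hI.frame a (by omega) e2
  · have e1 := Nat.le_mul_of_pos_right fillBegin.time (show 0 < n by omega)
    generalize fillBegin.time = T at *
    generalize fillBody.time = B at *
    simp only [Nat.add_mul]
    omega

/-- The invariant of the loop in `fillShort`: the first `j` cells of the list of the root are
filled. -/
structure CopyInv (w n k q τ : ℕ) (s : List ℕ) (OB : ℕ) (m₀ : ℕ → ℕ) (j : ℕ)
    (S : State) : Prop where
  consts : Consts w n k q τ S
  vp : S.v .vp = OB + j
  vi : S.v .vi = j * q
  pos : S.v .vpw * w + S.v .vpb = j * (q * τ)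
  vpb : S.v .vpb < w
  cells : ∀ i < j, S.mem (OB + i) = Nat.ofDigits (2 ^ k) s / 2 ^ (q * τ * i) % 2 ^ (q * τ)
  frame : ∀ a, (a < OB ∨ OB + (n / q + 1) ≤ a) → S.mem a = m₀ a

theorem copyBody_within (hp : Params w n k q τ) (hF : FillPre w n k q τ s d OB m₀) {j : ℕ}
    (hj : j * q ≤ n) (hI : CopyInv w n k q τ s OB m₀ j S) :
    copyBody.Within w S copyBody.time (CopyInv w n k q τ s OB m₀ (j + 1)) := by
  have hroom := hp.room
  have hn := hp.two_le
  have hq := hp.q_pos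
  have hLw := hp.L_lt
  have htw := hp.two_w
  have hc := hI.consts
  have hbuf := hF.buffer
  have hw : 0 < w := by omega
  have hpos := hI.pos
  have hpb := hI.vpb
  set p := S.v .vpw with hpw
  have hpn : p ≤ n := by
    have h1 : j * (q * τ) ≤ n * w := by
      rw [← mul_assoc]; exact Nat.mul_le_mul hj hp.tau_lt.le
    exact Nat.le_of_mul_le_mul_right (by omega) hw
  have hjq : j ≤ n / q := (Nat.le_div_iff_mul_le hq).mpr hj
  have hnq := Nat.div_le_self n q
  have hqn : q ≤ n := by
    have h1 := hp.pow_L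
    have h2 := Nat.lt_two_pow_self (n := q * τ)
    have h3 := Nat.le_mul_of_pos_right q hp.tau_pos
    omega
  have hin : ∀ a < 16 * n, S.mem a = Nat.ofDigits (2 ^ k) s / 2 ^ (w * a) % 2 ^ w := by
    intro a ha
    rw [hI.frame a (by omega), hF.input a ha]
  have hread : readExpr.val w S % 2 ^ (q * τ) =
      Nat.ofDigits (2 ^ k) s / 2 ^ (q * τ * j) % 2 ^ (q * τ) := by
    rw [read_val hin hc.vw rfl rfl hpb hpos (by omega) hLw.le, mul_comm j]
  have hok := read_ok hin hc.vw rfl rfl hpb (by omega : p + 1 < 16 * n) (by omega)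
  have hs : (j + 1) * q = j * q + q := Nat.succ_mul ..
  unfold copyBody
  refine ((Cmd.within_of_pre (Q := fun S' => S'.mem = Function.update S.mem (OB + j)
      (Nat.ofDigits (2 ^ k) s / 2 ^ (q * τ * j) % 2 ^ (q * τ)) ∧ S'.v .vp = OB + (j + 1) ∧
      S'.v .vi = (j + 1) * q ∧ S'.v .vpw * w + S'.v .vpb = (j + 1) * (q * τ) ∧
      S'.v .vpb < w) ?_).frame).mono le_rfl ?_
  · simp only [Cmd.pre, Expr.ok_mod, Expr.val_mod, Expr.ok_var, Expr.val_var, hc.vpL, hok, hread,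
      Expr.ok_add, Expr.val_add, State.v_set, State.v_put, hc.vL, true_and, hI.vp, and_true]
    refine ⟨by omega, normalize_pre (p := p) (b := S.v .vpb + q * τ) (by simp [hc.vw]) (by simp)
      (by simp [hpw]) (by omega) ?_⟩
    intro S' g1 g2 g3 g4
    have e1 : S'.v .vp = OB + j := by rw [g2 _ (by simp) (by simp)]; simp [hI.vp]
    have e2 : S'.v .vi = j * q := by rw [g2 _ (by simp) (by simp)]; simp [hI.vi]
    have e3 : S'.v .vq = q := by rw [g2 _ (by simp) (by simp)]; simp [hc.vq]
    simp only [Expr.ok_lit, Expr.val_lit, reduceCtorEq, if_false, if_true, e1, e2, e3, g1, g3,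
      State.mem_set, State.mem_put, hs]
    refine ⟨by and_intros <;> omega, by omega, trivial, by omega, trivial, ?_, g4 (by omega)⟩
    rw [Nat.succ_mul j (q * τ)]; omega
  rintro S₂ ⟨⟨hm2, hp2, hi2, hpos2, hpb2⟩, hf⟩
  refine ⟨hc.of_frame hf (by decide), hp2, hi2, hpos2, hpb2, ?_, ?_⟩
  · intro i hi
    rw [hm2]
    by_cases e : i = j
    · rw [e, Function.update_self]
    · rw [Function.update_of_ne (by omega), hI.cells i (by omega)]
  · intro a ha
    rw [hm2, Function.update_of_ne (by omega), hI.frame a ha]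

theorem fillShort_within (hp : Params w n k q τ) (hF : FillPre w n k q τ s d OB m₀)
    (hkq : k ≤ q) (hc : Consts w n k q τ S) (hm : S.mem = m₀) (hob : S.v .vob = OB) :
    fillShort.Within w S ((copyBody.time + 20) * (n / q + 1))
      fun S' => FillPost w n k q τ s d OB m₀ S'.mem := by
  have hn := hp.two_le
  have hdk := hF.d_lt
  have hlen := hF.length
  have hbuf := hF.buffer
  have hq := hp.q_pos
  have hw : 0 < w := by have := hp.k_pos; have := hp.k_le; omega
  have hroom := hp.room
  have hτk := hp.long hkq
  have hd0 : d = 0 := by have := hF.mod; rwa [hτk, Nat.mod_eq_of_lt hdk] at this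
  subst hd0
  have hnq := Nat.div_le_self n q
  unfold fillShort
  refine within_seq_of (t₂ := (copyBody.time + 6) * (n / q + 1) + 6) (P := fun S' =>
    S'.mem = m₀ ∧ S'.v .vpw = 0 ∧ S'.v .vpb = 0 ∧ S'.v .vi = 0 ∧ S'.v .vp = OB)
    (Cmd.within_of_pre ?_) ?_ ?_
  · simp [Cmd.pre, hm, hob]
  · rintro S₁ ⟨hm1, hpw1, hpb1, hi1, hp1⟩ hf1
    refine (within_loop (n / q + 1) (CopyInv w n k q τ s OB m₀) (fun _ => copyBody.time)
      (fun j => (copyBody.time + 6) * j) ?_ (fun _ S hI => ?_) ?_ ?_ ?_ ?_).mono le_rfl ?_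
    · refine ⟨hc.of_frame hf1 (by decide), hp1, by omega, ?_, ?_, ?_, ?_⟩
      · simp [hpw1, hpb1]
      · rw [hpb1]; exact hw
      · intro i hi; omega
      · intro a _; rw [hm1]
    · simp [hI.consts.vn]; omega
    · intro j hj S hI
      have h1 : j * q ≤ n := (Nat.le_div_iff_mul_le hq).mp (by omega)
      refine ⟨?_, copyBody_within hp hF h1 hI⟩
      simp [hI.vi, hI.consts.vn]; omega
    · intro S hI
      simp [hI.vi, hI.consts.vn]
      have := (Nat.div_lt_iff_lt_mul hq).mp (Nat.lt_succ_self (n / q))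
      omega
    · intro j _
      exact (Nat.mul_succ ..).ge
    · change _ + 1 + 3 + 2 ≤ _
      omega
    · intro S₂ hI
      have hone : nodeChars k s 1 = s := by
        rw [nodeChars_eq (d := 0) (by norm_num) (by norm_num)]
        apply List.filter_eq_self.mpr
        intro c hc
        have := hF.lt c hc
        simp [this]
      have hpk2 := hp.pow_k
      have hL := hF.lists
      refine ⟨?_, ⟨?_, ?_, ?_, ?_, ?_⟩, ?_⟩
      · intro h e1 e2
        rw [hI.frame _ (by omega), hF.ptr h (by simp at e1 ⊢; omega) e2]
      · intro h e1 e2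
        rw [hI.frame _ (by simp at e1 e2; omega)]; exact hL.len h e1 e2
      · intro h e1 e2
        rw [hI.frame _ (by simp at e1 e2; omega)]; exact hL.lo h e1 e2
      · intro h e1 e2
        rw [hI.frame _ (by simp at e1 e2; omega)]; exact hL.hi h e1 e2
      · intro h h' e1 e2 e3
        simp at e1 e3; omega
      · intro h e1 e2
        obtain rfl : h = 1 := by simp at e1 e2; omega
        rw [hI.frame _ (by omega), hF.root rfl, hone]
        have : s.map (shortChar k τ 0) = s := by
          conv_rhs => rw [← List.map_id s]
          apply List.map_congr_left
          intro c hc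
          have h1 := hF.lt c hc
          rw [hτk]
          simp [shortChar, Nat.mod_eq_of_lt h1]
        rw [this]
        intro i hi
        rw [hI.cells i (by rw [hlen] at hi; omega), hτk]
      · intro a e1 e2
        exact hI.frame a (by omega)
  · have e1 : (Cmd.time (.set .vpw 0 ;; .set .vpb 0 ;; .set .vi 0 ;; .set .vp Var.vob)) = 8 := rfl
    rw [e1]
    generalize copyBody.time = B
    have := Nat.zero_le (n / q)
    generalize n / q = x at *
    simp only [Nat.add_mul, Nat.mul_add]
    omega

/-- A constant factor for the running time of `fillCmd`. -/
def fillTime : ℕ := fillBody.time + fillBegin.time + copyBody.time + 40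

theorem fillCmd_within (hp : Params w n k q τ) (hF : FillPre w n k q τ s d OB m₀)
    (hc : Consts w n k q τ S) (hm : S.mem = m₀) (hd : S.v .vd = d) (hlo : S.v .vlo = 2 ^ d)
    (hob : S.v .vob = OB) :
    fillCmd.Within w S (fillTime * fillCount n k q)
      fun S' => FillPost w n k q τ s d OB m₀ S'.mem := by
  have hn := hp.two_le
  unfold fillCmd
  refine within_ite (fillTime * fillCount n k q - 4) (by simp) (by simp) (fun h => ?_)
    (fun h => ?_) ?_
  · rw [Expr.val_var, Expr.val_var, hc.vq, hc.vk] at h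
    refine (fillLong_within hp hF hc hm hd hlo).mono ?_ fun _ h => h
    rw [fillCount, if_pos h, fillTime]
    generalize fillBody.time = B at *
    generalize fillBegin.time = T at *
    generalize copyBody.time = C at *
    simp only [Nat.add_mul]
    have := Nat.zero_le (C * n)
    omega
  · rw [Expr.val_var, Expr.val_var, hc.vq, hc.vk] at h
    refine (fillShort_within hp hF (by omega) hc hm hob).mono ?_ fun _ h => h
    rw [fillCount, if_neg h, fillTime]
    generalize fillBody.time = B at *
    generalize fillBegin.time = T at *
    generalize copyBody.time = C at *
    generalize n / q = x at *
    simp only [Nat.add_mul, Nat.mul_add]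
    omega
  · have h1 : 1 ≤ fillCount n k q := by
      have := Nat.zero_le (n / q)
      unfold fillCount
      split_ifs <;> omega
    have h2 := Nat.mul_le_mul_left fillTime h1
    have h3 : 40 ≤ fillTime := Nat.le_add_left _ _
    simp only [Expr.cost]
    omega

end WaveletRAM

/-! ### All levels of the tree -/

namespace WaveletRAM

open WordRAM

open Var in
/-- Begin the loop over the nodes of depth `vd`. -/
def levelBegin : Cmd := .set vbp vnb ;; .set vh vlo ;; .set vhi (vlo + vlo)

open Var in
/-- Go on to the next depth; `ve` is `vd` modulo `vtau`. -/
def levelEnd : Cmd :=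
  .set vi vnb ;; .set vnb vob ;; .set vob vi ;; .set vd (vd + 1) ;; .set vlo vhi ;;
  .set ve (ve + 1) ;; .ite ve vtau .skip (.set ve 0)

open Var in
/-- Process the nodes of depth `vd`. -/
def levelCmd : Cmd := .ite ve 1 fillCmd .skip ;; levelBegin ;; levelLoop ;; levelEnd

/-- The address of the buffer for the lists of depth `d`. -/
def buffer (n d : ℕ) : ℕ := if d % 2 = 0 then 64 * n else 80 * n

/-- The invariant of the main loop: all nodes of depth less than `d` have been processed. -/
structure MainInv (w n k q τ : ℕ) (s : List ℕ) (d : ℕ) (S : State) : Prop where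
  consts : Consts w n k q τ S
  vd : S.v .vd = d
  ve : S.v .ve = d % τ
  vlo : S.v .vlo = 2 ^ d
  vob : S.v .vob = buffer n d
  vnb : S.v .vnb = buffer n (d + 1)
  out_ge : 96 * n ≤ S.v .vout
  out_le : S.v .vout ≤ 96 * n + n * d / w + 2 ^ d
  lists : Lists n k q τ s (initialChar k τ d) S.mem (buffer n d) (buffer n d + 16 * n)
    (2 ^ d) (2 ^ (d + 1))
  done : Done w n k s S.mem (S.v .vout) (2 ^ d)
  table : ∀ x < 2 ^ (q * τ), TableEntry S.mem (48 * n) τ x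
  input : ∀ a < 16 * n, S.mem a = Nat.ofDigits (2 ^ k) s / 2 ^ (w * a) % 2 ^ w
  ptr : ∀ h, 2 ^ d ≤ h → h < 16 * n → S.mem (32 * n + h) = 0
  root : d = 0 → S.mem (16 * n + 2) = buffer n d

variable {w n k q τ : ℕ} {s : List ℕ} {d : ℕ} {S : State}

theorem buffers (n d : ℕ) : Buffers n (buffer n d) (buffer n (d + 1)) := by
  unfold Buffers buffer
  rcases Nat.mod_two_eq_zero_or_one d with h | h
  · left; simp [h]; omega
  · right; simp [h]; omega

theorem buffer_add_two (n d : ℕ) : buffer n (d + 1 + 1) = buffer n d := by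
  unfold buffer
  rw [show (d + 1 + 1) % 2 = d % 2 by omega]

/-- The lists are ready when the loop over the nodes of depth `d` begins. -/
theorem fillStep_within (hp : Params w n k q τ) (hs : s.length = n) (hlt : ∀ c ∈ s, c < 2 ^ k)
    (hd : d < k) (hI : MainInv w n k q τ s d S) :
    (Cmd.ite Var.ve 1 fillCmd .skip).Within w S
      ((if d % τ = 0 then fillTime * fillCount n k q else 0) + 4) fun S' =>
      Lists n k q τ s (shortChar k τ d) S'.mem (buffer n d) (buffer n d + 16 * n)
        (2 ^ d) (2 ^ (d + 1)) ∧
      (∀ h, 2 ^ (d + 1) ≤ h → h < 16 * n → S'.mem (32 * n + h) = 0) ∧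
      (∀ a, (a < 32 * n ∨ 48 * n ≤ a) → (a < buffer n d ∨ buffer n d + 16 * n ≤ a) →
        S'.mem a = S.mem a) := by
  have hp2 : 2 ^ (d + 1) = 2 * 2 ^ d := pow_succ' ..
  have hw : w ≠ 0 := by have := hp.k_le; have := hp.k_pos; omega
  refine within_ite (if d % τ = 0 then fillTime * fillCount n k q else 0) (by simp)
    (by simp [hw]) (fun h => ?_) (fun h => ?_) (by simp only [Expr.cost]; omega)
  · have h0 : d % τ = 0 := by simpa [hI.ve] using h
    rw [if_pos h0]
    have hF : FillPre w n k q τ s d (buffer n d) S.mem :=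
      ⟨hd, h0, hs, hlt, by unfold buffer; split_ifs <;> simp, hI.input, hI.ptr, hI.lists, hI.root⟩
    exact (fillCmd_within hp hF hI.consts rfl hI.vd hI.vlo hI.vob).mono le_rfl
      fun S' h => ⟨h.lists, h.ptr, h.frame⟩
  · have h0 : ¬ d % τ = 0 := by simpa [hI.ve] using h
    refine within_skip ⟨?_, fun h h1 h2 => hI.ptr h (by omega) h2, fun _ _ _ => rfl⟩
    have : initialChar k τ d = shortChar k τ d := by
      funext c; rw [initialChar, if_neg h0]
    rw [← this]
    exact hI.lists

/-- A bound for the time a level takes, apart from the filling of the lists and from the time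
proportional to the total size of the lists and to the number of nodes. -/
def levelTime : ℕ := levelBegin.time + nodeTime + levelEnd.time + 8

theorem levelCmd_within (hp : Params w n k q τ) (hs : s.length = n) (hlt : ∀ c ∈ s, c < 2 ^ k)
    (hd : d < k) (hI : MainInv w n k q τ s d S) :
    levelCmd.Within w S ((if d % τ = 0 then fillTime * fillCount n k q else 0) +
      ((splitBody.time + 4) * (n / q) + nodeTime * 2 ^ d) + (levelTime - 4))
      (MainInv w n k q τ s (d + 1)) := by
  have hroom := hp.room
  have hn := hp.two_le
  have hp2 : 2 ^ (d + 1) = 2 * 2 ^ d := pow_succ' ..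
  have hpk : 2 * 2 ^ d ≤ 2 ^ k := by
    rw [← pow_succ']; exact Nat.pow_le_pow_right (by norm_num) hd
  have hpk2 := hp.pow_k
  have h1' : 1 ≤ 2 ^ d := Nat.one_le_two_pow
  have hLn := hp.pow_L
  have hB := buffers n d
  have hB' := hB
  unfold Buffers at hB'
  set OB := buffer n d with hOB
  set NB := buffer n (d + 1) with hNB
  have hw : 0 < w := by have := hp.k_le; have := hp.k_pos; omega
  unfold levelCmd
  refine within_seq_of (t₂ := levelBegin.time + ((splitBody.time + 4) * (n / q) +
    nodeTime * (2 ^ d + 1)) + levelEnd.time) (fillStep_within hp hs hlt hd hI) ?_ ?_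
  swap
  · have e : levelTime - 4 = levelBegin.time + nodeTime + levelEnd.time + 4 := rfl
    have e2 := Nat.mul_succ nodeTime (2 ^ d)
    rw [e, ← Nat.succ_eq_add_one (2 ^ d), e2]
    omega
  rintro S₁ ⟨hL1, hptr1, hfr1⟩ hf1
  have hc1 := hI.consts.of_frame hf1 (by decide)
  refine within_seq_of (t₂ := (splitBody.time + 4) * (n / q) +
    nodeTime * (2 ^ d + 1) + levelEnd.time) (Cmd.within_of_pre (Q := fun S' => S'.mem = S₁.mem ∧
    S'.v .vbp = NB ∧ S'.v .vh = 2 ^ d ∧ S'.v .vhi = 2 ^ (d + 1)) ?_) ?_ (by omega)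
  · have g1 : S₁.v .vnb = NB := by rw [hf1 _ (by decide), hI.vnb]
    have g2 : S₁.v .vlo = 2 ^ d := by rw [hf1 _ (by decide), hI.vlo]
    simp [levelBegin, Cmd.pre, g1, g2]
    omega
  rintro S₂ ⟨hm2, hbp2, hh2, hhi2⟩ hf2
  have hc2 := hc1.of_frame hf2 (by decide)
  have hout2 : S₂.v .vout = S.v .vout := by rw [hf2 _ (by decide), hf1 _ (by decide)]
  have hdone := hI.done
  have hout1 := hI.out_ge
  have hout3 := hI.out_le
  have hz := Nat.zero_le (n * d / w)
  have hinv : LevelInv w n k q τ s d OB NB S₁.mem (2 ^ d) S₂ := by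
    refine ⟨hc2, hh2, hhi2, by omega, ?_, by omega, ?_, by rw [hm2]; exact hL1, ?_, ?_, ?_⟩
    · rw [hbp2, before_two_pow]; omega
    · rw [before_two_pow, hout2, add_zero]; exact hout3
    · rw [← hp2]
      refine ⟨?_, ?_, ?_, ?_, ?_⟩ <;> intros <;> omega
    · have hdir : ∀ h, 1 ≤ h → h < 2 ^ d →
          S₁.mem (16 * n + 2 * h) = S.mem (16 * n + 2 * h) ∧
          S₁.mem (16 * n + 2 * h + 1) = S.mem (16 * n + 2 * h + 1) := fun h e1 e2 =>
        ⟨hfr1 _ (by omega) (by omega), hfr1 _ (by omega) (by omega)⟩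
      rw [hm2, hout2]
      refine ⟨?_, ?_, ?_, ?_, ?_⟩
      · intro h e1 e2; rw [(hdir h e1 e2).2]; exact hdone.len h e1 e2
      · intro h e1 e2; rw [(hdir h e1 e2).1]; exact hdone.lo h e1 e2
      · intro h e1 e2; rw [(hdir h e1 e2).1]; exact hdone.hi h e1 e2
      · intro h h' e1 e2 e3
        rw [(hdir h e1 (by omega)).1, (hdir h' (by omega) e3).1]
        exact hdone.sep h h' e1 e2 e3
      · intro h e1 e2
        rw [(hdir h e1 e2).1]
        have := hdone.lo h e1 e2
        exact (hdone.stores h e1 e2).congr fun i _ => hfr1 _ (by omega) (by omega)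
    · intro a _ _; rw [hm2]
  have htab : ∀ x < 2 ^ (q * τ), TableEntry S₁.mem (48 * n) τ x := by
    intro x hx
    obtain ⟨t1, t2, t3, t4⟩ := hI.table x hx
    refine ⟨?_, ?_, ?_, ?_⟩ <;> rw [hfr1 _ (by omega) (by omega)] <;> assumption
  refine within_seq_of (levelLoop_within hp hs hB hd htab hinv) ?_ le_rfl
  intro S₃ hI3 hf3
  have hfr3 := hI3.frame
  refine ((Cmd.within_of_pre (Q := fun S' => S'.mem = S₃.mem ∧ S'.v .vd = d + 1 ∧
    S'.v .ve = (d + 1) % τ ∧ S'.v .vlo = 2 ^ (d + 1) ∧ S'.v .vob = NB ∧ S'.v .vnb = OB)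
    ?_).frame).mono le_rfl ?_
  · have hdn := Nat.lt_two_pow_self (n := d)
    have he := Nat.mod_lt d hp.tau_pos
    have hDE := Nat.div_add_mod d τ
    have htk := hp.tau_le
    have hkn := Nat.lt_two_pow_self (n := k)
    have e1 : S₃.v .vnb = NB := by
      rw [hf3 _ (by decide), hf2 _ (by decide), hf1 _ (by decide), hI.vnb]
    have e2 : S₃.v .vob = OB := by
      rw [hf3 _ (by decide), hf2 _ (by decide), hf1 _ (by decide), hI.vob]
    have e3 : S₃.v .vd = d := by
      rw [hf3 _ (by decide), hf2 _ (by decide), hf1 _ (by decide), hI.vd]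
    have e4 : S₃.v .ve = d % τ := by
      rw [hf3 _ (by decide), hf2 _ (by decide), hf1 _ (by decide), hI.ve]
    simp only [levelEnd, Cmd.pre, Expr.ok_var, Expr.val_var, Expr.ok_add, Expr.val_add,
      Expr.ok_lit, Expr.val_lit, State.v_set, State.mem_set, reduceCtorEq, if_true, if_false,
      e1, e2, e3, e4, hI3.vhi, hI3.consts.vtau, true_and, and_true]
    refine ⟨⟨by omega, by omega⟩, ⟨by omega, by omega⟩, fun h => ?_, fun h => ⟨by omega, ?_⟩⟩
    · conv_rhs => rw [← hDE, add_assoc, Nat.mul_add_mod, Nat.mod_eq_of_lt h]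
    · conv_rhs => rw [← hDE, add_assoc, show d % τ + 1 = τ by omega, Nat.mul_add_mod,
        Nat.mod_self]
  rintro S₄ ⟨⟨hm4, hd4, he4, hlo4, hob4, hnb4⟩, hf4⟩
  have hout4 : S₄.v .vout = S₃.v .vout := hf4 _ (by decide)
  have hbl := before_le k s d (2 ^ (d + 1))
  rw [hs] at hbl
  have hbp3 := hI3.bp_le
  have hgeo : ∀ a < 64 * n, a < 16 * n ∨ 48 * n ≤ a → S₃.mem a = S.mem a := fun a h1 h2 => by
    rw [hfr3 a h1 (by omega), hfr1 a (by omega) (by omega)]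
  refine ⟨hI3.consts.of_frame hf4 (by decide), hd4, he4, hlo4, hob4, ?_, ?_, ?_, ?_, ?_, ?_, ?_,
    ?_, ?_⟩
  · rw [hnb4, buffer_add_two]
  · rw [hout4]; exact hI3.out_ge
  · rw [hout4]
    have e1 := hI3.out_le
    have e2 : (n * d + before k s d (2 ^ (d + 1))) / w ≤ n * (d + 1) / w :=
      Nat.div_le_div_right (by rw [Nat.mul_succ]; omega)
    omega
  · have hN := hI3.next
    rw [← pow_succ'] at hN
    rw [hm4]
    refine ⟨hN.len, hN.lo, fun h e1 e2 => (hN.hi h e1 e2).trans (by omega), hN.sep, hN.stores⟩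
  · rw [hm4, hout4]; exact hI3.done
  · intro x hx
    obtain ⟨t1, t2, t3, t4⟩ := hI.table x hx
    refine ⟨?_, ?_, ?_, ?_⟩ <;> rw [hm4, hgeo _ (by omega) (by omega)] <;> assumption
  · intro a ha
    rw [hm4, hgeo a (by omega) (by omega), hI.input a ha]
  · intro h e1 e2
    rw [hm4, hfr3 _ (by omega) (by omega), hptr1 h e1 e2]
  · intro h; omega

open Var in
/-- Process all levels. -/
def mainLoop : Cmd := .loop vd vk levelCmd

/-- A bound for the running time of the main loop. -/
def mainTime (n k q τ : ℕ) : ℕ :=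
  fillTime * fillCount n k q * ((k + τ - 1) / τ) +
    ((splitBody.time + 4) * (n / q) + levelTime) * k + nodeTime * 2 ^ k + 4

theorem mainLoop_within (hp : Params w n k q τ) (hs : s.length = n) (hlt : ∀ c ∈ s, c < 2 ^ k)
    (hI : MainInv w n k q τ s 0 S) :
    mainLoop.Within w S (mainTime n k q τ) (MainInv w n k q τ s k) := by
  have hτ := hp.tau_pos
  refine within_loop k (MainInv w n k q τ s) (fun d =>
      (if d % τ = 0 then fillTime * fillCount n k q else 0) +
      ((splitBody.time + 4) * (n / q) + nodeTime * 2 ^ d) + (levelTime - 4))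
    (fun d => fillTime * fillCount n k q * ((d + τ - 1) / τ) +
      ((splitBody.time + 4) * (n / q) + levelTime) * d + nodeTime * 2 ^ d) hI
    (fun _ _ _ => by simp) ?_ ?_ ?_ ?_
  · intro d hd S hI
    refine ⟨by simpa [hI.vd, hI.consts.vk] using hd, levelCmd_within hp hs hlt hd hI⟩
  · intro S hI
    simp [hI.vd, hI.consts.vk]
  · intro d hd
    have h4 : 4 ≤ levelTime := Nat.le_add_left_of_le (by norm_num)
    have e1 : (d + τ - 1) / τ + (if d % τ = 0 then 1 else 0) ≤ (d + 1 + τ - 1) / τ := by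
      have h1 : (d + 1 + τ - 1) / τ = d / τ + 1 := by
        rw [show d + 1 + τ - 1 = d + τ by omega, Nat.add_div_right _ hτ]
      rw [h1]
      split_ifs with h
      · have := Nat.div_add_mod d τ
        have h2 : (d + τ - 1) / τ ≤ d / τ := by
          rw [← Nat.lt_succ_iff, Nat.div_lt_iff_lt_mul hτ, Nat.succ_mul, mul_comm]
          omega
        omega
      · rw [← Nat.add_div_right _ hτ]
        exact Nat.div_le_div_right (by omega)
    have e2 := Nat.mul_le_mul_left (fillTime * fillCount n k q) e1
    have e3 : nodeTime * 2 ^ (d + 1) = nodeTime * 2 ^ d + nodeTime * 2 ^ d := by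
      rw [pow_succ]; ring
    simp only [Expr.cost]
    generalize fillTime * fillCount n k q = A at *
    generalize (splitBody.time + 4) * (n / q) = B at *
    generalize levelTime = C at *
    generalize nodeTime * 2 ^ (d + 1) = D at *
    generalize nodeTime * 2 ^ d = E at *
    rw [Nat.mul_add] at e2
    have e4 : A * (if d % τ = 0 then 1 else 0) = if d % τ = 0 then A else 0 := by
      split_ifs <;> simp
    rw [e4] at e2
    rw [Nat.mul_succ (B + C) d]
    omega
  · simp only [Expr.cost, mainTime]
    omega

end WaveletRAM

/-! ### Initialization -/

namespace WaveletRAM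

open WordRAM

/-- The number of short characters in a cell: with at most as many bits per character, a cell has
at most `n` different contents. -/
def perCell (n : ℕ) : ℕ := Nat.sqrt (Nat.log 2 n)

/-- The number of levels in a block, and of bits of a short character. -/
def blockHeight (n k : ℕ) : ℕ := min k (perCell n)

theorem perCell_pos {n : ℕ} (hn : 2 ≤ n) : 1 ≤ perCell n := by
  rw [perCell, Nat.le_sqrt]
  exact Nat.log_pos (by norm_num) hn

theorem perCell_mul_self_le (n : ℕ) : perCell n * perCell n ≤ Nat.log 2 n := Nat.sqrt_le _

theorem two_pow_clog_le {n σ : ℕ} (h2 : 2 ≤ σ) (hσ : σ ≤ n) : 2 ^ Nat.clog 2 σ ≤ 2 * n := by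
  have hk := Nat.clog_pos (b := 2) (by norm_num) h2
  have h := Nat.pow_lt_of_lt_clog (b := 2) (x := σ) (y := Nat.clog 2 σ - 1) (by omega)
  have e : 2 ^ Nat.clog 2 σ = 2 ^ (Nat.clog 2 σ - 1) * 2 := by
    rw [← pow_succ]; congr 1; omega
  omega

theorem params {w n σ : ℕ} (h2 : 2 ≤ σ) (hσ : σ ≤ n) (hw : Nat.clog 2 n + 8 ≤ w) :
    Params w n (Nat.clog 2 σ) (perCell n) (blockHeight n (Nat.clog 2 σ)) := by
  have hk := Nat.clog_pos (b := 2) (by norm_num) h2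
  have hq := perCell_pos (h2.trans hσ)
  have hpk := two_pow_clog_le h2 hσ
  have hl : 2 ^ Nat.log 2 n ≤ n := Nat.pow_log_le_self _ (by omega)
  have hlq := perCell_mul_self_le n
  have hqq : perCell n ≤ perCell n * perCell n := Nat.le_mul_self _
  have hroom : 256 * n ≤ 2 ^ w := by
    have h1 := Nat.le_pow_clog (b := 2) (by norm_num) n
    have h3 : 2 ^ (Nat.clog 2 n + 8) ≤ 2 ^ w := Nat.pow_le_pow_right (by norm_num) hw
    rw [pow_add] at h3
    omega
  have h2w : w + w < 2 ^ w := by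
    obtain ⟨v, rfl⟩ : ∃ v, w = v + 8 := ⟨w - 8, by omega⟩
    have := Nat.lt_two_pow_self (n := v)
    rw [pow_add]
    omega
  have hlt : ∀ a, 2 ^ a < 2 ^ w → a < w := fun a =>
    (Nat.pow_lt_pow_iff_right (a := 2) (by norm_num)).mp
  refine ⟨by omega, hk, hq, ?_, min_le_left _ _, (hlt _ (by omega)).le, ?_, hpk, ?_, hroom, h2w,
    fun h => min_eq_left h⟩
  · exact le_min hk hq
  · have := hlt (Nat.log 2 n) (by omega)
    omega
  · refine (Nat.pow_le_pow_right (by norm_num) ?_).trans hl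
    exact (Nat.mul_le_mul_left _ (min_le_right _ _)).trans hlq

open Var in
/-- Compute the number `vk` of bits of a character, and its power of two. -/
def charBits : Cmd :=
  .set vk 0 ;; .set vpk 1 ;; .loop vpk vsig (.set vpk (vpk + vpk) ;; .set vk (vk + 1))

open Var in
/-- Compute the logarithm of the length of the string. -/
def logLength : Cmd :=
  .set vl 0 ;; .set vp vn ;;
  .loop 1 vp (.set vp ((vp : Expr) >>> (1 : Expr)) ;; .set vl (vl + 1))

open Var in
/-- Compute the square root of the logarithm. -/
def sqrtLog : Cmd :=
  .set vq 1 ;; .loop ((vq + 1) * (vq + 1)) (vl + 1) (.set vq (vq + 1))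

open Var in
/-- Compute the other constants. -/
def constants : Cmd :=
  .ite vk vq (.set vtau vk) (.set vtau vq) ;;
  .set vL (vq * vtau) ;;
  .set vpL ((1 : Expr) <<< (vL : Expr)) ;;
  .set vpT ((1 : Expr) <<< (vtau : Expr)) ;;
  .set vdir (vn * 16) ;; .set vptr (vn * 32) ;; .set vtab (vn * 48)

variable {w n k q τ σ : ℕ} {S : State}

theorem charBits_within (h2 : 2 ≤ σ) (hσ : σ ≤ n) (hroom : 256 * n ≤ 2 ^ w)
    (hv : S.v .vsig = σ) : charBits.Within w S (12 * Nat.clog 2 σ + 8) fun S' =>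
      S'.mem = S.mem ∧ S'.v .vk = Nat.clog 2 σ ∧ S'.v .vpk = 2 ^ Nat.clog 2 σ := by
  have h1 : 1 < 2 ^ w := by omega
  have hw : w ≠ 0 := by rintro rfl; omega
  unfold charBits
  refine within_seq_of (t₁ := 2) (t₂ := 12 * Nat.clog 2 σ + 6) (Cmd.within_of_pre (Q := fun S' =>
    S'.mem = S.mem ∧ S'.v .vk = 0) ?_) ?_ (by omega)
  · simp [Cmd.pre]
  rintro S₁ ⟨hm1, hk1⟩ hf1
  refine within_seq_of (t₁ := 2) (t₂ := 12 * Nat.clog 2 σ + 4) (Cmd.within_of_pre (Q := fun S' =>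
    S'.mem = S.mem ∧ S'.v .vpk = 1) ?_) ?_ (by omega)
  · simp [Cmd.pre, hm1, hw]
  rintro S₂ ⟨hm2, hpk2⟩ hf2
  refine (within_loop (Nat.clog 2 σ) (fun j S' => S'.mem = S.mem ∧ S'.v .vk = j ∧
    S'.v .vpk = 2 ^ j ∧ S'.v .vsig = σ) (fun _ => 8) (fun j => 12 * j) ?_ (fun _ _ _ => by simp)
    ?_ ?_ (fun j _ => by simp only [Expr.cost]; omega) (by simp only [Expr.cost]; omega)).mono
    le_rfl fun S' h => ⟨h.1, h.2.1, h.2.2.1⟩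
  · refine ⟨hm2, ?_, by simp [hpk2], ?_⟩
    · rw [hf2 _ (by decide), hk1]
    · rw [hf2 _ (by decide), hf1 _ (by decide), hv]
  · rintro j hj S' ⟨g1, g2, g3, g4⟩
    have hlt := Nat.pow_lt_of_lt_clog hj
    refine ⟨by simpa [g3, g4] using hlt, Cmd.within_of_pre (c := .seq _ _) ?_⟩
    have := Nat.lt_two_pow_self (n := j)
    simp [Cmd.pre, g1, g2, g3, g4, pow_succ, hw]
    and_intros <;> omega
  · rintro S' ⟨g1, g2, g3, g4⟩
    simpa [g3, g4] using Nat.le_pow_clog (b := 2) (by norm_num) σ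

theorem logLength_within (hn : 2 ≤ n) (hroom : 256 * n ≤ 2 ^ w) (hv : S.v .vn = n) :
    logLength.Within w S (12 * Nat.log 2 n + 8) fun S' =>
      S'.mem = S.mem ∧ S'.v .vl = Nat.log 2 n := by
  have h1 : 1 < 2 ^ w := by omega
  have hw : w ≠ 0 := by rintro rfl; omega
  unfold logLength
  refine within_seq_of (t₁ := 2) (t₂ := 12 * Nat.log 2 n + 6) (Cmd.within_of_pre (Q := fun S' =>
    S'.mem = S.mem ∧ S'.v .vl = 0) ?_) ?_ (by omega)
  · simp [Cmd.pre]
  rintro S₁ ⟨hm1, hl1⟩ hf1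
  refine within_seq_of (t₁ := 2) (t₂ := 12 * Nat.log 2 n + 4) (Cmd.within_of_pre (Q := fun S' =>
    S'.mem = S.mem ∧ S'.v .vp = n) ?_) ?_ (by omega)
  · simp [Cmd.pre, hm1, hf1 .vn (by decide), hv]
  rintro S₂ ⟨hm2, hp2⟩ hf2
  refine (within_loop (Nat.log 2 n) (fun j S' => S'.mem = S.mem ∧ S'.v .vl = j ∧
    S'.v .vp = n / 2 ^ j) (fun _ => 8) (fun j => 12 * j) ?_ (fun _ _ _ => by simp [hw])
    ?_ ?_ (fun j _ => by simp only [Expr.cost]; omega) (by simp only [Expr.cost]; omega)).mono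
    le_rfl fun S' h => ⟨h.1, h.2.1⟩
  · exact ⟨hm2, by rw [hf2 _ (by decide), hl1], by simp [hp2]⟩
  · rintro j hj S' ⟨g1, g2, g3⟩
    have hle : 2 ^ (j + 1) ≤ n := Nat.pow_le_of_le_log (by omega) hj
    have hdiv : 2 ≤ n / 2 ^ j := by
      rw [Nat.le_div_iff_mul_le (by positivity), ← pow_succ']; exact hle
    refine ⟨by simp [g3]; omega, Cmd.within_of_pre (c := .seq _ _) ?_⟩
    have := Nat.lt_two_pow_self (n := j + 1)
    simp [Cmd.pre, g1, g2, g3, pow_succ, hw, Nat.div_div_eq_div_mul]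
    omega
  · rintro S' ⟨g1, g2, g3⟩
    have h := Nat.lt_pow_succ_log_self (b := 2) (by norm_num) n
    rw [pow_succ'] at h
    have h3 := (Nat.div_lt_iff_lt_mul (x := n) (y := 2) (k := 2 ^ Nat.log 2 n)
      (by positivity)).mpr h
    simp [g3]
    omega

theorem sqrtLog_within (hn : 2 ≤ n) (hroom : 256 * n ≤ 2 ^ w) (hv : S.v .vl = Nat.log 2 n) :
    sqrtLog.Within w S (16 * perCell n + 14) fun S' => S'.mem = S.mem ∧ S'.v .vq = perCell n := by
  have h1 : 1 < 2 ^ w := by omega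
  have hw : w ≠ 0 := by rintro rfl; omega
  have hq := perCell_pos hn
  have hln : Nat.log 2 n < n := Nat.log_lt_self 2 (by omega)
  have hqq := perCell_mul_self_le n
  have hql : perCell n ≤ perCell n * perCell n := Nat.le_mul_self _
  unfold sqrtLog
  refine within_seq_of (t₁ := 2) (t₂ := 16 * perCell n + 12) (Cmd.within_of_pre (Q := fun S' =>
    S'.mem = S.mem ∧ S'.v .vq = 1) ?_) ?_ (by omega)
  · simp [Cmd.pre, hw]
  rintro S₁ ⟨hm1, hq1⟩ hf1
  have hsq : ∀ a, a ≤ perCell n → (a + 1) * (a + 1) < 2 ^ w := fun a ha => by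
    have h3 := Nat.mul_self_le_mul_self (Nat.succ_le_succ ha)
    have e : (perCell n + 1) * (perCell n + 1) =
        perCell n * perCell n + perCell n + perCell n + 1 := by ring
    rw [Nat.succ_eq_add_one, Nat.succ_eq_add_one, e] at h3
    omega
  refine (within_loop (perCell n - 1) (fun j S' => S'.mem = S.mem ∧ S'.v .vq = j + 1 ∧
    j + 1 ≤ perCell n ∧ S'.v .vl = Nat.log 2 n) (fun _ => 4) (fun j => 16 * j) ?_ ?_
    ?_ ?_ (fun j _ => by simp only [Expr.cost]; omega) (by simp only [Expr.cost]; omega)).mono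
    le_rfl fun S' h => ⟨h.1, by have := h.2.1; omega⟩
  · exact ⟨hm1, hq1, hq, by rw [hf1 _ (by decide), hv]⟩
  · rintro j S' ⟨g1, g2, g3, g4⟩
    have := hsq (j + 1) g3
    simp [g2, g4, hw]
    omega
  · rintro j hj S' ⟨g1, g2, g3, g4⟩
    have hle : (j + 2) * (j + 2) ≤ Nat.log 2 n := Nat.le_sqrt.mp (by unfold perCell at hj; omega)
    refine ⟨by simp [g2, g4]; omega, Cmd.within_of_pre (c := .set _ _) ?_⟩
    simp [Cmd.pre, g1, g2, g4, hw]
    omega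
  · rintro S' ⟨g1, g2, g3, g4⟩
    have h := Nat.lt_succ_sqrt (Nat.log 2 n)
    have e : perCell n - 1 + 1 = perCell n := by omega
    simp [g2, g4, e]
    exact h

theorem constants_within (hp : Params w n k q (min k q)) (hn : S.v .vn = n) (hw : S.v .vw = w)
    (hk : S.v .vk = k) (hpk : S.v .vpk = 2 ^ k) (hq : S.v .vq = q) :
    constants.Within w S constants.time fun S' =>
      S'.mem = S.mem ∧ Consts w n k q (min k q) S' := by
  have hroom := hp.room
  have hn2 := hp.two_le
  have hLw := hp.L_lt
  have hτw := hp.tau_lt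
  have h2w := hp.two_w
  have hL : 2 ^ (q * min k q) < 2 ^ w := Nat.pow_lt_pow_right (by norm_num) hLw
  have hT : 2 ^ min k q < 2 ^ w := Nat.pow_lt_pow_right (by norm_num) hτw
  have hw0 : w ≠ 0 := by omega
  unfold constants
  refine within_seq_of (Cmd.within_of_pre (Q := fun S' => S'.mem = S.mem ∧
    S'.v .vtau = min k q) ?_) ?_ le_rfl
  · simp [Cmd.pre, hk, hq]
    omega
  rintro S₁ ⟨hm1, ht1⟩ hf1
  refine ((Cmd.within_of_pre (Q := fun S' => S'.mem = S.mem ∧ S'.v .vL = q * min k q ∧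
    S'.v .vpL = 2 ^ (q * min k q) ∧ S'.v .vpT = 2 ^ min k q ∧ S'.v .vdir = 16 * n ∧
    S'.v .vptr = 32 * n ∧ S'.v .vtab = 48 * n) ?_).frame).mono le_rfl ?_
  · simp [Cmd.pre, hm1, ht1, hf1 .vq (by decide), hq, hf1 .vn (by decide), hn, hw0,
      Nat.mod_eq_of_lt hL, Nat.mod_eq_of_lt hT]
    and_intros <;> omega
  · rintro S' ⟨⟨g1, g2, g3, g4, g5, g6, g7⟩, hf⟩
    refine ⟨g1, ?_, ?_, ?_, ?_, ?_, ?_, g2, g3, g4, g5, g6, g7⟩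
    all_goals rw [hf _ (by decide)]
    · rw [hf1 _ (by decide), hn]
    · rw [hf1 _ (by decide), hw]
    · rw [hf1 _ (by decide), hk]
    · rw [hf1 _ (by decide), hpk]
    · rw [hf1 _ (by decide), hq]
    · exact ht1

end WaveletRAM

/-! ### The lookup table -/

namespace WaveletRAM

open WordRAM

open Var in
/-- Read the table entries for `vx` without its first character `vc`; in `vg`, compute this
character without its leading bit. -/
def tableRead : Cmd :=
  .set vy (vtab + (vx : Expr) >>> (vtau : Expr) * 4) ;;
  .set vc (vx % vpT) ;; .set vg ((vc + vc) % vpT) ;;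
  .set vsa (.ld vy) ;; .set vsb (.ld (vy + 1) + .ld (vy + 1)) ;;
  .set vpw (.ld (vy + 2)) ;; .set vpb (.ld (vy + 3))

open Var in
/-- Take the character `vc` into account. -/
def tableCons : Cmd :=
  .ite (vc + vc) vpT
    (.set vpw (vg + vpw * vpT))
    (.set vsa (vsa + 1) ;; .set vsb (vsb + 1) ;; .set vpb (vg + vpb * vpT))

open Var in
/-- Write the table entries for `vx`, and go on to the next argument. -/
def tableWrite : Cmd :=
  .set va (vtab + vx * 4) ;;
  .store va vsa ;; .store (va + 1) vsb ;; .store (va + 2) vpw ;; .store (va + 3) vpb ;;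
  .set vx (vx + 1)

/-- Compute the table entries for `vx` from those for `vx` without its first character. -/
def tableBody : Cmd := tableRead ;; tableCons ;; tableWrite

open Var in
/-- Compute the table for all arguments less than `vpL`. -/
def tableLoop : Cmd := .set vx 1 ;; .loop vx vpL tableBody

variable {w n k q τ x : ℕ} {S : State}

/-- The table entries for a number that consists of less than `q` characters leave room for one
more character. -/
theorem TableEntry.bounds {m : ℕ → ℕ} {tab : ℕ} (hp : Params w n k q τ) (hx0 : 0 < x)
    (hx : x < 2 ^ (q * τ)) (h : TableEntry m tab τ (x / 2 ^ τ)) :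
    m (tab + 4 * (x / 2 ^ τ)) < n ∧ 2 * m (tab + 4 * (x / 2 ^ τ) + 1) < n ∧
      m (tab + 4 * (x / 2 ^ τ) + 2) * 2 ^ τ ≤ n ∧ m (tab + 4 * (x / 2 ^ τ) + 3) * 2 ^ τ ≤ n := by
  have hτ := hp.tau_pos
  have hLn := hp.pow_L
  have hb : 1 < 2 ^ τ := Nat.one_lt_two_pow (by omega)
  obtain ⟨h1, h2, h3, h4⟩ := h
  rw [h1, h2, h3, h4]
  have hlen : (Nat.digits (2 ^ τ) (x / 2 ^ τ)).length + 1 ≤ q := by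
    have e : (Nat.digits (2 ^ τ) x).length = (Nat.digits (2 ^ τ) (x / 2 ^ τ)).length + 1 := by
      rw [Nat.digits_def' hb hx0, List.length_cons]
    rw [← e, Nat.digits_length_le_iff hb, ← pow_mul, mul_comm]
    exact hx
  set l := Nat.digits (2 ^ τ) (x / 2 ^ τ)
  have hqL : 2 ^ q ≤ 2 ^ (q * τ) :=
    Nat.pow_le_pow_right (by norm_num) (Nat.le_mul_of_pos_right q hτ)
  have hsplit : ∀ b, splitVal τ b l * 2 ^ τ ≤ n := fun b => by
    have e1 : (split τ b l).length ≤ l.length := by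
      have := split_length_add τ l
      cases b <;> omega
    have e2 : splitVal τ b l < 2 ^ (τ * l.length) := splitVal_lt.trans_le
      (Nat.pow_le_pow_right (by norm_num) (Nat.mul_le_mul_left _ e1))
    calc splitVal τ b l * 2 ^ τ ≤ 2 ^ (τ * l.length) * 2 ^ τ := Nat.mul_le_mul_right _ e2.le
      _ = 2 ^ ((l.length + 1) * τ) := by rw [← pow_add]; congr 1; ring
      _ ≤ 2 ^ (q * τ) := Nat.pow_le_pow_right (by norm_num) (Nat.mul_le_mul_right _ hlen)
      _ ≤ n := hLn
  refine ⟨?_, ?_, hsplit false, hsplit true⟩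
  · have := onesCount_le τ l
    have := Nat.lt_two_pow_self (n := q)
    omega
  · have e1 := topBits_lt τ l
    have e2 : 2 ^ (l.length + 1) ≤ 2 ^ q := Nat.pow_le_pow_right (by norm_num) hlen
    rw [pow_succ] at e2
    omega

theorem tableBody_within (hp : Params w n k q τ) (hc : Consts w n k q τ S) (hv : S.v .vx = x)
    (hx0 : 0 < x) (hx : x < 2 ^ (q * τ)) (h : TableEntry S.mem (48 * n) τ (x / 2 ^ τ)) :
    tableBody.Within w S tableBody.time fun S' => S'.v .vx = x + 1 ∧
      TableEntry S'.mem (48 * n) τ x ∧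
      ∀ a, (a < 48 * n + 4 * x ∨ 48 * n + 4 * x + 4 ≤ a) → S'.mem a = S.mem a := by
  obtain ⟨b1, b2, b3, b4⟩ := h.bounds hp hx0 hx
  have hroom := hp.room
  have hn := hp.two_le
  have hLn := hp.pow_L
  have hw : w ≠ 0 := by have := hp.tau_lt; omega
  have hT : 2 ^ τ = 2 ^ (τ - 1) * 2 := by
    rw [← pow_succ]; congr 1; have := hp.tau_pos; omega
  have hc' := Nat.mod_lt x (show 0 < 2 ^ τ by positivity)
  have hg := Nat.mod_lt (x % 2 ^ τ + x % 2 ^ τ) (show 0 < 2 ^ τ by positivity)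
  have hTn : 2 ^ τ ≤ n := (Nat.pow_le_pow_right (by norm_num)
    (Nat.le_mul_of_pos_left τ hp.q_pos)).trans hLn
  have hd := Nat.div_le_self x (2 ^ τ)
  have hdiv : 0 < x → x / 2 ^ τ < x := fun h => Nat.div_lt_self h (Nat.one_lt_two_pow
    (by have := hp.tau_pos; omega))
  have hentry := fun m' => tableEntry_of_div (m' := m') hp.tau_pos hx0 h
  unfold tableBody
  set m := S.mem with hm
  obtain ⟨c, hc0⟩ : ∃ c, c = x % 2 ^ τ := ⟨_, rfl⟩
  obtain ⟨y, hy⟩ : ∃ y, y = x / 2 ^ τ := ⟨_, rfl⟩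
  have e2c : 2 * c = c + c := two_mul c
  simp only [← hc0, ← hy, e2c] at hc' hg hd hdiv hentry b1 b2 b3 b4
  obtain ⟨g, hg0⟩ : ∃ g, g = (c + c) % 2 ^ τ := ⟨_, rfl⟩
  simp only [← hg0] at hg hentry
  have e4 : ∀ a, 48 * n + a * 4 = 48 * n + 4 * a := fun a => by rw [mul_comm a]
  refine within_seq_of (Cmd.within_of_pre (Q := fun S' => S'.mem = m ∧
    S'.v .vc = c ∧ S'.v .vg = g ∧ S'.v .vsa = m (48 * n + 4 * y) ∧
    S'.v .vsb = 2 * m (48 * n + 4 * y + 1) ∧ S'.v .vpw = m (48 * n + 4 * y + 2) ∧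
    S'.v .vpb = m (48 * n + 4 * y + 3)) ?_) ?_ le_rfl
  · simp [tableRead, Cmd.pre, hc.vtab, hc.vtau, hc.vpT, hv, ← hy, ← hc0, ← hg0, ← hm, e4, hw]
    and_intros <;> omega
  rintro S₁ ⟨hm1, hc1, hg1, h1, h2, h3, h4⟩ hf1
  have hc' := hc.of_frame hf1 (by decide)
  have hx1 : S₁.v .vx = x := by rw [hf1 _ (by decide), hv]
  clear hf1
  refine within_seq_of (Cmd.within_of_pre (Q := fun S' => S'.mem = m ∧
    (c < 2 ^ (τ - 1) → S'.v .vsa = m (48 * n + 4 * y) ∧ S'.v .vsb = 2 * m (48 * n + 4 * y + 1) ∧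
      S'.v .vpw = g + m (48 * n + 4 * y + 2) * 2 ^ τ ∧ S'.v .vpb = m (48 * n + 4 * y + 3)) ∧
    (¬ c < 2 ^ (τ - 1) → S'.v .vsa = m (48 * n + 4 * y) + 1 ∧
      S'.v .vsb = 2 * m (48 * n + 4 * y + 1) + 1 ∧ S'.v .vpw = m (48 * n + 4 * y + 2) ∧
      S'.v .vpb = g + m (48 * n + 4 * y + 3) * 2 ^ τ)) ?_) ?_ le_rfl
  · simp [tableCons, Cmd.pre, hc'.vpT, hc1, hg1, h1, h2, h3, h4, hm1, hw]
    refine ⟨by omega, fun h => ?_, fun h => ?_⟩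
    · and_intros <;> omega
    · and_intros <;> omega
  rintro S₂ ⟨hm2, hlo, hhi⟩ hf2
  have hx2 : S₂.v .vx = x := by rw [hf2 _ (by decide), hx1]
  have ht2 : S₂.v .vtab = 48 * n := (hc'.of_frame hf2 (by decide)).vtab
  clear hf2
  refine (Cmd.within_of_pre (Q := fun S' => S'.v .vx = x + 1 ∧
    S'.mem (48 * n + 4 * x) = S₂.v .vsa ∧ S'.mem (48 * n + 4 * x + 1) = S₂.v .vsb ∧
    S'.mem (48 * n + 4 * x + 2) = S₂.v .vpw ∧ S'.mem (48 * n + 4 * x + 3) = S₂.v .vpb ∧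
      ∀ a, (a < 48 * n + 4 * x ∨ 48 * n + 4 * x + 4 ≤ a) → S'.mem a = m a) ?_).mono le_rfl ?_
  · simp [tableWrite, Cmd.pre, hx2, ht2, e4, hw, hm2, Function.update_apply]
    and_intros
    all_goals first | omega | skip
    intro a ha
    rw [if_neg (by omega), if_neg (by omega), if_neg (by omega), if_neg (by omega)]
  · rintro S₃ ⟨k1, k2, k3, k4, k5, k6⟩
    refine ⟨k1, hentry _ ?_ ?_, k6⟩
    · rw [k2, k3, k4, k5]; exact hlo
    · rw [k2, k3, k4, k5]; exact hhi

/-- The invariant of the loop that computes the table. -/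
structure TableInv (w n k q τ : ℕ) (m₀ : ℕ → ℕ) (j : ℕ) (S : State) : Prop where
  consts : Consts w n k q τ S
  vx : S.v .vx = j + 1
  table : ∀ x < j + 1, TableEntry S.mem (48 * n) τ x
  frame : ∀ a, (a < 48 * n ∨ 64 * n ≤ a) → S.mem a = m₀ a

theorem tableLoop_within (hp : Params w n k q τ) (hc : Consts w n k q τ S)
    (h0 : ∀ a < 4, S.mem (48 * n + a) = 0) :
    tableLoop.Within w S ((tableBody.time + 4) * 2 ^ (q * τ) + 6) fun S' =>
      (∀ x < 2 ^ (q * τ), TableEntry S'.mem (48 * n) τ x) ∧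
      ∀ a, (a < 48 * n ∨ 64 * n ≤ a) → S'.mem a = S.mem a := by
  have hL := Nat.one_le_two_pow (n := q * τ)
  have hLn := hp.pow_L
  have hn := hp.two_le
  have hw : w ≠ 0 := by have := hp.tau_lt; omega
  have e : 2 ^ (q * τ) - 1 + 1 = 2 ^ (q * τ) := by omega
  unfold tableLoop
  refine within_seq_of (t₁ := 2) (t₂ := (tableBody.time + 4) * 2 ^ (q * τ) + 4)
    (Cmd.within_of_pre (Q := fun S' => S'.mem = S.mem ∧ S'.v .vx = 1) ?_) ?_ (by omega)
  · simp [Cmd.pre, hw]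
  rintro S₁ ⟨hm1, hx1⟩ hf1
  refine (within_loop (2 ^ (q * τ) - 1) (TableInv w n k q τ S.mem) (fun _ => tableBody.time)
    (fun j => (tableBody.time + 4) * j) ?_ (fun _ _ _ => by simp) ?_ ?_ ?_ ?_).mono
    le_rfl fun S' h => ⟨by have := h.table; rwa [e] at this, h.frame⟩
  · refine ⟨hc.of_frame hf1 (by decide), hx1, fun x hx => ?_, fun a _ => by rw [hm1]⟩
    obtain rfl : x = 0 := by omega
    exact tableEntry_zero fun j hj => by rw [hm1, h0 j hj]
  · intro j hj S₂ hI
    refine ⟨by simp [hI.vx, hI.consts.vpL]; omega, ?_⟩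
    have hdiv : (j + 1) / 2 ^ τ < j + 1 := Nat.div_lt_self (by omega)
      (Nat.one_lt_two_pow (by have := hp.tau_pos; omega))
    refine ((tableBody_within hp hI.consts hI.vx (by omega) (by omega)
      (hI.table _ hdiv)).frame).mono le_rfl ?_
    rintro S₃ ⟨⟨g1, g2, g3⟩, hf⟩
    refine ⟨hI.consts.of_frame hf (by decide), g1, fun x hx => ?_, fun a ha => ?_⟩
    · rcases Nat.lt_succ_iff_lt_or_eq.mp hx with h | rfl
      · obtain ⟨t1, t2, t3, t4⟩ := hI.table x h
        refine ⟨?_, ?_, ?_, ?_⟩ <;> rw [g3 _ (by omega)] <;> assumption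
      · exact g2
    · rw [g3 a (by omega), hI.frame a ha]
  · intro S₂ hI
    simp [hI.vx, hI.consts.vpL, e]
  · intro j _
    rw [Nat.mul_succ]
    exact le_rfl
  · have := Nat.mul_le_mul_left (tableBody.time + 4) (Nat.sub_le (2 ^ (q * τ)) 1)
    simp only [Expr.cost, Nat.mul_zero]
    omega

end WaveletRAM

/-! ### The program -/

namespace WaveletRAM

open WordRAM

open Var in
/-- Prepare the main loop: there are two buffers for the lists, and the list of the root, of
length `n`, is the first one in the first buffer. -/
def root : Cmd :=
  .set vob (vn * 64) ;; .set vnb (vn * 80) ;; .set vout (vn * 96) ;;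
  .set vd 0 ;; .set ve 0 ;; .set vlo 1 ;;
  .store (vdir + 2) vob ;; .store (vdir + 3) vn

/-- Compute everything that the main loop needs. -/
def setup : Cmd := charBits ;; logLength ;; sqrtLog ;; constants ;; tableLoop ;; root

/-- A bound for the running time of the initialization. -/
def setupTime (n k q τ : ℕ) : ℕ :=
  12 * k + 12 * Nat.log 2 n + 16 * q + (tableBody.time + 4) * 2 ^ (q * τ) + constants.time +
    root.time + 40

open Var in
/-- The program: the address of the directory is moved to the output register at the end. -/
def wavelet : Cmd := setup ;; mainLoop ;; .set vn vdir

/-- The states in which the program starts. -/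
structure Input (w n σ : ℕ) (s : List ℕ) (S : State) : Prop where
  vn : S.v .vn = n
  vsig : S.v .vsig = σ
  vw : S.v .vw = w
  mem : ∀ a, S.mem a = Nat.ofDigits (2 ^ Nat.clog 2 σ) s / 2 ^ (w * a) % 2 ^ w

variable {w n k q τ σ : ℕ} {s : List ℕ} {S : State}

theorem Input.mem_eq_zero (h : Input w n σ s S) (hs : s.length = n)
    (hlt : ∀ c ∈ s, c < 2 ^ Nat.clog 2 σ) (hk : Nat.clog 2 σ ≤ w) {a : ℕ} (ha : n ≤ a) :
    S.mem a = 0 := by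
  have h1 := ofDigits_lt_two_pow hlt
  rw [h.mem, Nat.div_eq_of_lt, Nat.zero_mod]
  refine h1.trans_le (Nat.pow_le_pow_right (by norm_num) ?_)
  rw [hs]
  exact Nat.mul_le_mul hk ha

theorem initialChar_zero : initialChar k τ 0 = fun _ => 0 := by
  funext c
  simp [initialChar]

theorem root_within (hp : Params w n k q τ) (hs : s.length = n) (hlt : ∀ c ∈ s, c < 2 ^ k)
    (hc : Consts w n k q τ S) (htab : ∀ x < 2 ^ (q * τ), TableEntry S.mem (48 * n) τ x)
    (hinput : ∀ a < 16 * n, S.mem a = Nat.ofDigits (2 ^ k) s / 2 ^ (w * a) % 2 ^ w)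
    (hzero : ∀ a, n ≤ a → (a < 48 * n ∨ 64 * n ≤ a) → S.mem a = 0) :
    root.Within w S root.time (MainInv w n k q τ s 0) := by
  have hroom := hp.room
  have hn := hp.two_le
  have hLn := hp.pow_L
  have hw : w ≠ 0 := by have := hp.tau_lt; omega
  refine ((Cmd.within_of_pre (Q := fun S' => S'.v .vob = 64 * n ∧ S'.v .vnb = 80 * n ∧
    S'.v .vout = 96 * n ∧ S'.v .vd = 0 ∧ S'.v .ve = 0 ∧ S'.v .vlo = 1 ∧
    S'.mem (16 * n + 2) = 64 * n ∧ S'.mem (16 * n + 3) = n ∧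
    ∀ a, a ≠ 16 * n + 2 → a ≠ 16 * n + 3 → S'.mem a = S.mem a) ?_).frame).mono le_rfl ?_
  · simp [root, Cmd.pre, hc.vn, hc.vdir, hw, Function.update_apply]
    and_intros
    all_goals first | omega | skip
    intro a h1 h2
    rw [if_neg h2, if_neg h1]
  rintro S' ⟨⟨g1, g2, g3, g4, g5, g6, g7, g8, g9⟩, hf⟩
  have hone : nodeChars k s 1 = s := by
    rw [nodeChars_eq (d := 0) (by norm_num) (by norm_num)]
    apply List.filter_eq_self.mpr
    intro c hc
    simp [hlt c hc]
  have h1 : ∀ h, 2 ^ 0 ≤ h → h < 2 ^ (0 + 1) → h = 1 := fun h a b => by simp at a b; omega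
  have hb : buffer n 0 = 64 * n := by simp [buffer]
  refine ⟨hc.of_frame hf (by decide), g4, by simp [g5], by simp [g6], by rw [g1, hb],
    by simp [g2, buffer], g3.ge, by simp [g3], ?_, ?_, ?_, ?_, ?_, fun _ => by rw [g7, hb]⟩
  · rw [initialChar_zero, hb]
    refine ⟨?_, ?_, ?_, ?_, ?_⟩
    · intro h e1 e2; obtain rfl := h1 h e1 e2; rw [hone, hs]; exact g8
    · intro h e1 e2; obtain rfl := h1 h e1 e2; exact g7.ge
    · intro h e1 e2; obtain rfl := h1 h e1 e2
      have := Nat.div_le_self n q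
      rw [g7, hone, hs]; omega
    · intro h h' e1 e2 e3
      have := h1 h e1 (by omega); have := h1 h' (by omega) e3; omega
    · intro h e1 e2; obtain rfl := h1 h e1 e2
      have hz : Nat.ofDigits (2 ^ τ) (s.map fun _ => 0) = 0 :=
        ofDigits_of_forall_eq_zero fun c hc => by
          obtain ⟨_, _, rfl⟩ := List.mem_map.mp hc; rfl
      rw [hone, hs]
      have := Nat.div_le_self n q
      intro i hi
      rw [hz, g7, g9 _ (by omega) (by omega), hzero _ (by omega) (by omega), Nat.zero_div,
        Nat.zero_mod]
  · refine ⟨?_, ?_, ?_, ?_, ?_⟩ <;> intros <;> omega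
  · intro x hx
    obtain ⟨t1, t2, t3, t4⟩ := htab x hx
    refine ⟨?_, ?_, ?_, ?_⟩ <;> rw [g9 _ (by omega) (by omega)] <;> assumption
  · intro a ha; rw [g9 _ (by omega) (by omega), hinput a ha]
  · intro h e1 e2
    rw [g9 _ (by omega) (by omega), hzero _ (by omega) (by omega)]

theorem setup_within (h2 : 2 ≤ σ) (hσ : σ ≤ n) (hw : Nat.clog 2 n + 8 ≤ w) (hs : s.length = n)
    (hlt : ∀ c ∈ s, c < 2 ^ Nat.clog 2 σ) (hI : Input w n σ s S) :
    setup.Within w S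
      (setupTime n (Nat.clog 2 σ) (perCell n) (blockHeight n (Nat.clog 2 σ)))
      (MainInv w n (Nat.clog 2 σ) (perCell n) (blockHeight n (Nat.clog 2 σ)) s 0) := by
  have hp := params h2 hσ hw
  have hroom := hp.room
  have hn := hp.two_le
  unfold setup setupTime
  set k := Nat.clog 2 σ with hk
  set q := perCell n with hq
  have hL := hp.pow_L
  generalize hA : (tableBody.time + 4) * 2 ^ (q * blockHeight n k) = A
  refine within_seq_of (t₂ := 12 * Nat.log 2 n + 16 * q + A + constants.time + root.time + 32)
    (charBits_within h2 hσ hroom hI.vsig) ?_ (by omega)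
  rintro S₁ ⟨hm1, hk1, hpk1⟩ hf1
  refine within_seq_of (t₂ := 16 * q + A + constants.time + root.time + 24)
    (logLength_within hn hroom (by rw [hf1 _ (by decide), hI.vn])) ?_ (by omega)
  rintro S₂ ⟨hm2, hl2⟩ hf2
  refine within_seq_of (t₂ := A + constants.time + root.time + 10)
    (sqrtLog_within hn hroom hl2) ?_ (by omega)
  rintro S₃ ⟨hm3, hq3⟩ hf3
  refine within_seq_of (t₂ := A + root.time + 10) (constants_within (k := k) hp ?_ ?_ ?_ ?_ hq3)
    ?_ (by omega)
  · rw [hf3 _ (by decide), hf2 _ (by decide), hf1 _ (by decide), hI.vn]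
  · rw [hf3 _ (by decide), hf2 _ (by decide), hf1 _ (by decide), hI.vw]
  · rw [hf3 _ (by decide), hf2 _ (by decide), hk1]
  · rw [hf3 _ (by decide), hf2 _ (by decide), hpk1]
  rintro S₄ ⟨hm4, hc4⟩ hf4
  have hm : S₄.mem = S.mem := by rw [hm4, hm3, hm2, hm1]
  have hz : ∀ a, n ≤ a → S.mem a = 0 := fun a => hI.mem_eq_zero hs hlt hp.k_le
  refine within_seq_of (t₂ := root.time)
    (tableLoop_within hp hc4 fun a _ => by rw [hm, hz _ (by omega)]) ?_ (by omega)
  rintro S₅ ⟨htab, hfr⟩ hf5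
  refine root_within hp hs hlt (hc4.of_frame hf5 (by decide)) htab (fun a ha => ?_)
    fun a h1 h3 => ?_
  · rw [hfr a (by omega), hm, hI.mem]
  · rw [hfr a h3, hm, hz a h1]

theorem wavelet_within (h2 : 2 ≤ σ) (hσ : σ ≤ n) (hw : Nat.clog 2 n + 8 ≤ w) (hs : s.length = n)
    (hlt : ∀ c ∈ s, c < 2 ^ Nat.clog 2 σ) (hI : Input w n σ s S) :
    wavelet.Within w S
      (setupTime n (Nat.clog 2 σ) (perCell n) (blockHeight n (Nat.clog 2 σ)) +
        (mainTime n (Nat.clog 2 σ) (perCell n) (blockHeight n (Nat.clog 2 σ)) + 2)) fun S' =>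
      S'.v .vn = 16 * n ∧ ∃ E ≤ 96 * n + n * Nat.clog 2 σ / w + 2 ^ Nat.clog 2 σ,
        Done w n (Nat.clog 2 σ) s S'.mem E (2 ^ Nat.clog 2 σ) := by
  have hp := params h2 hσ hw
  unfold wavelet
  refine within_seq_of (setup_within h2 hσ hw hs hlt hI) ?_ le_rfl
  rintro S₁ hI1 -
  refine within_seq_of (mainLoop_within hp hs hlt hI1) ?_ le_rfl
  rintro S₂ hI2 -
  refine Cmd.within_of_pre (c := .set _ _) ?_
  simp only [Cmd.pre, Expr.ok_var, Expr.val_var, State.v_set, State.mem_set, if_true, true_and]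
  exact ⟨hI2.consts.vdir, _, hI2.out_le, hI2.done⟩

end WaveletRAM

/-! ### The running time -/

namespace WaveletRAM

open WordRAM

/-- The constant factor in the bound for the running time. -/
def timeFactor : ℕ :=
  130 + (tableBody.time + 4) + constants.time + root.time + 2 * fillTime +
    (splitBody.time + 4) + levelTime + 2 * nodeTime

variable {w n k q τ σ : ℕ} {s : List ℕ} {S : State}

theorem mul_self_le_two_pow (l : ℕ) : l * l ≤ 4 * 2 ^ l := by
  have h1 := Nat.lt_two_pow_self (n := l / 2)
  have h2 : l ≤ 2 * 2 ^ (l / 2) := by omega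
  have h3 : 2 ^ (l / 2) * 2 ^ (l / 2) ≤ 2 ^ l := by
    rw [← pow_add]; exact Nat.pow_le_pow_right (by norm_num) (by omega)
  calc l * l ≤ (2 * 2 ^ (l / 2)) * (2 * 2 ^ (l / 2)) := Nat.mul_le_mul h2 h2
    _ = 4 * (2 ^ (l / 2) * 2 ^ (l / 2)) := by ring
    _ ≤ 4 * 2 ^ l := Nat.mul_le_mul_left _ h3

/-- The size of the table. -/
theorem perCell_mul_two_pow_le (hn : 2 ≤ n) (hk : 1 ≤ k) :
    perCell n * 2 ^ (perCell n * min k (perCell n)) ≤ n * k := by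
  have hl : 2 ^ Nat.log 2 n ≤ n := Nat.pow_log_le_self _ (by omega)
  have hqq := perCell_mul_self_le n
  rcases Nat.lt_or_ge k (perCell n) with h | h
  · rw [min_eq_left h.le]
    calc perCell n * 2 ^ (perCell n * k) ≤ 2 ^ perCell n * 2 ^ (perCell n * k) :=
          Nat.mul_le_mul_right _ Nat.lt_two_pow_self.le
      _ = 2 ^ (perCell n * (k + 1)) := by rw [← pow_add]; congr 1; ring
      _ ≤ 2 ^ Nat.log 2 n := Nat.pow_le_pow_right (by norm_num)
          ((Nat.mul_le_mul_left _ h).trans hqq)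
      _ ≤ n := hl
      _ ≤ n * k := Nat.le_mul_of_pos_right n hk
  · rw [min_eq_right h, mul_comm]
    exact Nat.mul_le_mul ((Nat.pow_le_pow_right (by norm_num) hqq).trans hl) h

/-- The number of nodes. -/
theorem perCell_mul_two_pow_clog_le (hn : 2 ≤ n) (hk : 1 ≤ k) (hpk : 2 ^ k ≤ 2 * n) :
    perCell n * 2 ^ k ≤ 2 * (n * k) := by
  have hq := perCell_pos hn
  rcases Nat.lt_or_ge k (perCell n) with h | h
  · have h1 := perCell_mul_two_pow_le hn hk
    rw [min_eq_left h.le] at h1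
    have h2 : 2 ^ k ≤ 2 ^ (perCell n * k) :=
      Nat.pow_le_pow_right (by norm_num) (Nat.le_mul_of_pos_left k hq)
    have := Nat.mul_le_mul_left (perCell n) h2
    omega
  · calc perCell n * 2 ^ k ≤ k * (2 * n) := Nat.mul_le_mul h hpk
      _ = 2 * (n * k) := by ring

/-- The total time for filling the lists: there are `⌈k / τ⌉` blocks, and for each of them
`fillCount n k q` cells or characters are processed. -/
theorem perCell_mul_fillCount_le (hq : 1 ≤ q) (hqn : q ≤ n) (hk : 1 ≤ k) :
    q * (fillCount n k q * ((k + min k q - 1) / min k q)) ≤ 2 * (n * k) := by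
  unfold fillCount
  split_ifs with h
  · rw [min_eq_right h.le]
    have h1 := Nat.mul_div_le (k + q - 1) q
    calc q * (n * ((k + q - 1) / q)) = n * (q * ((k + q - 1) / q)) := by ring
      _ ≤ n * (2 * k) := Nat.mul_le_mul_left _ (by omega)
      _ = 2 * (n * k) := by ring
  · rw [min_eq_left (by omega)]
    have h1 : (k + k - 1) / k = 1 := by
      rw [show k + k - 1 = (k - 1) + k by omega, Nat.add_div_right _ hk,
        Nat.div_eq_of_lt (by omega)]
    have h2 := Nat.mul_div_le n q
    have h3 : n ≤ n * k := Nat.le_mul_of_pos_right n hk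
    rw [h1, mul_one, Nat.mul_succ]
    omega

theorem perCell_mul_time_le (hn : 2 ≤ n) (hk : 1 ≤ k) (hpk : 2 ^ k ≤ 2 * n) :
    perCell n * (setupTime n k (perCell n) (blockHeight n k) +
      (mainTime n k (perCell n) (blockHeight n k) + 2)) ≤ timeFactor * (n * k) := by
  have hq := perCell_pos hn
  have hqq := perCell_mul_self_le n
  have hql : perCell n ≤ perCell n * perCell n := Nat.le_mul_self _
  have hln : Nat.log 2 n < n := Nat.log_lt_self 2 (by omega)
  have hl : 2 ^ Nat.log 2 n ≤ n := Nat.pow_log_le_self _ (by omega)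
  have hnk : n ≤ n * k := Nat.le_mul_of_pos_right n hk
  have h1 : perCell n * k ≤ n * k := Nat.mul_le_mul_right _ (by omega)
  have h2 : perCell n * Nat.log 2 n ≤ 4 * (n * k) := by
    have := mul_self_le_two_pow (Nat.log 2 n)
    have := Nat.mul_le_mul_right (Nat.log 2 n) (hql.trans hqq)
    omega
  have h3 := perCell_mul_two_pow_le hn hk
  have h4 := perCell_mul_two_pow_clog_le hn hk hpk
  have h5 := perCell_mul_fillCount_le (k := k) hq (by omega : perCell n ≤ n) hk
  have h6 : perCell n * (n / perCell n * k) ≤ n * k := by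
    rw [← mul_assoc]; exact Nat.mul_le_mul_right _ (Nat.mul_div_le ..)
  have h7 : perCell n ≤ n * k := by omega
  have h8 : perCell n * perCell n ≤ n * k := by omega
  unfold setupTime mainTime timeFactor blockHeight
  generalize tableBody.time + 4 = A
  generalize constants.time = B
  generalize root.time = C
  generalize fillTime = D
  generalize splitBody.time + 4 = E
  generalize levelTime = F
  generalize nodeTime = G
  have e3 := Nat.mul_le_mul_left A h3
  have e4 := Nat.mul_le_mul_left G h4
  have e5 := Nat.mul_le_mul_left D h5
  have e6 := Nat.mul_le_mul_left E h6
  have e7 := Nat.mul_le_mul_left F h1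
  have e8 := Nat.mul_le_mul_left (B + C) h7
  nlinarith

/-- The bound of `perCell_mul_time_le` in terms of real logarithms. -/
theorem time_le (h2 : 2 ≤ σ) (hσ : σ ≤ n) {t : ℕ}
    (ht : perCell n * t ≤ timeFactor * (n * Nat.clog 2 σ)) :
    (t : ℝ) ≤ 4 * timeFactor * (n * Real.logb 2 σ / Real.sqrt (Real.logb 2 n)) := by
  have hn : 2 ≤ n := h2.trans hσ
  have hq := perCell_pos hn
  have hn' : (1 : ℝ) < n := by exact_mod_cast hn
  have hlog : 0 < Real.logb 2 n := Real.logb_pos (by norm_num) hn'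
  have hsqrt : Real.sqrt (Real.logb 2 n) ≤ 2 * perCell n := by
    rw [Real.sqrt_le_left (by positivity)]
    have h3 : Real.logb 2 n ≤ (Nat.log 2 n + 1 : ℕ) := by
      rw [Real.logb_le_iff_le_rpow (by norm_num) (by positivity), Real.rpow_natCast]
      exact_mod_cast (Nat.lt_pow_succ_log_self (by norm_num) n).le
    have h4 : Nat.log 2 n + 1 ≤ (2 * perCell n) ^ 2 := by
      have h5 : Nat.log 2 n < (perCell n + 1) * (perCell n + 1) := Nat.lt_succ_sqrt _
      nlinarith
    exact h3.trans (by exact_mod_cast h4)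
  have hk : (Nat.clog 2 σ : ℝ) ≤ 2 * Real.logb 2 σ := by
    have h3 : 1 ≤ Real.logb 2 σ := by
      rw [Real.le_logb_iff_rpow_le (by norm_num) (by positivity), Real.rpow_one]
      exact_mod_cast h2
    have h4 : ((Nat.clog 2 σ - 1 : ℕ) : ℝ) ≤ Real.logb 2 σ := by
      rw [Real.le_logb_iff_rpow_le (by norm_num) (by positivity), Real.rpow_natCast]
      have := Nat.clog_pos (b := 2) (by norm_num) h2
      exact_mod_cast (Nat.pow_lt_of_lt_clog (b := 2) (x := σ) (by omega)).le
    have h5 : (Nat.clog 2 σ : ℝ) ≤ ((Nat.clog 2 σ - 1 : ℕ) : ℝ) + 1 := by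
      exact_mod_cast (by omega : Nat.clog 2 σ ≤ Nat.clog 2 σ - 1 + 1)
    linarith
  rw [← mul_div_assoc, le_div_iff₀ (Real.sqrt_pos.mpr hlog)]
  have ht' : (perCell n : ℝ) * t ≤ timeFactor * (n * Nat.clog 2 σ) := by exact_mod_cast ht
  calc (t : ℝ) * Real.sqrt (Real.logb 2 n) ≤ t * (2 * perCell n) := by gcongr
    _ = 2 * (perCell n * t) := by ring
    _ ≤ 2 * (timeFactor * (n * Nat.clog 2 σ)) := by gcongr
    _ ≤ 2 * (timeFactor * (n * (2 * Real.logb 2 σ))) := by gcongr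
    _ = 4 * timeFactor * (n * Real.logb 2 σ) := by ring

/-! ### The output -/

theorem Represents.cell {γ : Config w} (h : Represents γ S) {a : ℕ} (ha : a < 2 ^ w) :
    γ.cell a = S.mem a := by
  rw [Config.cell, h.mem, BitVec.toNat_ofNat, Nat.mod_eq_of_lt ha]

/-- The state that the initial configuration represents. -/
def initialState (w σ : ℕ) (s : List ℕ) : State where
  v x := ((initial w σ s).reg x.idx).toNat
  mem a := Nat.ofDigits (2 ^ Nat.clog 2 σ) s / 2 ^ (w * a) % 2 ^ w

theorem represents_initial (hlt : ∀ c ∈ s, c < 2 ^ Nat.clog 2 σ) :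
    Represents (initial w σ s) (initialState w σ s) :=
  ⟨fun _ => rfl, fun a => by
    simp only [initial, initialState]
    rw [toNat_packedWord, bitsVal_entryBits hlt]⟩

theorem input_initialState (hs : s.length = n) (hn : n < 2 ^ w) (hσ : σ < 2 ^ w) :
    Input w n σ s (initialState w σ s) := by
  refine ⟨?_, ?_, ?_, fun _ => rfl⟩
  · change (BitVec.ofNat w s.length).toNat = n
    rw [hs, BitVec.toNat_ofNat, Nat.mod_eq_of_lt hn]
  · change (BitVec.ofNat w σ).toNat = σ
    rw [BitVec.toNat_ofNat, Nat.mod_eq_of_lt hσ]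
  · change (BitVec.ofNat w w).toNat = w
    rw [BitVec.toNat_ofNat, Nat.mod_eq_of_lt Nat.lt_two_pow_self]

theorem ceilDiv_le (hw : 0 < w) (a : ℕ) : a ⌈/⌉ w ≤ a / w + 1 := by
  rw [Nat.ceilDiv_eq_add_pred_div, ← Nat.add_div_right _ hw]
  exact Nat.div_le_div_right (by omega)

/-- A bitmask whose length is a multiple of `w` has one cell less than `Done` reserves for it. -/
theorem storesBitmasks {γ : Config w} {E : ℕ} (hp : Params w n k q τ)
    (hlt : ∀ c ∈ s, c < 2 ^ k) (hγ : Represents γ S)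
    (hv : S.v .vn = 16 * n) (hE : E ≤ 96 * n + n * k / w + 2 ^ k)
    (hd : Done w n k s S.mem E (2 ^ k)) : γ.StoresBitmasks (waveletTree k s) := by
  have hroom := hp.room
  have hn := hp.two_le
  have hpk := hp.pow_k
  have hw : 0 < w := by have := hp.tau_lt; omega
  have hE' : E < 2 ^ w := by
    have : n * k / w ≤ n := Nat.div_le_of_le_mul (by
      rw [mul_comm w]; exact Nat.mul_le_mul_left _ hp.k_le)
    omega
  have hreg : (γ.reg 0).toNat = 16 * n := by rw [← hv]; exact hγ.reg .vn
  have key : ∀ l B, (waveletTree k s).bitmaskAt l = some B →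
      1 ≤ heapIndex l ∧ heapIndex l < 2 ^ k ∧ B = nodeBits k s (heapIndex l) ∧
      B.length = (nodeChars k s (heapIndex l)).length ∧
      γ.cell (16 * n + 2 * heapIndex l) = S.mem (16 * n + 2 * heapIndex l) := by
    intro l B h
    obtain ⟨h1, h2⟩ := bitmaskAt_eq_some hlt h
    obtain ⟨h3, h4⟩ := heapIndex_mem l
    have h5 : heapIndex l < 2 ^ k :=
      h4.trans_le (Nat.pow_le_pow_right (by norm_num) h1)
    have h6 : B = nodeBits k s (heapIndex l) := by
      rw [h2, nodeBits, nodeChars_eq h3 h4, log_eq h3 h4]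
    exact ⟨Nat.one_le_two_pow.trans h3, h5, h6, by rw [h6, nodeBits, List.length_map],
      hγ.cell (by omega)⟩
  unfold Config.StoresBitmasks
  simp only [hreg]
  refine ⟨fun l B h => ?_, fun l l' B B' h h' hne => ?_⟩
  · obtain ⟨h1, h2, h3, h4, h5⟩ := key l B h
    have hhi := hd.hi _ h1 h2
    have hst := hd.stores _ h1 h2
    have hc := ceilDiv_le hw B.length
    rw [← h3] at hst
    rw [← h4] at hhi hst
    refine ⟨by omega, ?_, ?_⟩
    · rw [hγ.cell (by omega), hd.len _ h1 h2, h4]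
    · rw [h5]
      refine ⟨by omega, fun j hj => ?_⟩
      apply BitVec.eq_of_toNat_eq
      rw [toNat_packedWord, ← hst j (by omega)]
      exact hγ.cell (by omega)
  · obtain ⟨h1, h2, h3, h4, h5⟩ := key l B h
    obtain ⟨g1, g2, g3, g4, g5⟩ := key l' B' h'
    have hc := ceilDiv_le hw B.length
    have gc := ceilDiv_le hw B'.length
    rw [h5, g5, Set.disjoint_left]
    intro a ha ha'
    simp only [Set.mem_Ico] at ha ha'
    rcases Nat.lt_trichotomy (heapIndex l) (heapIndex l') with h | h | h
    · have := hd.sep _ _ h1 h g2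
      rw [← h4] at this
      omega
    · exact hne (heapIndex_injective h)
    · have := hd.sep _ _ g1 h h2
      rw [← g4] at this
      omega

end WaveletRAM

/-- There is one deterministic word-RAM program that, for every string `s` of length `n` over
`[0, σ - 1]` with `2 ≤ σ ≤ n`, given in packed form, and for every word length
`w ≥ log₂ n + O(1)`, builds all bitmasks of the wavelet tree of `s` in
`O(n log σ / √(log n))` steps. -/
theorem mainTheorem1 :
    ∃ (P : WordRAM.Program) (c₀ : ℕ) (C : ℝ),
      ∀ (w n σ : ℕ) (s : List ℕ),
        2 ≤ σ → σ ≤ n → s.length = n → (∀ c ∈ s, c < σ) → Nat.clog 2 n + c₀ ≤ w →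
        ∃ t : ℕ,
          (t : ℝ) ≤ C * (n * Real.logb 2 σ / Real.sqrt (Real.logb 2 n)) ∧
          P.Halted (P.run t (WordRAM.initial w σ s)) ∧
          (P.run t (WordRAM.initial w σ s)).StoresBitmasks (waveletTree (Nat.clog 2 σ) s) := by
  -- the additional eight bits of a word make room for `256 * n` memory cells
  refine ⟨WaveletRAM.wavelet.program, 8, 4 * WaveletRAM.timeFactor, ?_⟩
  intro w n σ s h2 hσ hs hc hw
  have hlt : ∀ c ∈ s, c < 2 ^ Nat.clog 2 σ := fun c h =>
    (hc c h).trans_le (Nat.le_pow_clog (by norm_num) σ)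
  have hp := WaveletRAM.params h2 hσ hw
  have hroom := hp.room
  obtain ⟨S', t, ht, hrun, hv, E, hE, hd⟩ := WaveletRAM.wavelet_within h2 hσ hw hs hlt
    (WaveletRAM.input_initialState hs (by omega) (by omega))
  obtain ⟨hrep, hhalt⟩ := hrun.program (WaveletRAM.represents_initial hlt) rfl
  refine ⟨t, WaveletRAM.time_le h2 hσ ?_, hhalt, WaveletRAM.storesBitmasks hp hlt hrep hv hE hd⟩
  exact (Nat.mul_le_mul_left _ ht).trans
    (WaveletRAM.perCell_mul_time_le hp.two_le hp.k_pos hp.pow_k)
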